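/- \textbf{Lemma (Holomorphic local triviality).} \emph{Setting.} Let $\mathfrak d$ be a real vector space of dimension $n$ and $\Delta=\bigcap_{j=1}^d\{\mu\in\mathfrak d^*\mid\langle\mu,X_j\rangle\ge\lambda_j\}$ an $n$-dimensional convex polytope with $d$ facets, where $X_1,\dots,X_d\ne0$ are inward normals to the facets. Let $Q\subset\mathfrak d$ be a quasilattice (a finitely generated additive subgroup spanning $\mathfrak d$) containing all $X_j$. For an open face $F$ of $\Delta$ put $I_F=\{j\mid\langle\mu,X_j\rangle=\lambda_j\text{ on }F\}$; write $F\le G$ if $F\subseteq\overline G$, i.e. $I_G\subseteq I_F$. A $p$-dimensional face $F$ is singular if $\operatorname{card}I_F>n-p$ and regular if $\operatorname{card} I_F=n-p$. For $J\subseteq\{1,\dots,d\}$ let $\mathbb C^J$, $(\mathbb C^*)^J$, $T^J$ be the coordinate subspace, complex torus and compact torus with indices in $J$ (other coordinates $0$, $0$, $1$ respectively); write $F$, $F^c$ for $I_F$ and its complement. Let $\pi:\mathbb R^d\to\mathfrak d$, $e_j\mapsto X_j$, $\mathfrak n=\ker\pi$, $\exp(Z)=(e^{2\pi iZ_j})_j$,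 $N=\{\exp(x)\mid x\in\mathbb R^d,\ \pi(x)\in Q\}\subset T^d$, $A=\exp(i\mathfrak n)$ and $N_{\mathbb C}=NA$. On $\mathbb C^d_\Delta=\bigcup_F\mathbb C^F\times(\mathbb C^*)^{F^c}$ put $z\sim w$ iff $N(\overline{Az})\cap\overline{Aw}\ne\emptyset$ (closures in $\mathbb C^d_\Delta$); the quotient $X_\Delta=\mathbb C^d_\Delta//N_{\mathbb C}$ has the quotient topology, and $U//N_{\mathbb C}$ denotes the image of $U\subseteq\mathbb C^d_\Delta$ in $X_\Delta$. \emph{Pieces.} For $G$ singular, $\mathcal T_G=\{z\mid\overline{Az}\cap(\mathbb C^*)^{G^c}\neq\emptyset\}//N_{\mathbb C}$; the maximal piece is $\mathcal T_{\max}=\bigl(\bigcup_{G\text{ regular}}\mathbb C^G\times(\mathbb C^*)^{G^c}\bigr)//N_{\mathbb C}$. Let $\mathcal I$ be the family of $I\subseteq\{1,\dots,d\}$ such that $\{X_j\}_{j\in I}$ is a basis of $\mathfrak d$ and $I\subseteq I_\mu$ for a vertex $\mu$, and $\Gamma_I=N\cap T^I$. The piece $\mathcal T_G$ is a complex quasifold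 with charts $(\mathbb C^*)^{B\setminus(B\cap I_G)}\to\mathcal T_G$, for $B\in\mathcal I$ with $\operatorname{card}(B\cap I_G)=n-\dim G$, given by filling in $0$ for $j\in I_G$ and $1$ for $j\notin B\cup I_G$. The piece $\mathcal T_{\max}$ has charts $\tilde V_B\to\mathcal T_{\max}$, $B\in\mathcal I$, given by filling in $1$ for $j\notin B$, where $\tilde V_B\subseteq\mathbb C^B$ is the projection of $\bigl(\mathbb C^B\times(\mathbb C^*)^{B^c}\bigr)\cap\bigcup_{G\text{ regular}}(\mathbb C^*)^{G^c}$. Biholomorphic means: bijective, and whenever a point $a$ of a chart and a point $b$ of a chart represent a point and its image, the map lifts to a biholomorphism from a neighbourhood of $a$ to a neighbourhood of $b$ taking $a$ to $b$. \emph{The cone.} For a face $F$ the same construction, applied to $\mathfrak d_F=\operatorname{Span}\{X_j\mid j\in I_F\}$, the cone $\Sigma_F=\bigcap_{j\in I_F}\{\mu\in\mathfrak d_F^*\mid\langle\mu,X_j\rangle\ge\lambda_j\}$, the vectors $X_j$ $(j\in I_F)$ and $Q\cap\mathfrak d_F$, gives the decomposed space $\mathbb C^F//N^F_{\mathbb C}$.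 \emph{Statement.} Let $F$ be a singular face of dimension $p$, let $I\in\mathcal I$ with $\operatorname{card}(I\cap I_F)=n-p$, and $\check\Gamma_I=\Gamma_I/(\Gamma_I\cap T^F)$, which acts on $(\mathbb C^*)^{I\setminus(I\cap I_F)}\times\mathbb C^F//N^F_{\mathbb C}$ by $[\gamma](w,[z])=(\gamma w,[\gamma z])$. Then: (1) $U_F=((\mathbb C^*)^{F^c}\times\mathbb C^F)//N_{\mathbb C}$ is an open subset of $X_\Delta$ containing $\mathcal T_F$, and filling in $0$ for $j\in I_F$ and $1$ for $j\notin I\cup I_F$ induces a homeomorphism $(\mathbb C^*)^{I\setminus(I\cap I_F)}/\check\Gamma_I\simeq\mathcal T_F$. (2) A subset of $I_F$ is the index set of a singular face of $\Sigma_F$ if and only if it is the index set of a singular face $G$ of $\Delta$ (so $G\ge F$); and for a singular face $G$ of $\Delta$, $\mathcal T_G$ meets $U_F$ if and only if $G\ge F$. (3) There is a homeomorphism $$h_F:\bigl((\mathbb C^*)^{I\setminus(I\cap I_F)}\times\mathbb C^F//N^F_{\mathbb C}\bigr)/\check\Gamma_I\longrightarrow U_F$$ which maps the piece induced by the singular piece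 of $\mathbb C^F//N^F_{\mathbb C}$ with index set $I_G$ biholomorphically onto $\mathcal T_G$, for every singular $G\ge F$, and maps the piece induced by the maximal piece of $\mathbb C^F//N^F_{\mathbb C}$ biholomorphically onto $\mathcal T_{\max}\cap U_F$. Here the charts of a piece of the left-hand side are the products of $(\mathbb C^*)^{I\setminus(I\cap I_F)}$ with the charts of the corresponding piece of $\mathbb C^F//N^F_{\mathbb C}$, followed by the projection. The charts cover the pieces. -/

import Mathlib

open Module

noncomputable section

set_option linter.unusedSectionVars false

/-- A quasilattice in a real vector space: a finitely generated additive subgroup that spans. -/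
def IsQuasilattice {V : Type*} [AddCommGroup V] [Module ℝ V] (Q : AddSubgroup V) : Prop :=
  Q.FG ∧ Submodule.span ℝ (Q : Set V) = ⊤

/-- The input of the quotient construction: vectors `X j` of `V`, constants `lam j` (so that we have
the polyhedron `{μ | ∀ j, lam j ≤ μ (X j)}` in the dual of `V`), and a subgroup `Q` of `V` which
contains the vectors `X j`. -/
structure PolyhedralData (V ι : Type*) [AddCommGroup V] [Module ℝ V] where
  X : ι → V
  lam : ι → ℝ
  Q : AddSubgroup V
  X_mem : ∀ j, X j ∈ Q

namespace PolyhedralData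

section Construction

variable {V ι : Type*} [AddCommGroup V] [Module ℝ V] [Fintype ι] [DecidableEq ι]
variable (D : PolyhedralData V ι)

/-! ### The polyhedron and its faces -/

/-- The polyhedron cut out by the half spaces `⟨μ, X j⟩ ≥ lam j`. -/
def polyhedron : Set (Dual ℝ V) := {μ | ∀ j, D.lam j ≤ μ (D.X j)}

/-- The set of the points of the polyhedron at which exactly the inequalities in `J` are
equalities. If it is nonempty, it is the open face `F` with `I_F = J`. -/
def openFace (J : Finset ι) : Set (Dual ℝ V) :=
  {μ | μ ∈ D.polyhedron ∧ ∀ j, μ (D.X j) = D.lam j ↔ j ∈ J}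

/-- `J` is the index set `I_F` of an open face `F`. A face is always represented by its index set;
the face of `G` is contained in the closure of the face of `H` iff `H ⊆ G`. -/
def IsFace (J : Finset ι) : Prop := (D.openFace J).Nonempty

/-- The dimension of a face. -/
def faceDim (J : Finset ι) : ℕ := finrank ℝ (vectorSpan ℝ (D.openFace J))

/-- A `p`-dimensional face `F` is singular if `card I_F > n - p`. -/
def IsSingularFace (J : Finset ι) : Prop :=
  D.IsFace J ∧ finrank ℝ V < J.card + D.faceDim J

/-- A `p`-dimensional face `F` is regular if `card I_F = n - p`. -/
def IsRegularFace (J : Finset ι) : Prop :=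
  D.IsFace J ∧ J.card + D.faceDim J = finrank ℝ V

/-- The polyhedron is a convex polytope of full dimension, and `j ↦ X j` enumerates, without
repetitions, inward normal vectors of its facets: the `j`-th inequality is the only one
that is an equality on the open facet number `j`. -/
structure IsConvexPolytope : Prop where
  polytope : ∃ S : Set (Dual ℝ V), S.Finite ∧ D.polyhedron = convexHull ℝ S
  full_dim : affineSpan ℝ D.polyhedron = ⊤
  X_ne_zero : ∀ j, D.X j ≠ 0
  facet : ∀ j, D.IsFace {j}

/-- The family of the sets `I` such that `(X j)_{j ∈ I}` is a basis of `V` and `I` is contained in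
the index set of a vertex. -/
def IsBasisSet (I : Finset ι) : Prop :=
  LinearIndependent ℝ (fun j : I => D.X j) ∧
  Submodule.span ℝ (Set.range fun j : I => D.X j) = ⊤ ∧
  ∃ M : Finset ι, D.IsFace M ∧ D.faceDim M = 0 ∧ I ⊆ M

/-! ### The quotient space -/

/-- The union over the faces `F` of `ℂ^F × (ℂ^*)^{F^c}`. -/
def CDelta : Set (ι → ℂ) := {z | ∃ J, D.IsFace J ∧ ∀ j, j ∉ J → z j ≠ 0}

/-- The group `N`: the kernel of the homomorphism `T^d = ℝ^d/ℤ^d → V/Q` induced by `e_j ↦ X j`;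
here `T^d` is the product of circles, and `x ∈ ℝ^d` gives `(exp (2πi x_j))_j`. -/
def N : Subgroup (ι → Circle) where
  carrier := {t | ∃ x : ι → ℝ, ∑ j, x j • D.X j ∈ D.Q ∧
    ∀ j, t j = Circle.exp (2 * Real.pi * x j)}
  one_mem' := ⟨0, by simp [D.Q.zero_mem], by simp⟩
  mul_mem' := by
    rintro s t ⟨x, hx, hs⟩ ⟨y, hy, ht⟩
    refine ⟨x + y, ?_, fun j => ?_⟩
    · simpa [add_smul, Finset.sum_add_distrib] using D.Q.add_mem hx hy
    · simp [hs, ht, mul_add, Circle.exp_add]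
  inv_mem' := by
    rintro s ⟨x, hx, hs⟩
    refine ⟨-x, ?_, fun j => ?_⟩
    · simpa [neg_smul, Finset.sum_neg_distrib] using D.Q.neg_mem hx
    · simp [hs, Circle.exp_neg]

/-- The diagonal action of `T^d` on `ℂ^d`. -/
def torusMul (t : ι → Circle) (z : ι → ℂ) : ι → ℂ := fun j => (t j : ℂ) * z j

/-- The orbit of `z` under the group `A = exp (i 𝔫)`, where `𝔫` is the kernel of `ℝ^d → V`,
`e_j ↦ X j`. -/
def orbitA (z : ι → ℂ) : Set (ι → ℂ) :=
  {w | ∃ Y : ι → ℝ, ∑ j, Y j • D.X j = 0 ∧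
    w = fun j => Complex.exp (2 * Real.pi * Complex.I * (Complex.I * Y j)) * z j}

/-- The closure, in `CDelta`, of the `A`-orbit of `z`. -/
def closureOrbitA (z : ι → ℂ) : Set (ι → ℂ) := closure (D.orbitA z) ∩ D.CDelta

/-- The relation `z ∼ w`, i.e. `N (closure (A z)) ∩ closure (A w) ≠ ∅`, on `CDelta`. -/
def Rel (z w : D.CDelta) : Prop :=
  ∃ u ∈ D.closureOrbitA z, ∃ t ∈ D.N, torusMul t u ∈ D.closureOrbitA w

/-- The space `CDelta // N_ℂ`, with the quotient topology (`N_ℂ = N A`). -/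
def XDelta : Type _ := Quot D.Rel

instance : TopologicalSpace D.XDelta := inferInstanceAs (TopologicalSpace (Quot D.Rel))

/-- The projection `CDelta → CDelta // N_ℂ`. -/
def toQuot (z : D.CDelta) : D.XDelta := Quot.mk _ z

/-- The stratum `T_F` (for a singular face): the image of the set of the points `z` such that the
closure of `A z` meets `(ℂ^*)^{F^c}`. -/
def stratum (J : Finset ι) : Set D.XDelta :=
  D.toQuot '' {z | ∃ u ∈ D.closureOrbitA z, ∀ j, u j = 0 ↔ j ∈ J}

/-- The maximal (regular) piece: the image of the union over the regular faces of
`ℂ^F × (ℂ^*)^{F^c}`. -/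
def regularPiece : Set D.XDelta :=
  D.toQuot '' {z | ∃ J, D.IsRegularFace J ∧ ∀ j, j ∉ J → (z : ι → ℂ) j ≠ 0}

/-- The subset `((ℂ^*)^{F^c} × ℂ^F) // N_ℂ` of `CDelta // N_ℂ`. -/
def nbhd (F : Finset ι) : Set D.XDelta :=
  D.toQuot '' {z | ∀ j, j ∉ F → (z : ι → ℂ) j ≠ 0}

/-! ### The action of `T^d` on the quotient space -/

variable {D} in
theorem torusMul_mem_CDelta (t : ι → Circle) {z : ι → ℂ} (hz : z ∈ D.CDelta) :
    torusMul t z ∈ D.CDelta := by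
  obtain ⟨J, hJ, h⟩ := hz
  exact ⟨J, hJ, fun j hj => mul_ne_zero (Circle.coe_ne_zero _) (h j hj)⟩

variable {D} in
theorem torusMul_mem_closureOrbitA (t : ι → Circle) {z u : ι → ℂ} (hu : u ∈ D.closureOrbitA z) :
    torusMul t u ∈ D.closureOrbitA (torusMul t z) := by
  refine ⟨map_mem_closure (f := torusMul t) ?_ hu.1 ?_, torusMul_mem_CDelta t hu.2⟩
  · unfold torusMul
    fun_prop
  · rintro w ⟨Y, hY, rfl⟩
    refine ⟨Y, hY, ?_⟩
    funext j
    simp only [torusMul]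
    ring

theorem torusMul_mul (s t : ι → Circle) (z : ι → ℂ) :
    torusMul (s * t) z = torusMul s (torusMul t z) := by
  funext j
  simp [torusMul, mul_assoc]

instance : MulAction (ι → Circle) D.XDelta where
  smul t := Quot.map (fun z => ⟨torusMul t z, torusMul_mem_CDelta t z.2⟩) (by
    rintro z w ⟨u, hu, s, hs, hsu⟩
    refine ⟨torusMul t u, torusMul_mem_closureOrbitA t hu, s, hs, ?_⟩
    rw [← torusMul_mul, mul_comm, torusMul_mul]
    exact torusMul_mem_closureOrbitA t hsu)
  one_smul := by
    rintro ⟨z⟩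
    refine congrArg (Quot.mk _) (Subtype.ext ?_)
    funext j
    simp [torusMul]
  mul_smul := by
    rintro s t ⟨z⟩
    exact congrArg (Quot.mk _) (Subtype.ext (torusMul_mul s t z))

theorem smul_toQuot (t : ι → Circle) (z : D.CDelta) :
    t • D.toQuot z = D.toQuot ⟨torusMul t z, torusMul_mem_CDelta t z.2⟩ := rfl

theorem self_mem_closureOrbitA (z : D.CDelta) : (z : ι → ℂ) ∈ D.closureOrbitA z :=
  ⟨subset_closure ⟨0, by simp, by simp⟩, z.2⟩

theorem N_smul (t : ι → Circle) (ht : t ∈ D.N) (x : D.XDelta) : t • x = x := by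
  obtain ⟨z, rfl⟩ := Quot.exists_rep x
  refine (Quot.sound ?_).symm
  exact ⟨z, D.self_mem_closureOrbitA z, t, ht, D.self_mem_closureOrbitA _⟩

/-! ### The cone of a face and the twisted product -/

/-- The data of the cone `Σ_F`: the space `𝔡_F = Span {X j | j ∈ I_F}`, the vectors `X j` and
constants `lam j` with `j ∈ I_F`, and the subgroup `Q ∩ 𝔡_F`. The space `XDelta` of these data
is `ℂ^F // N^F_ℂ`. -/
def cone (F : Finset ι) :
    PolyhedralData (Submodule.span ℝ (D.X '' (F : Set ι))) F where
  X j := ⟨D.X j, Submodule.subset_span ⟨j, j.2, rfl⟩⟩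
  lam j := D.lam j
  Q := D.Q.comap (Submodule.span ℝ (D.X '' (F : Set ι))).subtype.toAddMonoidHom
  X_mem j := D.X_mem j

/-- The subtorus `T^J` of `T^d`. -/
def subtorus (J : Finset ι) : Subgroup (ι → Circle) where
  carrier := {t | ∀ j, j ∉ J → t j = 1}
  one_mem' := fun _ _ => rfl
  mul_mem' := fun hs ht j hj => by simp [hs j hj, ht j hj]
  inv_mem' := fun hs j hj => by simp [hs j hj]

/-- The group `Γ_I = N ∩ T^I`. -/
def Gamma (I : Finset ι) : Subgroup (ι → Circle) := D.N ⊓ subtorus I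

/-- The group `Γ̌_I = Γ_I / (Γ_I ∩ T^F)`. -/
abbrev GammaCheck (F I : Finset ι) : Type _ :=
  D.Gamma I ⧸ (subtorus F).subgroupOf (D.Gamma I)

/-- The complex torus `(ℂ^*)^S`, as an open subset of `ℂ^S`. -/
abbrev PTorus (S : Finset ι) : Type _ := {w : S → ℂ // ∀ j, w j ≠ 0}

/-- The restriction of coordinates `T^d → T^S`. -/
def restrictTorus (S : Finset ι) : (ι → Circle) →* (S → Circle) where
  toFun t j := t j
  map_one' := rfl
  map_mul' _ _ := rfl

instance pTorusAction (S : Finset ι) : MulAction (S → Circle) (PTorus S) where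
  smul t w := ⟨torusMul t w, fun j => mul_ne_zero (Circle.coe_ne_zero _) (w.2 j)⟩
  one_smul w := Subtype.ext (by funext j; simp [HSMul.hSMul, torusMul])
  mul_smul s t w := Subtype.ext (torusMul_mul s t w)

theorem restrictTorus_mem_cone_N (F : Finset ι) {t : ι → Circle} (ht : t ∈ D.N)
    (htF : t ∈ subtorus F) : restrictTorus F t ∈ (D.cone F).N := by
  obtain ⟨x, hx, hxt⟩ := ht
  refine ⟨fun j => x j, ?_, fun j => hxt j⟩
  have hsum : ∑ j ∈ F, x j • D.X j ∈ D.Q := by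
    have h1 := Finset.sum_add_sum_compl F (fun j => x j • D.X j)
    have h2 : ∑ j ∈ Fᶜ, x j • D.X j ∈ D.Q := by
      refine D.Q.sum_mem fun j hj => ?_
      have h3 : Circle.exp (2 * Real.pi * x j) = 1 := by
        rw [← hxt j]
        exact htF j (by simpa using hj)
      rw [Circle.exp_eq_one] at h3
      obtain ⟨m, hm⟩ := h3
      have h4 : x j = m := by
        have : (2 * Real.pi) ≠ 0 := by positivity
        apply mul_left_cancel₀ this
        rw [hm]
        ring
      rw [h4, Int.cast_smul_eq_zsmul]
      exact D.Q.zsmul_mem (D.X_mem j) m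
    have h5 : ∑ j ∈ F, x j • D.X j = ∑ j, x j • D.X j - ∑ j ∈ Fᶜ, x j • D.X j := by
      rw [← h1]
      abel
    rw [h5]
    exact D.Q.sub_mem hx h2
  rw [← Finset.sum_coe_sort] at hsum
  change (((∑ j : F, x j • (D.cone F).X j : Submodule.span ℝ (D.X '' (F : Set ι))) : V)) ∈ D.Q
  simpa [cone] using hsum

/-- The action of `Γ̌_I` on `ℂ^F // N^F_ℂ`: `[γ] [w] = [γ w]`. -/
instance coneAction (F I : Finset ι) : MulAction (D.GammaCheck F I) (D.cone F).XDelta :=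
  MulAction.compHom _ (QuotientGroup.lift ((subtorus F).subgroupOf (D.Gamma I))
    ((MulAction.toPermHom (F → Circle) (D.cone F).XDelta).comp
      ((restrictTorus F).comp (D.Gamma I).subtype)) (by
        intro t ht
        refine Equiv.ext fun x => ?_
        exact (D.cone F).N_smul _ (D.restrictTorus_mem_cone_N F t.2.1 ht) x))

/-- The action of `Γ̌_I` on `(ℂ^*)^{I ∖ (I ∩ I_F)}`: `[γ] z = γ z`. -/
instance baseAction (F I : Finset ι) : MulAction (D.GammaCheck F I) (PTorus (I \ F)) :=
  MulAction.compHom _ (QuotientGroup.lift ((subtorus F).subgroupOf (D.Gamma I))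
    ((MulAction.toPermHom ((I \ F : Finset ι) → Circle) (PTorus (I \ F))).comp
      ((restrictTorus (I \ F)).comp (D.Gamma I).subtype)) (by
        intro t ht
        refine Equiv.ext fun w => Subtype.ext ?_
        funext j
        have h1 : (t : ι → Circle) j = 1 := ht j (Finset.mem_sdiff.1 j.2).2
        change (((t : ι → Circle) j : Circle) : ℂ) * (w : (I \ F : Finset ι) → ℂ) j = _
        rw [h1]
        simp))

theorem coneAction_mk (F I : Finset ι) (t : D.Gamma I) (x : (D.cone F).XDelta) :
    (QuotientGroup.mk t : D.GammaCheck F I) • x = restrictTorus F (t : ι → Circle) • x := rfl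

theorem baseAction_mk (F I : Finset ι) (t : D.Gamma I) (w : PTorus (I \ F)) :
    (QuotientGroup.mk t : D.GammaCheck F I) • w =
      restrictTorus (I \ F) (t : ι → Circle) • w := rfl

/-- The twisted product `((ℂ^*)^{I ∖ (I ∩ I_F)} × ℂ^F // N^F_ℂ) / Γ̌_I`, for the diagonal action. -/
abbrev TwistedProduct (F I : Finset ι) : Type _ :=
  MulAction.orbitRel.Quotient (D.GammaCheck F I) (PTorus (I \ F) × (D.cone F).XDelta)

/-- The projection onto the twisted product. -/
def twistedMk (F I : Finset ι) (a : PTorus (I \ F) × (D.cone F).XDelta) : D.TwistedProduct F I :=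
  Quotient.mk _ a

/-- The subset of the twisted product which is induced by a subset of `ℂ^F // N^F_ℂ`. -/
def twistedPiece (F I : Finset ι) (P : Set (D.cone F).XDelta) : Set (D.TwistedProduct F I) :=
  D.twistedMk F I '' {a | a.2 ∈ P}

end Construction

end PolyhedralData

/-! ### Complex quasifold charts -/

/-- A complex quasifold chart `Ũ/Γ ≃ U ⊆ X`, given by the projection `Ũ → Ũ/Γ ≃ U`, where `Ũ` is a
subset of a finite dimensional complex vector space. The group does not have to be
recorded: its orbits are the fibres of the projection. -/
structure QuasifoldChart.{u, v} (X : Type v) : Type (max (u + 1) v) where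
  E : Type u
  [normedAddCommGroup : NormedAddCommGroup E]
  [normedSpace : NormedSpace ℂ E]
  [finiteDimensional : FiniteDimensional ℂ E]
  dom : Set E
  proj : dom → X

attribute [instance] QuasifoldChart.normedAddCommGroup QuasifoldChart.normedSpace
  QuasifoldChart.finiteDimensional

/-- `f` lifts to local biholomorphisms in the charts `c` and `c'`: whenever `f` takes the image of a
point `a` of the chart `c` to the image of a point `b` of the chart `c'`, there is a biholomorphic
map `e` from a neighbourhood of `a` onto a neighbourhood of `b` such that `e a = b` and `e` lifts
`f`. -/
def LiftsBiholomorphically.{u, v, w} {X : Type v} {Y : Type w} (f : X → Y)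
    (c : QuasifoldChart.{u} X) (c' : QuasifoldChart.{u} Y) : Prop :=
  ∀ (a : c.dom) (b : c'.dom), f (c.proj a) = c'.proj b →
    ∃ e : OpenPartialHomeomorph c.E c'.E, (a : c.E) ∈ e.source ∧ e a = b ∧
      e.source ⊆ c.dom ∧ e.target ⊆ c'.dom ∧
      DifferentiableOn ℂ e e.source ∧ DifferentiableOn ℂ e.symm e.target ∧
      ∀ (x : c.dom) (y : c'.dom), (x : c.E) ∈ e.source → e x = y → f (c.proj x) = c'.proj y

/-- `f` restricts to a bijection of the piece `P` with the piece `P'` which is biholomorphic with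
respect to the atlas `𝒜` of `P` and the atlas `ℬ`. The charts of `ℬ` cover `P'`; their union
may be larger, as `P'` may be an open part of a quasifold. -/
structure IsBiholomorphicOn.{u, v, w} {X : Type v} {Y : Type w} (f : X → Y)
    (P : Set X) (𝒜 : Set (QuasifoldChart.{u} X)) (P' : Set Y) (ℬ : Set (QuasifoldChart.{u} Y)) :
    Prop where
  bijOn : Set.BijOn f P P'
  cover : ⋃ c ∈ 𝒜, Set.range c.proj = P
  cover' : P' ⊆ ⋃ c' ∈ ℬ, Set.range c'.proj
  lifts : ∀ c ∈ 𝒜, ∀ c' ∈ ℬ, LiftsBiholomorphically f c c'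

namespace PolyhedralData

section Charts

variable {V ι : Type*} [AddCommGroup V] [Module ℝ V] [Fintype ι] [DecidableEq ι]
variable (D : PolyhedralData V ι)

/-- The point of `ℂ^d` with coordinates `w j` for `j ∈ S`, `0` for the other `j ∈ J`, and `1`
elsewhere. -/
def slicePoint (S J : Finset ι) (w : S → ℂ) : ι → ℂ :=
  fun j => if h : j ∈ S then w ⟨j, h⟩ else if j ∈ J then 0 else 1

variable {D} in
theorem slicePoint_mem_CDelta {J : Finset ι} (hJ : D.IsFace J) (B : Finset ι)
    (w : PTorus (B \ J)) : slicePoint (B \ J) J w ∈ D.CDelta := by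
  refine ⟨J, hJ, fun j hj => ?_⟩
  unfold slicePoint
  split_ifs with h
  · exact w.2 _
  · exact one_ne_zero

/-- The chart `(ℂ^*)^{B ∖ (B ∩ J)} / Γ̌_B` of the stratum of a face `J`. -/
def stratumChart (J : Finset ι) (hJ : D.IsFace J) (B : Finset ι) : QuasifoldChart D.XDelta where
  E := (B \ J : Finset ι) → ℂ
  dom := {w | ∀ j, w j ≠ 0}
  proj w := D.toQuot ⟨slicePoint (B \ J) J w.1, slicePoint_mem_CDelta hJ B w⟩

/-- The atlas of the stratum of a face `J` of dimension `p`: there is a chart for each index set `B`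
of a basis (see `IsBasisSet`) such that `card (B ∩ J) = n - p`. -/
def stratumAtlas (J : Finset ι) (hJ : D.IsFace J) : Set (QuasifoldChart D.XDelta) :=
  {c | ∃ B, D.IsBasisSet B ∧ (B ∩ J).card + D.faceDim J = finrank ℝ V ∧
    c = D.stratumChart J hJ B}

/-- The chart `Ṽ_B / Γ_B` of the regular piece, where `Ṽ_B ⊆ ℂ^B` is the projection of the set of
the points of `ℂ^B × (ℂ^*)^{B^c}` that lie in `(ℂ^*)^{F^c}` for a regular face `F`. -/
def regularChart (B : Finset ι) : QuasifoldChart D.XDelta where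
  E := B → ℂ
  dom := {w | ∃ J, D.IsRegularFace J ∧ ∀ j, slicePoint B ∅ w j = 0 ↔ j ∈ J}
  proj w := D.toQuot ⟨slicePoint B ∅ w.1, by
    obtain ⟨J, hJ, h⟩ := w.2
    exact ⟨J, hJ.1, fun j hj h0 => hj ((h j).1 h0)⟩⟩

/-- The atlas of the regular piece. -/
def regularAtlas : Set (QuasifoldChart D.XDelta) :=
  {c | ∃ B, D.IsBasisSet B ∧ c = D.regularChart B}

/-- The chart of the twisted product which is induced by a chart `Ũ/Γ` of a piece of `ℂ^F // N^F_ℂ`: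
the projection from `(ℂ^*)^{I ∖ (I ∩ I_F)} × Ũ`. -/
def twistedChart (F I : Finset ι) (c : QuasifoldChart (D.cone F).XDelta) :
    QuasifoldChart (D.TwistedProduct F I) where
  E := ((I \ F : Finset ι) → ℂ) × c.E
  dom := {a | (∀ j, a.1 j ≠ 0) ∧ a.2 ∈ c.dom}
  proj a := D.twistedMk F I (⟨a.1.1, a.2.1⟩, c.proj ⟨a.1.2, a.2.2⟩)

end Charts

end PolyhedralData

end

noncomputable section

set_option linter.unusedSectionVars false

namespace PolyhedralData

/-! ### Faces and the smallest face containing the zero set of a point. -/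

section Faces

variable {V ι : Type*} [AddCommGroup V] [Module ℝ V] [Fintype ι] [DecidableEq ι]
variable (D : PolyhedralData V ι)

/-! The relation on `CDelta` is governed by the hull of a point `z`, the index set of the smallest
face containing the zero set of `z`. By Stiemke's lemma there is a one-parameter subgroup of `A`
that contracts all coordinates in the hull to zero and fixes the others
(`exists_contracting_relation`). Conversely, monomials `∏ |w_j| ^ ξ(X_j)` invariant under `A` show
that a limit of `A z` inside `CDelta` has the same hull and differs from `z` outside of it by an
element of `A` (`eq_of_mem_closureOrbitA`). So two points are identified iff they have the same hull
and, off the hull, differ by an element of `N_ℂ` (`rel_iff_hullRel`). Strata are then the level sets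
of the hull, `nbhd F` is the set where the hull lies in `F`, and the regular piece is the set where
the hull is a regular face.

The space of directions of a face is the annihilator of the vectors `X j` that define it. Hence
singularity of a face is linear dependence of these vectors, the condition on `I` says that `I ∩ F`
spans the same subspace as `F`, and the faces of the cone are the faces of the polytope with index
set inside `F` (`cone_isFace_iff`).

The trivialization sends `(w, [v])` to the class of the point with coordinates `v` in `F`, `w` in `I
\ F` and `1` elsewhere. It is onto because the exponents of an element of `N_ℂ` can be prescribed
freely outside the basis `I`, so that every point can be normalised to `1` outside `F ∪ I`; choosing
the logarithms continuously gives continuity of the inverse. The remaining identifications come from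
`Γ_I` and the relation of the cone (`exists_gamma_of_toQuot_fill_eq`), because the `X j` with `j ∈ I
\ F` are independent modulo the span of `F`. The stratum of `F` corresponds to the apex of the cone.

For biholomorphy, a chart of the cone with basis `B`, multiplied by the torus, is up to a
permutation of coordinates a restriction of the chart of the polytope with basis `(I \ F) ∪ B`
(`glue`). It remains to compare two charts of one piece of the polytope. In logarithmic coordinates
for the nonvanishing coordinates the transition is a linear change of basis, and the vanishing
coordinates are multiplied by the exponential factors that this change forces on them
(`exists_local_biholomorphism`). -/

variable {D} in
theorem lt_of_mem_openFace {J : Finset ι} {μ : Dual ℝ V} (hμ : μ ∈ D.openFace J) {j : ι}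
    (hj : j ∉ J) : D.lam j < μ (D.X j) :=
  lt_of_le_of_ne (hμ.1 j) fun h => hj ((hμ.2 j).1 h.symm)

variable {D} in
theorem mem_openFace_of {J : Finset ι} {μ : Dual ℝ V} (h1 : ∀ j ∈ J, μ (D.X j) = D.lam j)
    (h2 : ∀ j, j ∉ J → D.lam j < μ (D.X j)) : μ ∈ D.openFace J := by
  refine ⟨fun j => ?_, fun j => ⟨fun h => ?_, h1 j⟩⟩
  · by_cases hj : j ∈ J
    · exact (h1 j hj).ge
    · exact (h2 j hj).le
  · by_contra hj
    exact (h2 j hj).ne' h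

variable {D} in
-- At the midpoint of a point of each face, an inequality is tight iff it is tight at both points.
theorem IsFace.inter {J K : Finset ι} (hJ : D.IsFace J) (hK : D.IsFace K) : D.IsFace (J ∩ K) := by
  obtain ⟨μ, hμ⟩ := hJ
  obtain ⟨ν, hν⟩ := hK
  refine ⟨(1 / 2 : ℝ) • μ + (1 / 2 : ℝ) • ν, mem_openFace_of (fun j hj => ?_) fun j hj => ?_⟩
  · rw [Finset.mem_inter] at hj
    have h1 := (hμ.2 j).2 hj.1
    have h2 := (hν.2 j).2 hj.2
    simp only [LinearMap.add_apply, LinearMap.smul_apply, smul_eq_mul]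
    linarith
  · have h1 := hμ.1 j
    have h2 := hν.1 j
    simp only [LinearMap.add_apply, LinearMap.smul_apply, smul_eq_mul]
    by_cases hjJ : j ∈ J
    · have := lt_of_mem_openFace hν fun h => hj (Finset.mem_inter.2 ⟨hjJ, h⟩)
      linarith
    · have := lt_of_mem_openFace hμ hjJ
      linarith

variable {D} in
/-- Moving from a point of an open face in a direction that points into the polyhedron. -/
theorem exists_perturbation_mem_openFace {J K : Finset ι} {μ ξ : Dual ℝ V}
    (hμ : μ ∈ D.openFace J) (hKJ : K ⊆ J) (h0 : ∀ j ∈ K, ξ (D.X j) = 0)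
    (hpos : ∀ j ∈ J, j ∉ K → 0 < ξ (D.X j)) :
    ∃ ε : ℝ, 0 < ε ∧ μ + ε • ξ ∈ D.openFace K := by
  have h1 : ∀ᶠ ε in nhdsWithin (0 : ℝ) (Set.Ioi 0), ∀ j, j ∉ J →
      D.lam j < μ (D.X j) + ε * ξ (D.X j) := by
    rw [Filter.eventually_all]
    intro j
    by_cases hj : j ∈ J
    · simp [hj]
    · have hc : ContinuousAt (fun ε : ℝ => μ (D.X j) + ε * ξ (D.X j)) 0 := by fun_prop
      have := hc.eventually_const_lt (u := D.lam j) (by simpa using lt_of_mem_openFace hμ hj)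
      exact (this.filter_mono nhdsWithin_le_nhds).mono fun ε h _ => h
  obtain ⟨ε, hε, hε0⟩ := (h1.and self_mem_nhdsWithin).exists
  refine ⟨ε, hε0, mem_openFace_of (fun j hj => ?_) fun j hj => ?_⟩
  · simp [(hμ.2 j).2 (hKJ hj), h0 j hj]
  · simp only [LinearMap.add_apply, LinearMap.smul_apply, smul_eq_mul]
    by_cases hjJ : j ∈ J
    · rw [(hμ.2 j).2 hjJ]
      have := mul_pos hε0 (hpos j hjJ hj)
      linarith
    · exact hε j hjJ

open Classical in
/-- The index set of the smallest face which contains the zero set of `z`. -/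
def hull (z : ι → ℂ) : Finset ι :=
  Finset.univ.filter fun j => ∀ J, D.IsFace J → (∀ i, i ∉ J → z i ≠ 0) → j ∈ J

theorem mem_hull_iff {z : ι → ℂ} {j : ι} :
    j ∈ D.hull z ↔ ∀ J, D.IsFace J → (∀ i, i ∉ J → z i ≠ 0) → j ∈ J := by
  simp [hull]

variable {D} in
theorem hull_subset {z : ι → ℂ} {J : Finset ι} (hJ : D.IsFace J) (h : ∀ i, i ∉ J → z i ≠ 0) :
    D.hull z ⊆ J := fun _ hj => D.mem_hull_iff.1 hj J hJ h

theorem ne_zero_of_notMem_hull {z : ι → ℂ} {j : ι} (hj : j ∉ D.hull z) : z j ≠ 0 := by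
  intro h0
  refine hj (D.mem_hull_iff.2 fun J _ h => ?_)
  by_contra hjJ
  exact h j hjJ h0

theorem mem_hull_of_eq_zero {z : ι → ℂ} {j : ι} (hj : z j = 0) : j ∈ D.hull z := by
  by_contra h
  exact D.ne_zero_of_notMem_hull h hj

variable {D} in
-- Admissible index sets are closed under intersection, so a minimal one is the least one, and it is
-- the hull.
theorem isFace_hull {z : ι → ℂ} (hz : z ∈ D.CDelta) : D.IsFace (D.hull z) := by
  obtain ⟨J, hJ, hmin⟩ := WellFounded.has_min (r := ((· < ·) : Finset ι → Finset ι → Prop))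
    wellFounded_lt {J | D.IsFace J ∧ ∀ j, j ∉ J → z j ≠ 0} hz
  have : D.hull z = J := by
    refine (hull_subset hJ.1 hJ.2).antisymm fun j hj => ?_
    refine D.mem_hull_iff.2 fun K hK h => ?_
    by_contra hjK
    refine hmin (J ∩ K) ⟨hJ.1.inter hK, fun i hi => ?_⟩ ?_
    · rw [Finset.mem_inter, not_and_or] at hi
      exact hi.elim (hJ.2 i) (h i)
    · refine Finset.ssubset_iff_subset_ne.2 ⟨Finset.inter_subset_left, fun h' => hjK ?_⟩
      rw [← h'] at hj
      exact (Finset.mem_inter.1 hj).2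
  rw [this]
  exact hJ.1

theorem hull_congr {z w : ι → ℂ} (h : ∀ j, z j = 0 ↔ w j = 0) : D.hull z = D.hull w := by
  ext j
  simp only [mem_hull_iff, ne_eq, h]

variable {D} in
theorem hull_eq_of_zeros {z : ι → ℂ} {J : Finset ι} (hJ : D.IsFace J)
    (h : ∀ j, z j = 0 ↔ j ∈ J) : D.hull z = J :=
  (hull_subset hJ fun i hi h0 => hi ((h i).1 h0)).antisymm fun j hj =>
    D.mem_hull_of_eq_zero ((h j).2 hj)

variable {D} in
theorem hull_eq_of_between {z u : ι → ℂ} (hz : z ∈ D.CDelta) (h1 : ∀ j, z j = 0 → u j = 0)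
    (h2 : ∀ j, u j = 0 → j ∈ D.hull z) : D.hull u = D.hull z := by
  refine (hull_subset (isFace_hull hz) fun i hi h0 => hi (h2 i h0)).antisymm fun j hj => ?_
  refine D.mem_hull_iff.2 fun K hK h => ?_
  exact hull_subset hK (fun i hi h0 => h i hi (h1 i h0)) hj

end Faces

/-! ### A theorem of the alternative for positive linear relations. -/

section Stiemke

/-- Stiemke's lemma: if a linear form which is nonnegative on the vectors `x i` has to vanish
on them, then there is a linear relation between the `x i` with positive coefficients. -/
theorem exists_pos_relation {W τ : Type*} [AddCommGroup W] [Module ℝ W] [Fintype τ]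
    (x : τ → W) (h : ∀ ξ : Dual ℝ W, (∀ i, 0 ≤ ξ (x i)) → ∀ i, ξ (x i) = 0) :
    ∃ y : τ → ℝ, (∀ i, 0 < y i) ∧ ∑ i, y i • x i = 0 := by
  classical
  set φ : (τ → ℝ) →ₗ[ℝ] W := Fintype.linearCombination ℝ x with hφ
  have hφa : ∀ y, φ y = ∑ i, y i • x i := fun y => rfl
  by_contra hno
  have hdisj : Disjoint (Set.pi Set.univ fun _ : τ => Set.Ioi (0 : ℝ))
      (LinearMap.ker φ : Set (τ → ℝ)) := by
    rw [Set.disjoint_left]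
    intro y hy hk
    exact hno ⟨y, fun i => hy i trivial, hk⟩
  -- If the open positive orthant misses the relations, a functional `f` separates them. It is
  -- bounded below on a subspace, hence zero there, and is nonpositive on the unit vectors. So `-f`
  -- factors through `φ` as a form `ξ` to which the hypothesis applies, which forces `f = 0` on the
  -- unit vectors, against strict separation.
  obtain ⟨f, u, hf1, hf2⟩ := geometric_hahn_banach_open
    (convex_pi fun _ _ => convex_Ioi (0 : ℝ)) (isOpen_set_pi Set.finite_univ fun _ _ => isOpen_Ioi)
    (Submodule.convex (LinearMap.ker φ)) hdisj
  have hu : u ≤ 0 := by simpa using hf2 0 (LinearMap.ker φ).zero_mem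
  have hker : ∀ y ∈ LinearMap.ker φ, f y = 0 := by
    intro y hy
    by_contra hne
    have := hf2 (((u - 1) / f y) • y) ((LinearMap.ker φ).smul_mem _ hy)
    rw [map_smul, smul_eq_mul, div_mul_cancel₀ _ hne] at this
    linarith
  have hneg : ∀ i, f (Pi.single i 1) ≤ 0 := by
    intro i
    by_contra! hpos
    -- The multiple of the unit vector is chosen so that `f` takes the value `f 1 + |f 1| ≥ 0` on
    -- this point of the orthant, whereas it should be less than `u ≤ 0`.
    have h1 : (fun _ => (1 : ℝ)) + (|f fun _ => (1 : ℝ)| / f (Pi.single i 1)) • Pi.single i (1 : ℝ) ∈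
        Set.pi Set.univ fun _ : τ => Set.Ioi (0 : ℝ) := by
      intro j _
      simp only [Pi.add_apply, Pi.smul_apply, smul_eq_mul, Set.mem_Ioi]
      have h2 : (0 : ℝ) ≤ (Pi.single i (1 : ℝ) : τ → ℝ) j := by
        rw [Pi.single_apply]
        split_ifs <;> norm_num
      positivity
    have h2 := hf1 _ h1
    rw [map_add, map_smul, smul_eq_mul, div_mul_cancel₀ _ hpos.ne'] at h2
    linarith [neg_abs_le (f fun _ => (1 : ℝ))]
  have hfmem : (-f : Dual ℝ (τ → ℝ)) ∈ LinearMap.range φ.dualMap := by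
    rw [LinearMap.range_dualMap_eq_dualAnnihilator_ker, Submodule.mem_dualAnnihilator]
    intro y hy
    simpa using hker y hy
  obtain ⟨ξ, hξ⟩ := hfmem
  have hξx : ∀ i, ξ (x i) = - f (Pi.single i 1) := by
    intro i
    have := LinearMap.congr_fun hξ (Pi.single i 1)
    simpa [hφ, Fintype.linearCombination_apply_single] using this
  have hz := h ξ fun i => by rw [hξx]; linarith [hneg i]
  have h1 : f (fun _ => (1 : ℝ)) = 0 := by
    have : (fun _ => (1 : ℝ)) = ∑ i : τ, Pi.single i (1 : ℝ) := by
      rw [Finset.univ_sum_single]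
    rw [this, map_sum]
    refine Finset.sum_eq_zero fun i _ => ?_
    have := hz i
    rw [hξx] at this
    linarith
  have h2 := hf1 (fun _ => (1 : ℝ)) fun i _ => by simp
  linarith

/-- Expressing an element of a span through a function on the ambient index type. -/
theorem exists_sum_eq_of_mem_span {W ι : Type*} [AddCommGroup W] [Module ℝ W] [Fintype ι]
    [DecidableEq ι] (x : ι → W) (S : Finset ι) {v : W}
    (hv : v ∈ Submodule.span ℝ (x '' (S : Set ι))) :
    ∃ a : ι → ℝ, (∀ j, j ∉ S → a j = 0) ∧ ∑ j, a j • x j = v := by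
  obtain ⟨l, hl, rfl⟩ := (Finsupp.mem_span_image_iff_linearCombination ℝ).1 hv
  refine ⟨l, fun j hj => ?_, ?_⟩
  · by_contra h0
    exact hj (hl (Finsupp.mem_support_iff.2 h0))
  · rw [Finsupp.linearCombination_apply, Finsupp.sum_fintype _ _ (by simp)]

end Stiemke

/-! ### Relations that contract the hull. -/

section Closure

variable {V ι : Type*} [AddCommGroup V] [Module ℝ V] [Fintype ι] [DecidableEq ι]
variable (D : PolyhedralData V ι)

/-- The span of the vectors `X j` with `j ∈ J`. -/
abbrev spanX (J : Finset ι) : Submodule ℝ V := Submodule.span ℝ (D.X '' (J : Set ι))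

variable {D} in
theorem X_mem_spanX {J : Finset ι} {j : ι} (hj : j ∈ J) : D.X j ∈ D.spanX J :=
  Submodule.subset_span ⟨j, hj, rfl⟩

theorem sum_smul_mem_spanX {J : Finset ι} {y : ι → ℝ} (hy : ∀ j, j ∉ J → y j = 0) :
    ∑ j, y j • D.X j ∈ D.spanX J := by
  refine Submodule.sum_mem _ fun j _ => ?_
  by_cases hj : j ∈ J
  · exact Submodule.smul_mem _ _ (X_mem_spanX hj)
  · simp [hy j hj]

variable {D} in
-- Stiemke's lemma is applied modulo the span of the vectors whose coordinate already vanishes,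
-- since the signs of `Y` are irrelevant there. Its hypothesis is the minimality of the hull: a form
-- that is nonnegative on the hull vectors and not identically zero on them would push a point of
-- the face into a strictly larger face still containing the zero set.
theorem exists_contracting_relation {z : ι → ℂ} (hz : z ∈ D.CDelta) :
    ∃ Y : ι → ℝ, ∑ j, Y j • D.X j = 0 ∧ (∀ j ∈ D.hull z, z j ≠ 0 → 0 < Y j) ∧
      ∀ j, j ∉ D.hull z → Y j = 0 := by
  classical
  set J := D.hull z
  have hJ : D.IsFace J := isFace_hull hz
  let Z : Finset ι := J.filter fun j => z j = 0
  let W := D.spanX Z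
  obtain ⟨y, hy, hsum⟩ := exists_pos_relation
    (fun j : ↥(J \ Z) => W.mkQ (D.X j)) (by
      intro ξ hξ
      obtain ⟨μ, hμ⟩ := hJ
      let K := J.filter fun j => ξ (W.mkQ (D.X j)) = 0
      have hZ : ∀ j ∈ Z, ξ (W.mkQ (D.X j)) = 0 := fun j hj => by
        rw [Submodule.mkQ_apply, (Submodule.Quotient.mk_eq_zero W).2 (X_mem_spanX hj), map_zero]
      obtain ⟨ε, -, hε⟩ := exists_perturbation_mem_openFace (K := K) (ξ := ξ ∘ₗ W.mkQ) hμ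
        (Finset.filter_subset _ _) (fun j hj => (Finset.mem_filter.1 hj).2) (by
          intro j hj hjK
          have h0 : ξ (W.mkQ (D.X j)) ≠ 0 := fun h => hjK (Finset.mem_filter.2 ⟨hj, h⟩)
          have hjZ : j ∉ Z := fun h => h0 (hZ j h)
          exact lt_of_le_of_ne (hξ ⟨j, Finset.mem_sdiff.2 ⟨hj, hjZ⟩⟩) h0.symm)
      have hsub : J ⊆ K := hull_subset ⟨_, hε⟩ fun i hi h0 => by
        have hiJ : i ∈ J := D.mem_hull_of_eq_zero h0
        exact hi (Finset.mem_filter.2 ⟨hiJ, hZ i (Finset.mem_filter.2 ⟨hiJ, h0⟩)⟩)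
      intro j
      exact (Finset.mem_filter.1 (hsub (Finset.mem_sdiff.1 j.2).1)).2)
  have hmem : ∑ j : ↥(J \ Z), y j • D.X j ∈ W := by
    rw [← Submodule.Quotient.mk_eq_zero, ← Submodule.mkQ_apply, map_sum]
    simpa using hsum
  obtain ⟨a, ha, hasum⟩ := exists_sum_eq_of_mem_span D.X Z hmem
  refine ⟨fun j => (if h : j ∈ J \ Z then y ⟨j, h⟩ else 0) - a j, ?_, ?_, ?_⟩
  · simp only [sub_smul, Finset.sum_sub_distrib, hasum]
    rw [sub_eq_zero, ← Finset.sum_subset (Finset.subset_univ (J \ Z)), ← Finset.sum_coe_sort]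
    · exact Finset.sum_congr rfl fun j _ => by rw [dif_pos j.2]
    · intro j _ hj
      rw [dif_neg hj, zero_smul]
  · intro j hj hzj
    have hjZ : j ∉ Z := fun h => hzj (Finset.mem_filter.1 h).2
    beta_reduce
    rw [dif_pos (Finset.mem_sdiff.2 ⟨hj, hjZ⟩), ha j hjZ, sub_zero]
    exact hy _
  · intro j hj
    beta_reduce
    rw [dif_neg fun h => hj (Finset.mem_sdiff.1 h).1, ha j fun h => hj (Finset.mem_filter.1 h).1,
      sub_zero]

end Closure

/-! ### The exponential normalised to have the integers as kernel. -/

section Exponential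

/-- The exponential `ξ ↦ exp (2πi ξ)`. -/
def cexp (ξ : ℂ) : ℂ := Complex.exp (2 * Real.pi * Complex.I * ξ)

theorem cexp_zero : cexp 0 = 1 := by simp [cexp]

theorem cexp_add (ξ η : ℂ) : cexp (ξ + η) = cexp ξ * cexp η := by
  simp [cexp, mul_add, Complex.exp_add]

theorem cexp_neg (ξ : ℂ) : cexp (-ξ) = (cexp ξ)⁻¹ := by
  simp [cexp, Complex.exp_neg]

theorem cexp_sub (ξ η : ℂ) : cexp (ξ - η) = cexp ξ / cexp η := by
  rw [sub_eq_add_neg, cexp_add, cexp_neg, div_eq_mul_inv]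

theorem cexp_ne_zero (ξ : ℂ) : cexp ξ ≠ 0 := Complex.exp_ne_zero _

theorem exists_cexp_eq {z : ℂ} (hz : z ≠ 0) : ∃ ξ, cexp ξ = z :=
  ⟨Complex.log z / (2 * Real.pi * Complex.I), by
    rw [cexp, mul_div_cancel₀ _ Complex.two_pi_I_ne_zero, Complex.exp_log hz]⟩

theorem cexp_eq_one_iff {ξ : ℂ} : cexp ξ = 1 ↔ ∃ m : ℤ, ξ = m := by
  rw [cexp, Complex.exp_eq_one_iff]
  refine exists_congr fun m => ?_
  rw [mul_comm (m : ℂ), mul_right_inj' Complex.two_pi_I_ne_zero]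

theorem coe_circle_exp (x : ℝ) : (Circle.exp (2 * Real.pi * x) : ℂ) = cexp x := by
  rw [Circle.coe_exp, cexp]
  congr 1
  push_cast
  ring

theorem cexp_I_mul (y : ℝ) : cexp (Complex.I * y) = (Real.exp (-(2 * Real.pi * y)) : ℝ) := by
  rw [cexp, Complex.ofReal_exp]
  congr 1
  push_cast
  linear_combination (2 * Real.pi * y : ℂ) * Complex.I_mul_I

end Exponential

/-! ### Closures of orbits, and the relation in terms of hulls. -/

section Closure

variable {V ι : Type*} [AddCommGroup V] [Module ℝ V] [Fintype ι] [DecidableEq ι]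
variable (D : PolyhedralData V ι)

variable {D} in
-- This is the limit along `Y + s Y'` as `s → ∞`, where `Y'` is a contracting relation: the
-- coordinates in the hull decay, and the others do not depend on `s`.
theorem collapse_mem_closureOrbitA {z : ι → ℂ} (hz : z ∈ D.CDelta) {Y : ι → ℝ}
    (hY : ∑ j, Y j • D.X j = 0) :
    (fun j => if j ∈ D.hull z then 0 else cexp (Complex.I * Y j) * z j) ∈ D.closureOrbitA z := by
  obtain ⟨Y', hY', hpos, hzero⟩ := exists_contracting_relation hz
  refine ⟨?_, D.hull z, isFace_hull hz, fun j hj => ?_⟩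
  · refine mem_closure_of_tendsto (b := Filter.atTop)
      (f := fun s : ℝ => fun j => cexp (Complex.I * (Y j + s * Y' j : ℝ)) * z j) ?_
      (Filter.Eventually.of_forall fun s => ⟨fun j => Y j + s * Y' j, ?_, rfl⟩)
    · rw [tendsto_pi_nhds]
      intro j
      split_ifs with hj
      · by_cases hzj : z j = 0
        · simp [hzj]
        · simp only [cexp_I_mul]
          rw [← zero_mul (z j)]
          refine Filter.Tendsto.mul_const _ ?_
          rw [← Complex.ofReal_zero]
          refine (Complex.continuous_ofReal.tendsto 0).comp ?_
          refine Real.tendsto_exp_atBot.comp ?_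
          refine Filter.tendsto_neg_atTop_atBot.comp ?_
          refine Filter.Tendsto.const_mul_atTop (by positivity) ?_
          exact Filter.tendsto_atTop_add_const_left _ _
            (Filter.tendsto_id.atTop_mul_const (hpos j hj hzj))
      · simp [hzero j hj]
    · simp only [add_smul, mul_smul, Finset.sum_add_distrib, ← Finset.smul_sum, hY, hY']
      simp
  · beta_reduce
    rw [if_neg hj]
    exact mul_ne_zero (cexp_ne_zero _) (D.ne_zero_of_notMem_hull hj)

variable {D} in
-- Applying `ξ` to a relation `Y` gives `∑ Y_j ξ(X_j) = 0`, so the monomial is constant on the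
-- orbit. The sign condition on the exponents where `u` vanishes is what makes it continuous at `u`.
theorem prod_rpow_eq_of_mem_closure {z u : ι → ℂ}
    (hu : u ∈ closure (D.orbitA z)) {ξ : Dual ℝ V} (hξ : ∀ j ∈ D.hull z, ξ (D.X j) = 0)
    (hξu : ∀ j, u j ≠ 0 ∨ 0 ≤ ξ (D.X j)) :
    ∏ j ∈ (D.hull z)ᶜ, ‖u j‖ ^ ξ (D.X j) = ∏ j ∈ (D.hull z)ᶜ, ‖z j‖ ^ ξ (D.X j) := by
  have hc : ContinuousAt (fun w : ι → ℂ => ∏ j ∈ (D.hull z)ᶜ, ‖w j‖ ^ ξ (D.X j)) u := by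
    refine tendsto_finsetProd _ fun j _ => ?_
    have h1 : ContinuousAt (fun w : ι → ℂ => ‖w j‖) u :=
      (continuous_apply j).norm.continuousAt
    exact h1.rpow_const ((hξu j).imp (fun h => norm_ne_zero_iff.2 h) id)
  have h1 := hc.continuousWithinAt.mem_closure_image hu
  have h2 : (fun w : ι → ℂ => ∏ j ∈ (D.hull z)ᶜ, ‖w j‖ ^ ξ (D.X j)) '' D.orbitA z ⊆
      {∏ j ∈ (D.hull z)ᶜ, ‖z j‖ ^ ξ (D.X j)} := by
    rintro _ ⟨w, ⟨Y, hY, rfl⟩, rfl⟩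
    have h3 : ∀ j, ‖Complex.exp (2 * Real.pi * Complex.I * (Complex.I * Y j)) * z j‖ ^ ξ (D.X j) =
        Real.exp (-(2 * Real.pi) * (Y j * ξ (D.X j))) * ‖z j‖ ^ ξ (D.X j) := by
      intro j
      have := cexp_I_mul (Y j)
      rw [cexp] at this
      rw [this, norm_mul, Complex.norm_real, Real.norm_eq_abs, Real.abs_exp,
        Real.mul_rpow (Real.exp_pos _).le (norm_nonneg _), ← Real.exp_mul]
      congr 2
      ring
    have h4 : ∑ j ∈ (D.hull z)ᶜ, Y j * ξ (D.X j) = 0 := by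
      have := congrArg ξ hY
      simp only [map_sum, map_smul, smul_eq_mul, map_zero] at this
      rw [← this, ← Finset.sum_add_sum_compl (D.hull z)]
      rw [Finset.sum_eq_zero (s := D.hull z) fun j hj => by rw [hξ j hj, mul_zero], zero_add]
    simp only [h3, Set.mem_singleton_iff]
    rw [Finset.prod_mul_distrib, ← Real.exp_sum, ← Finset.mul_sum, h4, mul_zero, Real.exp_zero,
      one_mul]
  simpa using closure_mono h2 h1

variable {D} in
-- For `μ` in the face of the hull and `μ'` in a face that witnesses `u ∈ CDelta`, the exponents `(μ
-- - μ')(X_i)` vanish on the hull and are nonnegative wherever `u` may vanish. A zero of `u` off the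
-- hull has positive exponent, so the monomial would vanish at `u` but not at `z`.
theorem mem_hull_of_mem_closureOrbitA {z u : ι → ℂ} (hz : z ∈ D.CDelta)
    (hu : u ∈ D.closureOrbitA z) (h0 : ∀ j, z j = 0 → u j = 0) {j : ι} (hj : u j = 0) :
    j ∈ D.hull z := by
  obtain ⟨hu, J', ⟨μ', hμ'⟩, huJ'⟩ := hu
  obtain ⟨μ, hμ⟩ := isFace_hull hz
  have hsub : D.hull z ⊆ J' := hull_subset ⟨_, hμ'⟩ fun i hi hzi => huJ' i hi (h0 i hzi)
  by_contra hjz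
  have key := prod_rpow_eq_of_mem_closure (ξ := μ - μ') hu (fun i hi => by
    simp [(hμ.2 i).2 hi, (hμ'.2 i).2 (hsub hi)]) (fun i => by
      by_cases hi : i ∈ J'
      · right
        have := hμ.1 i
        simp only [LinearMap.sub_apply, (hμ'.2 i).2 hi]
        linarith
      · exact Or.inl (huJ' i hi))
  have hjJ' : j ∈ J' := by
    by_contra h
    exact huJ' j h hj
  have hpos : (μ - μ') (D.X j) ≠ 0 := by
    have := lt_of_mem_openFace hμ hjz
    simp only [LinearMap.sub_apply, (hμ'.2 j).2 hjJ']
    linarith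
  rw [Finset.prod_eq_zero (Finset.mem_compl.2 hjz) (by rw [hj, norm_zero, Real.zero_rpow hpos])]
    at key
  refine (Finset.prod_pos fun i hi => ?_).ne key
  exact Real.rpow_pos_of_pos (norm_pos_iff.2 (D.ne_zero_of_notMem_hull (Finset.mem_compl.1 hi))) _

/-- `A` multiplies coordinates by positive reals, so phases persist in the limit; only absolute
values need to be matched afterwards. -/
theorem mul_conj_eq_of_mem_closure {z u : ι → ℂ} (hu : u ∈ closure (D.orbitA z)) (j : ι) :
    u j * (starRingEnd ℂ) (z j) = (‖u j‖ * ‖z j‖ : ℝ) := by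
  have hcl : IsClosed {w : ι → ℂ | w j * (starRingEnd ℂ) (z j) = (‖w j‖ * ‖z j‖ : ℝ)} :=
    isClosed_eq (by fun_prop) (by fun_prop)
  refine closure_minimal ?_ hcl hu
  rintro _ ⟨Y, hY, rfl⟩
  have := cexp_I_mul (Y j)
  rw [cexp] at this
  simp only [this, Set.mem_ofPred_eq, norm_mul, Complex.norm_real, Real.norm_eq_abs, Real.abs_exp]
  rw [mul_assoc, Complex.mul_conj, Complex.normSq_eq_norm_sq]
  push_cast
  ring

variable {D} in
/-- A point of the closure of an `A`-orbit has the same hull, and the coordinates outside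
of the hull differ by an element of `A`. -/
theorem eq_of_mem_closureOrbitA {z u : ι → ℂ} (hz : z ∈ D.CDelta) (hu : u ∈ D.closureOrbitA z) :
    D.hull u = D.hull z ∧ ∃ Y : ι → ℝ, ∑ j, Y j • D.X j = 0 ∧
      ∀ j, j ∉ D.hull z → u j = cexp (Complex.I * Y j) * z j := by
  have h0 : ∀ j, z j = 0 → u j = 0 := by
    intro j hj
    have hcl : IsClosed {w : ι → ℂ | w j = 0} := isClosed_eq (by fun_prop) (by fun_prop)
    refine closure_minimal ?_ hcl hu.1
    rintro _ ⟨Y, hY, rfl⟩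
    simp [hj]
  have h1 : ∀ j, u j = 0 → j ∈ D.hull z := fun j hj => mem_hull_of_mem_closureOrbitA hz hu h0 hj
  refine ⟨hull_eq_of_between hz h0 h1, ?_⟩
  have hu0 : ∀ j ∈ (D.hull z)ᶜ, ‖u j‖ ≠ 0 := fun j hj =>
    norm_ne_zero_iff.2 fun h => Finset.mem_compl.1 hj (h1 j h)
  have hz0 : ∀ j ∈ (D.hull z)ᶜ, ‖z j‖ ≠ 0 := fun j hj =>
    norm_ne_zero_iff.2 (D.ne_zero_of_notMem_hull (Finset.mem_compl.1 hj))
  -- Off the hull `|u_j| = exp (-2π Y_j) |z_j|` forces `2π Y_j = c j`. To extend this to a relation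
  -- by coefficients on the hull, the sum of the `c j • X j` has to lie in the span of the hull;
  -- this is tested on the forms that vanish there, by taking the logarithm of the invariant
  -- monomial.
  let c : ι → ℝ := fun j => if j ∈ D.hull z then 0 else Real.log ‖z j‖ - Real.log ‖u j‖
  have hmem : ∑ j, c j • D.X j ∈ D.spanX (D.hull z) := by
    by_contra hnot
    obtain ⟨ξ', hξ'⟩ : ∃ ξ' : Dual ℝ (V ⧸ D.spanX (D.hull z)),
        ξ' (Submodule.mkQ _ (∑ j, c j • D.X j)) ≠ 0 := by
      by_contra! hall
      exact hnot ((Submodule.Quotient.mk_eq_zero _).1 ((forall_dual_apply_eq_zero_iff ℝ _).1 hall))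
    apply hξ'
    let ξ : Dual ℝ V := ξ' ∘ₗ Submodule.mkQ _
    have hξ : ∀ j ∈ D.hull z, ξ (D.X j) = 0 := fun j hj => by
      change ξ' (Submodule.mkQ _ (D.X j)) = 0
      rw [Submodule.mkQ_apply, (Submodule.Quotient.mk_eq_zero _).2 (X_mem_spanX hj), map_zero]
    change ξ (∑ j, c j • D.X j) = 0
    by_cases hgood : ∀ j, u j ≠ 0 ∨ 0 ≤ ξ (D.X j)
    swap
    · exfalso
      push Not at hgood
      obtain ⟨j, hj1, hj2⟩ := hgood
      rw [hξ j (h1 j hj1)] at hj2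
      exact lt_irrefl _ hj2
    have key := congrArg Real.log (prod_rpow_eq_of_mem_closure hu.1 hξ hgood)
    rw [Real.log_prod fun j hj => (Real.rpow_pos_of_pos
        ((norm_nonneg _).lt_of_ne' (hu0 j hj)) _).ne',
      Real.log_prod fun j hj => (Real.rpow_pos_of_pos
        ((norm_nonneg _).lt_of_ne' (hz0 j hj)) _).ne'] at key
    rw [map_sum, ← Finset.sum_add_sum_compl (D.hull z), Finset.sum_eq_zero fun j hj => by simp [c, hj],
      zero_add]
    have h2 : ∀ j ∈ (D.hull z)ᶜ, ξ (c j • D.X j) =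
        Real.log (‖z j‖ ^ ξ (D.X j)) - Real.log (‖u j‖ ^ ξ (D.X j)) := by
      intro j hj
      rw [Real.log_rpow ((norm_nonneg _).lt_of_ne' (hu0 j hj)),
        Real.log_rpow ((norm_nonneg _).lt_of_ne' (hz0 j hj))]
      simp only [c, if_neg (Finset.mem_compl.1 hj), map_smul, smul_eq_mul]
      ring
    rw [Finset.sum_congr rfl h2, Finset.sum_sub_distrib, key, sub_self]
  obtain ⟨a, ha, hsum⟩ := exists_sum_eq_of_mem_span D.X _ hmem
  refine ⟨fun j => (2 * Real.pi)⁻¹ * (c j - a j), ?_, fun j hj => ?_⟩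
  · simp only [mul_smul, sub_smul, ← Finset.smul_sum, Finset.sum_sub_distrib, hsum, sub_self,
      smul_zero]
  · have hj' := Finset.mem_compl.2 hj
    have hzj : (starRingEnd ℂ) (z j) ≠ 0 := by
      simpa using D.ne_zero_of_notMem_hull hj
    apply mul_right_cancel₀ hzj
    rw [D.mul_conj_eq_of_mem_closure hu.1, cexp_I_mul, mul_assoc, Complex.mul_conj,
      Complex.normSq_eq_norm_sq, ← Complex.ofReal_mul]
    congr 1
    have h3 : -(2 * Real.pi * ((2 * Real.pi)⁻¹ * (c j - a j))) =
        Real.log ‖u j‖ - Real.log ‖z j‖ := by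
      rw [mul_inv_cancel_left₀ (by positivity), ha j hj]
      simp only [c, if_neg hj]
      ring
    rw [h3, Real.exp_sub, Real.exp_log ((norm_nonneg _).lt_of_ne' (hu0 j hj')),
      Real.exp_log ((norm_nonneg _).lt_of_ne' (hz0 j hj'))]
    have := hz0 j hj'
    field_simp

/-- The condition on `ξ` that `(exp (2πi ξ_j))_j` is in the group `N_ℂ`. -/
def MemLieNC (ξ : ι → ℂ) : Prop :=
  ∑ j, (ξ j).re • D.X j ∈ D.Q ∧ ∑ j, (ξ j).im • D.X j = 0

variable {D} in
theorem MemLieNC.add {ξ η : ι → ℂ} (h1 : D.MemLieNC ξ) (h2 : D.MemLieNC η) :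
    D.MemLieNC (ξ + η) := by
  refine ⟨?_, ?_⟩
  · simpa [add_smul, Finset.sum_add_distrib] using D.Q.add_mem h1.1 h2.1
  · simp [add_smul, Finset.sum_add_distrib, h1.2, h2.2]

variable {D} in
theorem MemLieNC.neg {ξ : ι → ℂ} (h1 : D.MemLieNC ξ) : D.MemLieNC (-ξ) := by
  refine ⟨?_, ?_⟩
  · simpa [neg_smul, Finset.sum_neg_distrib] using D.Q.neg_mem h1.1
  · simp [neg_smul, Finset.sum_neg_distrib, h1.2]

theorem memLieNC_zero : D.MemLieNC 0 := by
  simp [MemLieNC, D.Q.zero_mem]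

/-- The description of the relation `∼` through hulls. -/
def HullRel (z w : D.CDelta) : Prop :=
  D.hull z = D.hull w ∧ ∃ ξ, D.MemLieNC ξ ∧
    ∀ j, j ∉ D.hull z → (w : ι → ℂ) j = cexp (ξ j) * (z : ι → ℂ) j

theorem hullRel_equivalence : Equivalence D.HullRel where
  refl z := ⟨rfl, 0, D.memLieNC_zero, fun j _ => by simp [cexp_zero]⟩
  symm := by
    rintro z w ⟨h, ξ, hξ, hw⟩
    refine ⟨h.symm, -ξ, hξ.neg, fun j hj => ?_⟩
    rw [hw j (h ▸ hj), Pi.neg_apply, cexp_neg, inv_mul_cancel_left₀ (cexp_ne_zero _)]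
  trans := by
    rintro z w v ⟨h, ξ, hξ, hw⟩ ⟨h', η, hη, hv⟩
    refine ⟨h.trans h', η + ξ, hη.add hξ, fun j hj => ?_⟩
    rw [hv j (h ▸ hj), hw j hj, Pi.add_apply, cexp_add, mul_assoc]

/-- For the converse, both points are collapsed on the common hull. The imaginary part of `ξ` is the
element of `A` used for `z`, and its real part is the element of `N`. In particular the relation is
transitive, so that equality in the quotient is the relation itself. -/
theorem rel_iff_hullRel (z w : D.CDelta) : D.Rel z w ↔ D.HullRel z w := by
  constructor
  · rintro ⟨u, hu, t, ⟨x, hx, ht⟩, htu⟩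
    obtain ⟨h1, Y, hY, h2⟩ := eq_of_mem_closureOrbitA z.2 hu
    obtain ⟨h3, Y', hY', h4⟩ := eq_of_mem_closureOrbitA w.2 htu
    have h5 : D.hull (torusMul t u) = D.hull u := D.hull_congr fun j => by
      simp [torusMul]
    have h6 : D.hull z = D.hull w := by rw [← h1, ← h3, h5]
    refine ⟨h6, fun j => x j + Complex.I * (Y j - Y' j : ℝ), ⟨by simpa using hx, ?_⟩, fun j hj => ?_⟩
    · simp [sub_smul, Finset.sum_sub_distrib, hY, hY']
    · have h7 := h4 j (h6 ▸ hj)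
      rw [torusMul, ht, coe_circle_exp, h2 j hj] at h7
      apply mul_left_cancel₀ (cexp_ne_zero (Complex.I * Y' j))
      rw [← h7, ← mul_assoc, ← mul_assoc, ← cexp_add, ← cexp_add]
      congr 2
      push_cast
      ring
  · rintro ⟨h, ξ, hξ, hw⟩
    refine ⟨_, collapse_mem_closureOrbitA z.2 (Y := fun j => (ξ j).im) hξ.2,
      fun j => Circle.exp (2 * Real.pi * (ξ j).re), ⟨_, hξ.1, fun _ => rfl⟩, ?_⟩
    have := collapse_mem_closureOrbitA w.2 (Y := 0) (by simp)
    convert this using 1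
    funext j
    rw [← h, torusMul, coe_circle_exp]
    split_ifs with hj
    · simp
    · rw [hw j hj, ← mul_assoc, ← mul_assoc, ← cexp_add, ← cexp_add]
      congr 2
      simp only [Pi.zero_apply, Complex.ofReal_zero, mul_zero, zero_add]
      rw [mul_comm Complex.I]
      exact Complex.re_add_im _

theorem toQuot_eq_iff {z w : D.CDelta} : D.toQuot z = D.toQuot w ↔ D.HullRel z w := by
  have : D.Rel = D.HullRel := by
    funext z w
    exact propext (D.rel_iff_hullRel z w)
  have h := D.hullRel_equivalence
  rw [← this] at h ⊢
  exact h.quot_mk_eq_iff z w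

end Closure

/-! ### Dimension of faces; regularity as linear independence. -/

section FaceDimension

variable {V ι : Type*} [AddCommGroup V] [Module ℝ V] [Fintype ι] [DecidableEq ι]
variable (D : PolyhedralData V ι)

variable {D} in
-- A form that kills the tight vectors is tangent to the face, because a small move along it stays
-- in the open face.
theorem IsFace.vectorSpan_openFace {J : Finset ι} (hJ : D.IsFace J) :
    vectorSpan ℝ (D.openFace J) = (D.spanX J).dualAnnihilator := by
  apply le_antisymm
  · rw [vectorSpan_def, Submodule.span_le]
    rintro _ ⟨μ, hμ, ν, hν, rfl⟩
    rw [SetLike.mem_coe, Submodule.mem_dualAnnihilator]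
    intro v hv
    induction hv using Submodule.span_induction with
    | mem x hx =>
      obtain ⟨j, hj, rfl⟩ := hx
      simp [(hμ.2 j).2 hj, (hν.2 j).2 hj]
    | zero => simp
    | add x y _ _ hx hy => rw [map_add, hx, hy, add_zero]
    | smul a x _ hx => rw [map_smul, hx, smul_zero]
  · intro ξ hξ
    rw [Submodule.mem_dualAnnihilator] at hξ
    obtain ⟨μ, hμ⟩ := hJ
    obtain ⟨ε, hε, h⟩ := exists_perturbation_mem_openFace (ξ := ξ) hμ subset_rfl
      (fun j hj => hξ _ (X_mem_spanX hj)) fun j hj hj' => absurd hj hj'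
    have := (vectorSpan ℝ (D.openFace J)).smul_mem ε⁻¹ (vsub_mem_vectorSpan ℝ h hμ)
    simpa [hε.ne'] using this

variable {D} in
theorem IsFace.faceDim_add_finrank [FiniteDimensional ℝ V] {J : Finset ι} (hJ : D.IsFace J) :
    D.faceDim J + finrank ℝ (D.spanX J) = finrank ℝ V := by
  rw [faceDim, hJ.vectorSpan_openFace, add_comm]
  exact Subspace.finrank_add_finrank_dualAnnihilator_eq _

theorem linearIndependent_iff_card_eq (J : Finset ι) :
    LinearIndependent ℝ (fun j : J => D.X j) ↔ J.card = finrank ℝ (D.spanX J) := by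
  rw [linearIndependent_iff_card_eq_finrank_span, Fintype.card_coe, Set.finrank, spanX,
    Set.image_eq_range]
  rfl

theorem finrank_spanX_le_card (J : Finset ι) : finrank ℝ (D.spanX J) ≤ J.card := by
  classical
  have : D.spanX J = Submodule.span ℝ ((J.image D.X : Finset V) : Set V) := by
    rw [Finset.coe_image]
  rw [this]
  exact (finrank_span_finset_le_card _).trans Finset.card_image_le

theorem isSingularFace_iff [FiniteDimensional ℝ V] (J : Finset ι) :
    D.IsSingularFace J ↔ D.IsFace J ∧ finrank ℝ (D.spanX J) < J.card :=
  and_congr_right fun h => by have := h.faceDim_add_finrank; omega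

theorem isRegularFace_iff [FiniteDimensional ℝ V] (J : Finset ι) :
    D.IsRegularFace J ↔ D.IsFace J ∧ LinearIndependent ℝ (fun j : J => D.X j) :=
  and_congr_right fun h => by
    have := h.faceDim_add_finrank
    rw [linearIndependent_iff_card_eq]
    omega

variable {D} in
-- By independence there is a form with value `0` on the vectors in `K` and `1` on the other ones in
-- `J`; moving along it relaxes exactly the inequalities in `J \ K`.
theorem IsRegularFace.subset [FiniteDimensional ℝ V] {J K : Finset ι} (hJ : D.IsRegularFace J)
    (hK : K ⊆ J) : D.IsRegularFace K := by
  rw [isRegularFace_iff] at hJ ⊢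
  obtain ⟨⟨μ, hμ⟩, hli⟩ := hJ
  refine ⟨?_, hli.comp (fun j : K => (⟨j, hK j.2⟩ : J)) fun i j h => Subtype.ext (by simpa using h)⟩
  obtain ⟨ξ, hξ⟩ := LinearMap.dualMap_surjective_of_injective
    (f := Fintype.linearCombination ℝ fun j : J => D.X j)
    (linearIndependent_iff_injective_fintypeLinearCombination.1 hli)
    (Fintype.linearCombination ℝ fun j : J => if (j : ι) ∈ K then (0 : ℝ) else 1)
  have h : ∀ j (hj : j ∈ J), ξ (D.X j) = if j ∈ K then 0 else 1 := fun j hj => by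
    have := LinearMap.congr_fun hξ (Pi.single ⟨j, hj⟩ 1)
    simpa only [LinearMap.dualMap_apply, Fintype.linearCombination_apply_single, one_smul] using this
  obtain ⟨ε, -, hε⟩ := exists_perturbation_mem_openFace hμ hK
    (fun j hj => by rw [h j (hK hj), if_pos hj]) fun j hj hjK => by
      rw [h j hj, if_neg hjK]
      exact one_pos
  exact ⟨_, hε⟩

end FaceDimension

/-! ### Strata, the regular piece and the neighbourhood in terms of hulls. -/

section Pieces

variable {V ι : Type*} [AddCommGroup V] [Module ℝ V] [Fintype ι] [DecidableEq ι]
variable (D : PolyhedralData V ι)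

theorem hull_eq_of_toQuot_eq {z w : D.CDelta} (h : D.toQuot z = D.toQuot w) :
    D.hull z = D.hull w := (D.toQuot_eq_iff.1 h).1

variable {D} in
theorem toQuot_mem_stratum_iff {J : Finset ι} (hJ : D.IsFace J) (z : D.CDelta) :
    D.toQuot z ∈ D.stratum J ↔ D.hull z = J := by
  constructor
  · rintro ⟨w, ⟨u, hu, h⟩, hw⟩
    rw [← D.hull_eq_of_toQuot_eq hw, ← (eq_of_mem_closureOrbitA w.2 hu).1]
    exact hull_eq_of_zeros hJ h
  · rintro rfl
    refine ⟨z, ⟨_, collapse_mem_closureOrbitA z.2 (Y := 0) (by simp), fun j => ?_⟩, rfl⟩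
    have := @ne_zero_of_notMem_hull _ _ _ _ _ _ D z j
    split_ifs with hj
    · simpa using hj
    · simpa [hj, cexp_zero] using this

variable {D} in
theorem toQuot_mem_nbhd_iff {F : Finset ι} (hF : D.IsFace F) (z : D.CDelta) :
    D.toQuot z ∈ D.nbhd F ↔ D.hull z ⊆ F := by
  constructor
  · rintro ⟨w, hw, h⟩
    rw [← D.hull_eq_of_toQuot_eq h]
    exact hull_subset hF hw
  · intro h
    exact ⟨z, fun j hj => D.ne_zero_of_notMem_hull fun h' => hj (h h'), rfl⟩

theorem toQuot_mem_regularPiece_iff [FiniteDimensional ℝ V] (z : D.CDelta) :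
    D.toQuot z ∈ D.regularPiece ↔ D.IsRegularFace (D.hull z) := by
  constructor
  · rintro ⟨w, ⟨J, hJ, hw⟩, h⟩
    rw [← D.hull_eq_of_toQuot_eq h]
    exact hJ.subset (hull_subset hJ.1 hw)
  · intro h
    exact ⟨z, ⟨_, h, fun j hj => D.ne_zero_of_notMem_hull hj⟩, rfl⟩

variable {D} in
-- Subsets of a regular index set are index sets of faces, so the zero set is itself a face and is
-- therefore the hull.
theorem eq_zero_iff_mem_hull [FiniteDimensional ℝ V] {z : ι → ℂ} (h : D.IsRegularFace (D.hull z))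
    (j : ι) : z j = 0 ↔ j ∈ D.hull z := by
  classical
  refine ⟨D.mem_hull_of_eq_zero, fun hj => ?_⟩
  have hK : D.IsRegularFace ((D.hull z).filter fun i => z i = 0) := h.subset (Finset.filter_subset _ _)
  have := hull_subset (z := z) hK.1 fun i hi h0 =>
    hi (Finset.mem_filter.2 ⟨D.mem_hull_of_eq_zero h0, h0⟩)
  exact (Finset.mem_filter.1 (this hj)).2

variable {D} in
theorem isOpen_nbhd {F : Finset ι} (hF : D.IsFace F) : IsOpen (D.nbhd F) := by
  have h : IsOpen (D.toQuot ⁻¹' D.nbhd F) := by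
    have : D.toQuot ⁻¹' D.nbhd F = {z : D.CDelta | ∀ j, j ∉ F → (z : ι → ℂ) j ≠ 0} := by
      ext z
      rw [Set.mem_preimage, toQuot_mem_nbhd_iff hF]
      exact ⟨fun h j hj => D.ne_zero_of_notMem_hull fun h' => hj (h h'), hull_subset hF⟩
    rw [this]
    simp only [Set.ofPred_forall]
    refine isOpen_iInter_of_finite fun j => isOpen_iInter_of_finite fun _ => ?_
    exact isOpen_ne_fun ((continuous_apply j).comp continuous_subtype_val) continuous_const
  exact h

variable {D} in
theorem stratum_subset_nbhd {G F : Finset ι} (hG : D.IsFace G) (hF : D.IsFace F) (h : G ⊆ F) :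
    D.stratum G ⊆ D.nbhd F := by
  intro x hx
  obtain ⟨z, rfl⟩ := Quot.exists_rep x
  rw [show Quot.mk D.Rel z = D.toQuot z from rfl] at hx ⊢
  rw [toQuot_mem_stratum_iff hG] at hx
  rwa [toQuot_mem_nbhd_iff hF, hx]

variable {D} in
theorem stratum_nonempty {G : Finset ι} (hG : D.IsFace G) : (D.stratum G).Nonempty := by
  let z : D.CDelta := ⟨fun j => if j ∈ G then 0 else 1, G, hG, fun j hj => by simp [hj]⟩
  exact ⟨D.toQuot z, (toQuot_mem_stratum_iff hG z).2 (hull_eq_of_zeros hG fun j => by simp [z])⟩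

variable {D} in
theorem stratum_inter_nbhd_nonempty_iff {G F : Finset ι} (hG : D.IsFace G) (hF : D.IsFace F) :
    (D.stratum G ∩ D.nbhd F).Nonempty ↔ G ⊆ F := by
  constructor
  · rintro ⟨x, hx, hxF⟩
    obtain ⟨z, rfl⟩ := Quot.exists_rep x
    rw [← (toQuot_mem_stratum_iff hG z).1 hx]
    exact (toQuot_mem_nbhd_iff hF z).1 hxF
  · intro h
    rw [Set.inter_eq_left.2 (stratum_subset_nbhd hG hF h)]
    exact stratum_nonempty hG

end Pieces

/-! ### Bases adapted to a face. -/

section Bases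

variable {V ι : Type*} [AddCommGroup V] [Module ℝ V] [Fintype ι] [DecidableEq ι]
variable (D : PolyhedralData V ι)

theorem spanX_mono {J K : Finset ι} (h : J ⊆ K) : D.spanX J ≤ D.spanX K :=
  Submodule.span_mono (Set.image_mono (Finset.coe_subset.2 h))

/-- The vectors `X j` with `j ∈ B` are a basis. -/
structure IsBasisIndex (B : Finset ι) : Prop where
  linearIndependent : LinearIndependent ℝ (fun j : B => D.X j)
  spanX_eq_top : D.spanX B = ⊤

variable {D} in
theorem IsBasisSet.isBasisIndex {B : Finset ι} (hB : D.IsBasisSet B) : D.IsBasisIndex B :=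
  ⟨hB.1, by rw [← hB.2.1, spanX, Set.image_eq_range]; rfl⟩

variable {D} in
theorem IsBasisIndex.isBasisSet {B M : Finset ι} (hB : D.IsBasisIndex B) (hM : D.IsFace M)
    (hM0 : D.faceDim M = 0) (hBM : B ⊆ M) : D.IsBasisSet B :=
  ⟨hB.1, by rw [← hB.2, spanX, Set.image_eq_range]; rfl, M, hM, hM0, hBM⟩

variable {D} in
theorem IsBasisIndex.card_inter_eq {B : Finset ι} (hB : D.IsBasisIndex B) (J : Finset ι) :
    (B ∩ J).card = finrank ℝ (D.spanX (B ∩ J)) :=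
  (D.linearIndependent_iff_card_eq _).1 <|
    hB.1.comp (fun j : ↥(B ∩ J) => (⟨j, Finset.inter_subset_left j.2⟩ : B)) fun i j h =>
      Subtype.ext (by simpa using h)

variable {D} in
-- Both sides compare ranks: `(B ∩ J).card` is the rank of `B ∩ J` by independence, and the
-- codimension of the face is the rank of `J`.
theorem IsBasisIndex.spanX_inter_eq_iff [FiniteDimensional ℝ V] {B J : Finset ι}
    (hB : D.IsBasisIndex B) (hJ : D.IsFace J) :
    D.spanX (B ∩ J) = D.spanX J ↔ (B ∩ J).card + D.faceDim J = finrank ℝ V := by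
  have h1 := hB.card_inter_eq J
  have h2 := hJ.faceDim_add_finrank
  constructor
  · intro h
    rw [h] at h1
    omega
  · intro h
    exact Submodule.eq_of_le_of_finrank_eq (D.spanX_mono Finset.inter_subset_right) (by omega)

theorem exists_extension {S T : Finset ι} (hST : S ⊆ T)
    (hS : LinearIndependent ℝ (fun j : S => D.X j)) :
    ∃ B, S ⊆ B ∧ B ⊆ T ∧ LinearIndependent ℝ (fun j : B => D.X j) ∧ D.spanX B = D.spanX T := by
  classical
  obtain ⟨b, hbT, hSb, hspan, hli⟩ := exists_linearIndepOn_extension (K := ℝ) (v := D.X)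
    (s := (S : Set ι)) (t := (T : Set ι)) hS (Finset.coe_subset.2 hST)
  lift b to Finset ι using Set.toFinite b
  refine ⟨b, Finset.coe_subset.1 hSb, Finset.coe_subset.1 hbT, hli, ?_⟩
  exact (D.spanX_mono (Finset.coe_subset.1 hbT)).antisymm (Submodule.span_le.2 hspan)

theorem exists_adapted_basis {K T : Finset ι} (hKT : K ⊆ T) :
    ∃ B, B ⊆ T ∧ LinearIndependent ℝ (fun j : B => D.X j) ∧ D.spanX B = D.spanX T ∧
      D.spanX (B ∩ K) = D.spanX K := by
  obtain ⟨S, -, hSK, hSli, hSspan⟩ := D.exists_extension (S := ∅) (Finset.empty_subset K)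
    linearIndependent_empty_type
  obtain ⟨B, hSB, hBT, hli, hspan⟩ := D.exists_extension (hSK.trans hKT) hSli
  refine ⟨B, hBT, hli, hspan, (D.spanX_mono Finset.inter_subset_right).antisymm ?_⟩
  rw [← hSspan]
  exact D.spanX_mono (Finset.subset_inter hSB hSK)

end Bases

/-! ### Faces and bases of the cone compared with those of the polytope. -/

section Cone

variable {V ι : Type*} [AddCommGroup V] [Module ℝ V] [Fintype ι] [DecidableEq ι]
variable (D : PolyhedralData V ι)

/-- The subset of `ι` which is given by a set of elements of `F`. -/
abbrev lift (F : Finset ι) (K : Finset F) : Finset ι := K.map (Function.Embedding.subtype _)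

theorem mem_lift {F : Finset ι} {K : Finset F} {j : ι} :
    j ∈ lift F K ↔ ∃ h : j ∈ F, (⟨j, h⟩ : F) ∈ K := by
  simp [lift]

theorem lift_subset {F : Finset ι} {K : Finset F} : lift F K ⊆ F := fun _ hj =>
  (mem_lift.1 hj).1

theorem coe_mem_lift {F : Finset ι} {K : Finset F} {j : F} : (j : ι) ∈ lift F K ↔ j ∈ K := by
  simp [lift]

theorem exists_lift_eq {F J : Finset ι} (h : J ⊆ F) : ∃ K : Finset F, lift F K = J := by
  refine ⟨Finset.univ.filter fun j => (j : ι) ∈ J, ?_⟩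
  ext j
  rw [mem_lift]
  simp only [Finset.mem_filter, Finset.mem_univ, true_and]
  exact ⟨fun ⟨_, hj⟩ => hj, fun hj => ⟨h hj, hj⟩⟩

theorem lift_univ (F : Finset ι) : lift F Finset.univ = F := by
  ext j
  simp

theorem cone_X_coe (F : Finset ι) (j : F) : ((D.cone F).X j : V) = D.X j := rfl

theorem map_cone_spanX (F : Finset ι) (K : Finset F) :
    ((D.cone F).spanX K).map (Submodule.subtype _) = D.spanX (lift F K) := by
  rw [spanX, Submodule.map_span, spanX, ← Set.image_comp]
  congr 1
  ext v
  simp only [Set.mem_image, Finset.mem_coe]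
  constructor
  · rintro ⟨j, hj, rfl⟩
    exact ⟨j, coe_mem_lift.2 hj, rfl⟩
  · rintro ⟨j, hj, rfl⟩
    obtain ⟨h, hj⟩ := mem_lift.1 hj
    exact ⟨⟨j, h⟩, hj, rfl⟩

theorem finrank_cone_spanX (F : Finset ι) (K : Finset F) :
    finrank ℝ ((D.cone F).spanX K) = finrank ℝ (D.spanX (lift F K)) := by
  rw [← D.map_cone_spanX F K]
  exact (Submodule.equivMapOfInjective _ (Submodule.subtype_injective _) _).finrank_eq

theorem cone_linearIndependent_iff (F : Finset ι) (K : Finset F) :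
    LinearIndependent ℝ (fun j : K => (D.cone F).X j) ↔
      LinearIndependent ℝ (fun j : lift F K => D.X j) := by
  rw [linearIndependent_iff_card_eq, linearIndependent_iff_card_eq, finrank_cone_spanX,
    Finset.card_map]

variable {D} in
-- A point `ν` of the cone extends to a form `ν'` on `V`. In the direction `ν' - μ` the constants
-- `lam j` cancel for `j ∈ F`, so the slack of `ν` becomes the rate at which the inequalities in `F`
-- are relaxed near `μ`. In the other direction, forms are restricted.
theorem cone_isFace_iff {F : Finset ι} (hF : D.IsFace F) (K : Finset F) :
    (D.cone F).IsFace K ↔ D.IsFace (lift F K) := by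
  obtain ⟨μ, hμ⟩ := hF
  constructor
  · rintro ⟨ν, hν⟩
    obtain ⟨ν', hν'⟩ := LinearMap.exists_extend ν
    have hν'X : ∀ j : F, ν' (D.X j) = ν ((D.cone F).X j) := fun j => by
      rw [← hν']
      rfl
    obtain ⟨ε, -, hε⟩ := exists_perturbation_mem_openFace (ξ := ν' - μ) hμ
      (lift_subset (K := K)) (fun j hj => by
        obtain ⟨h, hj⟩ := mem_lift.1 hj
        rw [LinearMap.sub_apply, (hμ.2 j).2 h, hν'X ⟨j, h⟩, (hν.2 _).2 hj]
        exact sub_self _) fun j hj hjK => by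
          have := lt_of_mem_openFace hν (j := ⟨j, hj⟩) fun h => hjK (mem_lift.2 ⟨hj, h⟩)
          rw [LinearMap.sub_apply, (hμ.2 j).2 hj, hν'X ⟨j, hj⟩]
          exact sub_pos.2 this
    exact ⟨_, hε⟩
  · rintro ⟨ν, hν⟩
    refine ⟨ν ∘ₗ Submodule.subtype _, mem_openFace_of (fun j hj => ?_) fun j hj => ?_⟩
    · exact (hν.2 j).2 (coe_mem_lift.2 hj)
    · exact lt_of_mem_openFace hν fun h => hj (coe_mem_lift.1 h)

variable {D} in
theorem cone_isSingularFace_iff [FiniteDimensional ℝ V] {F : Finset ι} (hF : D.IsFace F)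
    (K : Finset F) : (D.cone F).IsSingularFace K ↔ D.IsSingularFace (lift F K) := by
  rw [isSingularFace_iff, isSingularFace_iff, cone_isFace_iff hF, finrank_cone_spanX,
    Finset.card_map]

variable {D} in
theorem cone_isRegularFace_iff [FiniteDimensional ℝ V] {F : Finset ι} (hF : D.IsFace F)
    (K : Finset F) : (D.cone F).IsRegularFace K ↔ D.IsRegularFace (lift F K) := by
  rw [isRegularFace_iff, isRegularFace_iff, cone_isFace_iff hF, cone_linearIndependent_iff]

theorem cone_spanX_univ (F : Finset ι) : (D.cone F).spanX Finset.univ = ⊤ := by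
  apply Submodule.map_injective_of_injective (Submodule.subtype_injective _)
  rw [map_cone_spanX, lift_univ, Submodule.map_subtype_top]

variable {D} in
theorem cone_isFace_univ {F : Finset ι} (hF : D.IsFace F) : (D.cone F).IsFace Finset.univ := by
  rwa [cone_isFace_iff hF, lift_univ]

variable {D} in
theorem cone_faceDim_univ [FiniteDimensional ℝ V] {F : Finset ι} (hF : D.IsFace F) :
    (D.cone F).faceDim Finset.univ = 0 := by
  have h := (cone_isFace_univ hF).faceDim_add_finrank
  rw [cone_spanX_univ, finrank_top] at h
  omega

/-- The index set of the basis of `V` given by a part of the basis `I` and a basis for the cone. -/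
abbrev glue (F I : Finset ι) (B : Finset F) : Finset ι := I \ F ∪ lift F B

theorem glue_inter {F I : Finset ι} {B K : Finset F} :
    glue F I B ∩ lift F K = lift F (B ∩ K) := by
  ext j
  simp only [Finset.mem_inter, Finset.mem_union, Finset.mem_sdiff, mem_lift]
  constructor
  · rintro ⟨h | ⟨h, hB⟩, hF, hK⟩
    · exact absurd hF h.2
    · exact ⟨h, hB, hK⟩
  · rintro ⟨h, hB, hK⟩
    exact ⟨Or.inr ⟨h, hB⟩, h, hK⟩

variable {D} in
-- `B` spans the same subspace as `I ∩ F`, so exchanging one for the other keeps the span. It also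
-- keeps the number of vectors, and a spanning family of at most `n` vectors is independent.
theorem IsBasisIndex.glue [FiniteDimensional ℝ V] {F I : Finset ι} (hI : D.IsBasisIndex I)
    (hIF : D.spanX (I ∩ F) = D.spanX F) {B : Finset F} (hB : (D.cone F).IsBasisIndex B) :
    D.IsBasisIndex (glue F I B) := by
  have hBF : D.spanX (lift F B) = D.spanX F := by
    rw [← map_cone_spanX, hB.spanX_eq_top, Submodule.map_subtype_top]
  have htop : D.spanX (PolyhedralData.glue F I B) = ⊤ := by
    rw [eq_top_iff, ← hI.spanX_eq_top, spanX, Submodule.span_le]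
    rintro _ ⟨j, hj, rfl⟩
    by_cases hjF : j ∈ F
    · have : D.X j ∈ D.spanX (lift F B) := hBF ▸ X_mem_spanX hjF
      exact D.spanX_mono Finset.subset_union_right this
    · exact X_mem_spanX (Finset.mem_union_left _ (Finset.mem_sdiff.2 ⟨hj, hjF⟩))
  refine ⟨?_, htop⟩
  rw [linearIndependent_iff_card_eq, htop, finrank_top]
  refine le_antisymm ?_ ?_
  · have h1 : (lift F B).card = (I ∩ F).card := by
      rw [hI.card_inter_eq, hIF, ← hBF]
      exact (D.linearIndependent_iff_card_eq _).1 ((D.cone_linearIndependent_iff F B).1 hB.1)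
    have h2 := (D.linearIndependent_iff_card_eq _).1 hI.1
    rw [hI.spanX_eq_top, finrank_top, ← Finset.card_sdiff_add_card_inter I F] at h2
    rw [← h2, ← h1]
    exact Finset.card_union_le _ _
  · have := D.finrank_spanX_le_card (PolyhedralData.glue F I B)
    rwa [htop, finrank_top] at this

variable {D} in
/-- A vertex whose index set contains a basis which is adapted to a face lies in the closure
of this face. -/
theorem subset_of_spanX_inter_eq {F I M : Finset ι} (hF : D.IsFace F) (hM : D.IsFace M)
    (hIM : I ⊆ M) (hIF : D.spanX (I ∩ F) = D.spanX F) : F ⊆ M := by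
  obtain ⟨μ, hμ⟩ := hF
  obtain ⟨ν, hν⟩ := hM
  intro j hj
  -- Points of the two faces agree on `X i` for `i ∈ I ∩ F`, hence on the span of `F`; so the
  -- inequalities in `F` are tight at the vertex too.
  have h : D.spanX (I ∩ F) ≤ LinearMap.ker (μ - ν) := by
    rw [spanX, Submodule.span_le]
    rintro _ ⟨i, hi, rfl⟩
    obtain ⟨hiI, hiF⟩ := Finset.mem_inter.1 hi
    simp [(hμ.2 i).2 hiF, (hν.2 i).2 (hIM hiI)]
  have h1 : D.X j ∈ LinearMap.ker (μ - ν) := h (hIF ▸ X_mem_spanX hj)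
  rw [LinearMap.mem_ker, LinearMap.sub_apply, sub_eq_zero, (hμ.2 j).2 hj] at h1
  exact (hν.2 j).1 h1.symm

end Cone

/-! ### Relations among the normals, and elements of `N_ℂ` with prescribed exponents. -/

section LinearRelations

variable {V ι : Type*} [AddCommGroup V] [Module ℝ V] [Fintype ι] [DecidableEq ι]
variable (D : PolyhedralData V ι)

variable {D} in
theorem IsBasisIndex.eq_zero_of_sum_eq_zero {B : Finset ι} (hB : D.IsBasisIndex B) {c : ι → ℝ}
    (hc : ∀ j, j ∉ B → c j = 0) (hsum : ∑ j, c j • D.X j = 0) (j : ι) : c j = 0 := by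
  by_cases hj : j ∈ B
  · rw [← Finset.sum_subset (Finset.subset_univ B) (fun i _ hi => by rw [hc i hi, zero_smul]),
      ← Finset.sum_coe_sort] at hsum
    exact Fintype.linearIndependent_iff.1 hB.1 (fun i => c i) hsum ⟨j, hj⟩
  · exact hc j hj

theorem sum_ite_mem_smul (F : Finset ι) (y : ι → ℝ) :
    ∑ j, y j • D.X j = ∑ j, (if j ∈ F then y j else 0) • D.X j +
      ∑ j, (if j ∈ F then 0 else y j) • D.X j := by
  rw [← Finset.sum_add_distrib]
  refine Finset.sum_congr rfl fun j _ => ?_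
  split_ifs <;> simp

variable {D} in
theorem exists_sum_eq_of_spanX_inter_eq {F I : Finset ι}
    (hIF : D.spanX (I ∩ F) = D.spanX F) (y : ι → ℝ) :
    ∃ a : ι → ℝ, (∀ j, j ∉ I ∩ F → a j = 0) ∧
      ∑ j, a j • D.X j = ∑ j, (if j ∈ F then y j else 0) • D.X j :=
  exists_sum_eq_of_mem_span D.X (I ∩ F) (hIF.symm.le (D.sum_smul_mem_spanX fun j hj => by simp [hj]))

variable {D} in
-- Rewriting the part over `F` through `I ∩ F` turns the relation into one over the basis `I`
-- without changing the coefficients off `F`.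
theorem IsBasisIndex.eq_zero_of_relation {F I : Finset ι} (hI : D.IsBasisIndex I)
    (hIF : D.spanX (I ∩ F) = D.spanX F) {y : ι → ℝ} (hy : ∀ j, j ∉ F → j ∉ I → y j = 0)
    (hsum : ∑ j, y j • D.X j = 0) {j : ι} (hj : j ∉ F) : y j = 0 := by
  obtain ⟨a, ha, hasum⟩ := exists_sum_eq_of_spanX_inter_eq hIF y
  have h := hI.eq_zero_of_sum_eq_zero (c := fun j => a j + if j ∈ F then 0 else y j)
    (fun i hi => by
      rw [ha i fun h => hi (Finset.mem_inter.1 h).1, zero_add]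
      split_ifs with hF
      · rfl
      · exact hy i hF hi)
    (by
      simp only [add_smul, Finset.sum_add_distrib]
      rw [hasum, ← sum_ite_mem_smul, hsum]) j
  simpa [hj, ha j fun h => hj (Finset.mem_inter.1 h).2] using h

variable {D} in
theorem IsBasisIndex.exists_coeff {B : Finset ι} (hB : D.IsBasisIndex B) :
    ∃ a : ι → ι → ℝ, (∀ k j, j ∉ B → a k j = 0) ∧ ∀ k, ∑ j, a k j • D.X j = D.X k := by
  have h : ∀ k, ∃ a : ι → ℝ, (∀ j, j ∉ B → a j = 0) ∧ ∑ j, a j • D.X j = D.X k := fun k =>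
    exists_sum_eq_of_mem_span D.X B (by
      have := hB.2
      rw [spanX] at this
      rw [this]
      trivial)
  choose a h1 h2 using h
  exact ⟨a, h1, h2⟩

/-- The completion of `ζ` to an element of the Lie algebra of `N_ℂ`, which uses the coefficients
`a k j` of the vectors `X k` with respect to a basis. -/
def complete (a : ι → ι → ℝ) (ζ : ι → ℂ) : ι → ℂ := fun j => ζ j - ∑ k, ζ k * a k j

variable {D} in
-- The subtracted term is the expansion of `∑ ζ_k X_k` in the basis. A general real-linear `f`
-- treats real and imaginary parts at once.
theorem sum_complete {a : ι → ι → ℝ} (ha : ∀ k, ∑ j, a k j • D.X j = D.X k) (f : ℂ →ₗ[ℝ] ℝ)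
    (ζ : ι → ℂ) : ∑ j, f (complete a ζ j) • D.X j = 0 := by
  have h : ∀ j, f (complete a ζ j) • D.X j = f (ζ j) • D.X j - ∑ k, f (ζ k) • a k j • D.X j := by
    intro j
    rw [complete, map_sub, sub_smul, map_sum, Finset.sum_smul]
    congr 1
    refine Finset.sum_congr rfl fun k _ => ?_
    rw [mul_comm, ← Complex.real_smul, map_smul, smul_smul, smul_eq_mul, mul_comm]
  rw [Finset.sum_congr rfl fun j _ => h j, Finset.sum_sub_distrib, Finset.sum_comm, sub_eq_zero]
  refine Finset.sum_congr rfl fun k _ => ?_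
  rw [← Finset.smul_sum, ha]

variable {D} in
theorem memLieNC_complete {a : ι → ι → ℝ} (ha : ∀ k, ∑ j, a k j • D.X j = D.X k) (ζ : ι → ℂ) :
    D.MemLieNC (complete a ζ) := by
  refine ⟨?_, sum_complete ha Complex.imLm ζ⟩
  have := sum_complete ha Complex.reLm ζ
  rw [show ∑ j, (complete a ζ j).re • D.X j = 0 from this]
  exact D.Q.zero_mem

theorem complete_apply_of_notMem {B : Finset ι} {a : ι → ι → ℝ} (ha : ∀ k j, j ∉ B → a k j = 0)
    (ζ : ι → ℂ) {j : ι} (hj : j ∉ B) : complete a ζ j = ζ j := by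
  simp [complete, ha _ j hj]

theorem cexp_mul_mem_CDelta {z : ι → ℂ} (hz : z ∈ D.CDelta) (ξ : ι → ℂ) :
    (fun j => cexp (ξ j) * z j) ∈ D.CDelta := by
  obtain ⟨J, hJ, h⟩ := hz
  exact ⟨J, hJ, fun j hj => mul_ne_zero (cexp_ne_zero _) (h j hj)⟩

theorem toQuot_eq_of_cexp_mul {z w : D.CDelta} {ξ : ι → ℂ} (hξ : D.MemLieNC ξ)
    (h : ∀ j, (w : ι → ℂ) j = cexp (ξ j) * (z : ι → ℂ) j) : D.toQuot z = D.toQuot w :=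
  D.toQuot_eq_iff.2 ⟨D.hull_congr fun j => by simp [h j, cexp_ne_zero], ξ, hξ, fun j _ => h j⟩

end LinearRelations

/-! ### Points normalised to `1` outside `F ∪ I`, and their identifications. -/

section Fill

variable {V ι : Type*} [AddCommGroup V] [Module ℝ V] [Fintype ι] [DecidableEq ι]
variable (D : PolyhedralData V ι)

/-- The point with the coordinates `v` in `F`, the coordinates `w` in `I \ F`, and `1` elsewhere. -/
def fill (F I : Finset ι) (w : (I \ F : Finset ι) → ℂ) (v : F → ℂ) : ι → ℂ := fun j =>
  if h : j ∈ F then v ⟨j, h⟩ else if h : j ∈ I \ F then w ⟨j, h⟩ else 1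

theorem fill_of_mem {F I : Finset ι} {w : (I \ F : Finset ι) → ℂ} {v : F → ℂ} {j : ι}
    (h : j ∈ F) : fill F I w v j = v ⟨j, h⟩ := dif_pos h

theorem fill_of_mem_sdiff {F I : Finset ι} {w : (I \ F : Finset ι) → ℂ} {v : F → ℂ} {j : ι}
    (h : j ∈ I \ F) : fill F I w v j = w ⟨j, h⟩ := by
  rw [fill, dif_neg (Finset.mem_sdiff.1 h).2, dif_pos h]

theorem fill_of_notMem {F I : Finset ι} {w : (I \ F : Finset ι) → ℂ} {v : F → ℂ} {j : ι}
    (h : j ∉ F) (h' : j ∉ I) : fill F I w v j = 1 := by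
  rw [fill, dif_neg h, dif_neg fun h'' => h' (Finset.mem_sdiff.1 h'').1]

theorem fill_ne_zero_of_notMem {F I : Finset ι} {w : (I \ F : Finset ι) → ℂ} (hw : ∀ j, w j ≠ 0)
    {v : F → ℂ} {j : ι} (h : j ∉ F) : fill F I w v j ≠ 0 := by
  by_cases h' : j ∈ I
  · rw [fill_of_mem_sdiff (Finset.mem_sdiff.2 ⟨h', h⟩)]
    exact hw _
  · rw [fill_of_notMem h h']
    exact one_ne_zero

variable {D} in
theorem fill_mem_CDelta {F : Finset ι} (hF : D.IsFace F) {I : Finset ι}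
    {w : (I \ F : Finset ι) → ℂ} (hw : ∀ j, w j ≠ 0) {v : F → ℂ} (hv : v ∈ (D.cone F).CDelta) :
    fill F I w v ∈ D.CDelta := by
  obtain ⟨K, hK, h⟩ := hv
  refine ⟨lift F K, (cone_isFace_iff hF K).1 hK, fun j hj => ?_⟩
  by_cases hjF : j ∈ F
  · rw [fill_of_mem hjF]
    exact h _ fun h' => hj (mem_lift.2 ⟨hjF, h'⟩)
  · exact fill_ne_zero_of_notMem hw hjF

variable {D} in
/-- The hull of a point with no zero outside of `F` can be computed in the cone. -/
theorem hull_eq_lift_hull {F : Finset ι} (hF : D.IsFace F) {z : ι → ℂ}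
    (hz : ∀ j, j ∉ F → z j ≠ 0) : D.hull z = lift F ((D.cone F).hull fun j => z j) := by
  ext j
  rw [mem_lift, mem_hull_iff]
  simp only [mem_hull_iff]
  constructor
  · intro h
    refine ⟨h F hF hz, fun K hK hzK => coe_mem_lift.1 ?_⟩
    refine h _ ((cone_isFace_iff hF K).1 hK) fun i hi => ?_
    by_cases hiF : i ∈ F
    · exact hzK ⟨i, hiF⟩ fun h' => hi (coe_mem_lift.2 h')
    · exact hz i hiF
  · rintro ⟨hjF, h⟩ J hJ hzJ
    obtain ⟨K, hK⟩ := exists_lift_eq (Finset.inter_subset_right : J ∩ F ⊆ F)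
    have h1 := h K ((cone_isFace_iff hF K).2 (hK ▸ hJ.inter hF)) fun i hi => hzJ i fun hiJ =>
      hi (coe_mem_lift.1 (hK ▸ Finset.mem_inter.2 ⟨hiJ, i.2⟩))
    have h2 := coe_mem_lift.2 h1
    rw [hK] at h2
    exact (Finset.mem_inter.1 h2).1

variable {D} in
theorem hull_fill {F : Finset ι} (hF : D.IsFace F) {I : Finset ι}
    {w : (I \ F : Finset ι) → ℂ} (hw : ∀ j, w j ≠ 0) (v : F → ℂ) :
    D.hull (fill F I w v) = lift F ((D.cone F).hull v) := by
  rw [hull_eq_lift_hull hF fun j hj => fill_ne_zero_of_notMem hw hj]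
  congr 2
  funext j
  exact fill_of_mem j.2

variable {D} in
theorem restrict_mem_cone_CDelta {F : Finset ι} (hF : D.IsFace F) {z : ι → ℂ} (hz : z ∈ D.CDelta) :
    (fun j : F => z j) ∈ (D.cone F).CDelta := by
  obtain ⟨J, hJ, h⟩ := hz
  obtain ⟨K, hK⟩ := exists_lift_eq (Finset.inter_subset_right : J ∩ F ⊆ F)
  refine ⟨K, (cone_isFace_iff hF K).2 (hK ▸ hJ.inter hF), fun i hi => h i fun hiJ => ?_⟩
  exact hi (coe_mem_lift.1 (hK ▸ Finset.mem_inter.2 ⟨hiJ, i.2⟩))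

theorem coe_cone_sum {F : Finset ι} {y : ι → ℝ} (hy : ∀ j, j ∉ F → y j = 0) :
    ((∑ j : F, y j • (D.cone F).X j : Submodule.span ℝ (D.X '' (F : Set ι))) : V) =
      ∑ j, y j • D.X j := by
  simp only [Submodule.coe_sum, Submodule.coe_smul, cone_X_coe]
  rw [Finset.sum_coe_sort F fun j => y j • D.X j]
  exact Finset.sum_subset (Finset.subset_univ F) fun i _ hi => by rw [hy i hi, zero_smul]

/-- This is where the choice of `Q ∩ 𝔡_F` as the subgroup of the cone enters. -/
theorem cone_memLieNC_iff {F : Finset ι} {ξ : ι → ℂ} (hξ : ∀ j, j ∉ F → ξ j = 0) :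
    (D.cone F).MemLieNC (fun j : F => ξ j) ↔ D.MemLieNC ξ := by
  refine and_congr ?_ ?_
  · rw [← D.coe_cone_sum (y := fun j => (ξ j).re) fun j hj => by simp [hξ j hj]]
    rfl
  · rw [← D.coe_cone_sum (y := fun j => (ξ j).im) fun j hj => by simp [hξ j hj]]
    exact Submodule.coe_eq_zero.symm

variable {D} in
theorem toQuot_fill_congr {F : Finset ι} (hF : D.IsFace F) {I : Finset ι} (w : PTorus (I \ F))
    {v v' : (D.cone F).CDelta} (h : (D.cone F).toQuot v = (D.cone F).toQuot v') :
    D.toQuot ⟨fill F I w.1 v, fill_mem_CDelta hF w.2 v.2⟩ =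
      D.toQuot ⟨fill F I w.1 v', fill_mem_CDelta hF w.2 v'.2⟩ := by
  obtain ⟨hh, ξ, hξ, hv⟩ := (D.cone F).toQuot_eq_iff.1 h
  let η : ι → ℂ := fun j => if h : j ∈ F then ξ ⟨j, h⟩ else 0
  have hη : (fun j : F => η j) = ξ := by
    funext j
    exact dif_pos j.2
  refine D.toQuot_eq_iff.2 ⟨?_, η, ?_, fun j hj => ?_⟩
  · rw [hull_fill hF w.2, hull_fill hF w.2, hh]
  · rwa [← cone_memLieNC_iff (F := F) D fun j hj => dif_neg hj, hη]
  · rw [hull_fill hF w.2] at hj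
    by_cases hjF : j ∈ F
    · simp only [fill_of_mem hjF, η, dif_pos hjF]
      exact hv _ fun h => hj (mem_lift.2 ⟨hjF, h⟩)
    · simp [fill, hjF, η, cexp_zero]

theorem torusMul_fill {F I : Finset ι} {γ : ι → Circle} (hγ : γ ∈ subtorus I)
    (w : (I \ F : Finset ι) → ℂ) (v : F → ℂ) :
    torusMul γ (fill F I w v) =
      fill F I (torusMul (restrictTorus (I \ F) γ) w) (torusMul (restrictTorus F γ) v) := by
  funext j
  by_cases hjF : j ∈ F
  · rw [torusMul, fill_of_mem hjF, fill_of_mem hjF]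
    rfl
  · by_cases hjI : j ∈ I
    · have := Finset.mem_sdiff.2 ⟨hjI, hjF⟩
      rw [torusMul, fill_of_mem_sdiff this, fill_of_mem_sdiff this]
      rfl
    · rw [torusMul, fill_of_notMem hjF hjI, fill_of_notMem hjF hjI, hγ j hjI]
      simp

variable {D} in
/-- The identifications between points which are normalised to `1` outside of `F ∪ I` come from
the group `Γ_I` and the relation of the cone. -/
theorem exists_gamma_of_toQuot_fill_eq {F I : Finset ι} (hF : D.IsFace F) (hI : D.IsBasisIndex I)
    (hIF : D.spanX (I ∩ F) = D.spanX F) {w w' : PTorus (I \ F)} {v v' : (D.cone F).CDelta}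
    (h : D.toQuot ⟨fill F I w.1 v, fill_mem_CDelta hF w.2 v.2⟩ =
      D.toQuot ⟨fill F I w'.1 v', fill_mem_CDelta hF w'.2 v'.2⟩) :
    ∃ γ : D.Gamma I, restrictTorus (I \ F) (γ : ι → Circle) • w = w' ∧
      restrictTorus F (γ : ι → Circle) • (D.cone F).toQuot v = (D.cone F).toQuot v' := by
  obtain ⟨hh, ξ, hξ, hz⟩ := D.toQuot_eq_iff.1 h
  simp only at hh hz
  have hull_sub : ∀ {j}, j ∉ F → j ∉ D.hull (fill F I w.1 v) := fun hj h => by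
    rw [hull_fill hF w.2] at h
    exact hj (lift_subset h)
  -- Both points have the coordinate `1` there, so the exponents are integers; their imaginary parts
  -- vanish, and independence of `I \ F` modulo the span of `F` propagates this to all of the
  -- complement of `F`.
  have hint : ∀ j, j ∉ F → j ∉ I → ∃ m : ℤ, ξ j = m := fun j hjF hjI => by
    have := hz j (hull_sub hjF)
    rw [fill_of_notMem hjF hjI, fill_of_notMem hjF hjI, mul_one] at this
    exact cexp_eq_one_iff.1 this.symm
  have him : ∀ j, j ∉ F → (ξ j).im = 0 := fun j hj =>
    hI.eq_zero_of_relation hIF (y := fun j => (ξ j).im) (fun i hiF hiI => by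
      obtain ⟨m, hm⟩ := hint i hiF hiI
      simp [hm]) hξ.2 hj
  obtain ⟨a, ha, hasum⟩ := exists_sum_eq_of_spanX_inter_eq hIF fun j => (ξ j).re
  -- The exponents of `γ`: unchanged on `I \ F`, replaced on `F` by equivalent ones supported in `I
  -- ∩ F`, and zero elsewhere. Dropping the integral exponents changes the sum by an element of `Q`,
  -- because `X j ∈ Q`.
  let y : ι → ℝ := fun j => if j ∈ F then a j else if j ∈ I then (ξ j).re else 0
  have hysum : ∑ j, y j • D.X j ∈ D.Q := by
    have h1 : ∑ j, (if j ∈ F then 0 else if j ∈ I then 0 else (ξ j).re) • D.X j ∈ D.Q := by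
      refine D.Q.sum_mem fun j _ => ?_
      split_ifs with h1 h2
      · simp [D.Q.zero_mem]
      · simp [D.Q.zero_mem]
      · obtain ⟨m, hm⟩ := hint j h1 h2
        rw [hm, Complex.intCast_re, Int.cast_smul_eq_zsmul]
        exact D.Q.zsmul_mem (D.X_mem j) m
    have h2 : ∑ j, y j • D.X j = ∑ j, (ξ j).re • D.X j -
        ∑ j, (if j ∈ F then 0 else if j ∈ I then 0 else (ξ j).re) • D.X j := by
      rw [D.sum_ite_mem_smul F fun j => (ξ j).re, ← hasum, ← Finset.sum_add_distrib,
        ← Finset.sum_sub_distrib]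
      refine Finset.sum_congr rfl fun j _ => ?_
      simp only [y]
      split_ifs with h1 h2
      · simp
      · rw [ha j fun h => h1 (Finset.mem_inter.1 h).2]
        simp
      · rw [ha j fun h => h1 (Finset.mem_inter.1 h).2]
        simp
    rw [h2]
    exact D.Q.sub_mem hξ.1 h1
  let γ : ι → Circle := fun j => Circle.exp (2 * Real.pi * y j)
  have hγ : γ ∈ D.Gamma I := by
    refine ⟨⟨y, hysum, fun _ => rfl⟩, fun j hj => ?_⟩
    have : y j = 0 := by
      simp only [y, if_neg hj]
      split_ifs
      · exact ha j fun h => hj (Finset.mem_inter.1 h).1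
      · rfl
    simp [γ, this]
  refine ⟨⟨γ, hγ⟩, Subtype.ext ?_, ?_⟩
  · funext j
    obtain ⟨hjI, hjF⟩ := Finset.mem_sdiff.1 j.2
    have h1 := hz j (hull_sub hjF)
    rw [fill_of_mem_sdiff j.2, fill_of_mem_sdiff j.2] at h1
    change ((γ j : Circle) : ℂ) * w.1 j = w'.1 j
    rw [h1, coe_circle_exp]
    congr 2
    apply Complex.ext
    · simp [y, hjI, hjF]
    · simp [him j hjF]
  · rw [smul_toQuot]
    -- What `γ` leaves over on `F`. Its real parts form a relation by the choice of `a`, and so do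
    -- its imaginary parts, since those of `ξ` vanish off `F`; thus it comes from the group of the
    -- cone.
    let η : ι → ℂ := fun j => if j ∈ F then ξ j - y j else 0
    have hη : D.MemLieNC η := by
      constructor
      · have : ∑ j, (η j).re • D.X j = 0 := by
          rw [← sub_self (∑ j, a j • D.X j)]
          nth_rw 1 [hasum]
          rw [← Finset.sum_sub_distrib]
          refine Finset.sum_congr rfl fun j _ => ?_
          by_cases hj : j ∈ F
          · simp [η, y, hj, sub_smul]
          · simp [η, hj, ha j fun h => hj (Finset.mem_inter.1 h).2]
        rw [this]
        exact D.Q.zero_mem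
      · rw [← hξ.2]
        refine Finset.sum_congr rfl fun j _ => ?_
        by_cases hj : j ∈ F
        · simp [η, hj]
        · simp [η, hj, him j hj]
    rw [← D.cone_memLieNC_iff (F := F) fun j hj => if_neg hj] at hη
    have hhull : (D.cone F).hull (torusMul (restrictTorus F γ) v.1) = (D.cone F).hull v :=
      (D.cone F).hull_congr fun j => by simp [torusMul]
    refine (D.cone F).toQuot_eq_iff.2 ⟨?_, _, hη, fun j hj => ?_⟩
    · refine hhull.trans ?_
      rw [hull_fill hF w.2, hull_fill hF w'.2] at hh
      exact Finset.map_injective _ hh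
    · simp only [hhull] at hj
      have h1 := hz j fun h => hj (by
        rw [hull_fill hF w.2] at h
        exact coe_mem_lift.1 h)
      rw [fill_of_mem j.2, fill_of_mem j.2] at h1
      change v'.1 j = cexp (η j) * (((γ j : Circle) : ℂ) * v.1 j)
      rw [h1, coe_circle_exp, ← mul_assoc, ← cexp_add]
      simp [η, j.2]

end Fill

/-! ### The local trivialization as a homeomorphism, and the stratum as its zero section. -/

section Trivialization

variable {V ι : Type*} [AddCommGroup V] [Module ℝ V] [Fintype ι] [DecidableEq ι]
variable (D : PolyhedralData V ι)

/-- The map `(w, [v]) ↦ [fill w v]`. -/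
def fillMap {F : Finset ι} (hF : D.IsFace F) (I : Finset ι)
    (p : PTorus (I \ F) × (D.cone F).XDelta) : D.XDelta :=
  Quot.lift (fun v : (D.cone F).CDelta =>
    D.toQuot ⟨fill F I p.1.1 v, fill_mem_CDelta hF p.1.2 v.2⟩)
    (fun _ _ h => toQuot_fill_congr hF p.1 (Quot.sound h)) p.2

theorem fillMap_mk {F : Finset ι} (hF : D.IsFace F) (I : Finset ι) (w : PTorus (I \ F))
    (v : (D.cone F).CDelta) : D.fillMap hF I (w, (D.cone F).toQuot v) =
      D.toQuot ⟨fill F I w.1 v, fill_mem_CDelta hF w.2 v.2⟩ := rfl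

theorem exists_toQuot_eq (x : D.XDelta) : ∃ z, D.toQuot z = x := Quot.exists_rep x

theorem continuous_fill {F I : Finset ι} :
    Continuous fun p : ((I \ F : Finset ι) → ℂ) × (F → ℂ) => fill F I p.1 p.2 := by
  refine continuous_pi fun j => ?_
  unfold fill
  split_ifs <;> fun_prop

theorem continuous_toQuot : Continuous D.toQuot := continuous_quot_mk

theorem isQuotientMap_toQuot : Topology.IsQuotientMap D.toQuot := isQuotientMap_quot_mk

/-- Multiplying a quotient map by the identity of a locally compact space gives a quotient map
again. This yields the joint continuity of `fillMap`. -/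
instance (S : Finset ι) : LocallyCompactSpace (PTorus S) := by
  have h : IsOpen {w : S → ℂ | ∀ j, w j ≠ 0} := by
    simp only [Set.ofPred_forall]
    exact isOpen_iInter_of_finite fun j => isOpen_ne_fun (continuous_apply j) continuous_const
  exact h.locallyCompactSpace

theorem continuous_fillMap {F : Finset ι} (hF : D.IsFace F) (I : Finset ι) :
    Continuous (D.fillMap hF I) := by
  refine (D.cone F).isQuotientMap_toQuot.continuous_lift_prod_right ?_
  refine D.continuous_toQuot.comp (Continuous.subtype_mk ?_ _)
  exact continuous_fill.comp
    ((continuous_subtype_val.comp continuous_fst).prodMk (continuous_subtype_val.comp continuous_snd))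

/-- An element of `Γ_I` preserves the coordinates `1` outside `I`, so it acts on a filled point
through its two components; as an element of `N` it acts trivially on the quotient. -/
theorem fillMap_smul {F : Finset ι} (hF : D.IsFace F) (I : Finset ι) (g : D.GammaCheck F I)
    (p : PTorus (I \ F) × (D.cone F).XDelta) : D.fillMap hF I (g • p) = D.fillMap hF I p := by
  obtain ⟨γ, rfl⟩ := QuotientGroup.mk_surjective g
  obtain ⟨w, x⟩ := p
  obtain ⟨v, rfl⟩ := (D.cone F).exists_toQuot_eq x
  rw [Prod.smul_mk, coneAction_mk, baseAction_mk, smul_toQuot, fillMap_mk, fillMap_mk,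
    ← D.N_smul γ γ.2.1 (D.toQuot ⟨fill F I w.1 v, _⟩), smul_toQuot]
  refine congrArg D.toQuot (Subtype.ext ?_)
  exact (torusMul_fill γ.2.2 w.1 v.1).symm

theorem fillMap_eq_iff {F I : Finset ι} (hF : D.IsFace F) (hI : D.IsBasisIndex I)
    (hIF : D.spanX (I ∩ F) = D.spanX F) {p q : PTorus (I \ F) × (D.cone F).XDelta} :
    D.fillMap hF I p = D.fillMap hF I q ↔ D.twistedMk F I p = D.twistedMk F I q := by
  constructor
  · intro h
    obtain ⟨w, x⟩ := p
    obtain ⟨w', x'⟩ := q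
    obtain ⟨v, rfl⟩ := (D.cone F).exists_toQuot_eq x
    obtain ⟨v', rfl⟩ := (D.cone F).exists_toQuot_eq x'
    obtain ⟨γ, h1, h2⟩ := exists_gamma_of_toQuot_fill_eq hF hI hIF h
    refine (Quotient.sound ?_ : D.twistedMk F I _ = D.twistedMk F I _)
    refine MulAction.orbitRel_apply.2 (MulAction.mem_orbit_symm.1 ⟨QuotientGroup.mk γ, ?_⟩)
    exact Prod.ext h1 h2
  · intro h
    obtain ⟨g, hg⟩ := MulAction.orbitRel_apply.1 (Quotient.exact h)
    rw [← hg]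
    exact D.fillMap_smul hF I g q

theorem hull_subset_of_fill {F I : Finset ι} (hF : D.IsFace F) (w : PTorus (I \ F)) (v : F → ℂ) :
    D.hull (fill F I w.1 v) ⊆ F := by
  rw [hull_fill hF w.2]
  exact lift_subset

/-- The condition on the logarithms `ζ` that the completion of `ζ` moves `z` to a point which has the
coordinates `1` outside of `F ∪ I`. -/
def IsNormalizer (F I : Finset ι) (z ζ : ι → ℂ) : Prop :=
  ∀ j, j ∉ F → j ∉ I → cexp (ζ j) * z j = 1

theorem fill_eq_of_isNormalizer {F I : Finset ι} {a : ι → ι → ℝ} (ha : ∀ k j, j ∉ I → a k j = 0)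
    {z ζ : ι → ℂ} (h : IsNormalizer F I z ζ) :
    fill F I (fun j => cexp (complete a ζ j) * z j) (fun j => cexp (complete a ζ j) * z j) =
      fun j => cexp (complete a ζ j) * z j := by
  funext j
  by_cases hjF : j ∈ F
  · rw [fill_of_mem hjF]
  · by_cases hjI : j ∈ I
    · rw [fill_of_mem_sdiff (Finset.mem_sdiff.2 ⟨hjI, hjF⟩)]
    · rw [fill_of_notMem hjF hjI, complete_apply_of_notMem ha ζ hjI, h j hjF hjI]

/-- The base component of the normalisation of `z`. -/
def baseCoord (F I : Finset ι) (a : ι → ι → ℝ) (ζ : ι → ℂ) (z : ι → ℂ)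
    (hz : ∀ j, j ∉ F → z j ≠ 0) : PTorus (I \ F) :=
  ⟨fun j => cexp (complete a ζ j) * z j,
    fun j => mul_ne_zero (cexp_ne_zero _) (hz j (Finset.mem_sdiff.1 j.2).2)⟩

/-- The cone component of the normalisation of `z`. -/
def coneCoord {F : Finset ι} (hF : D.IsFace F) (a : ι → ι → ℝ) (ζ : ι → ℂ) (z : D.CDelta) :
    (D.cone F).CDelta :=
  ⟨fun j => cexp (complete a ζ j) * (z : ι → ℂ) j,
    restrict_mem_cone_CDelta hF (D.cexp_mul_mem_CDelta z.2 (complete a ζ))⟩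

theorem fillMap_coord {F I : Finset ι} (hF : D.IsFace F) {a : ι → ι → ℝ}
    (ha : ∀ k j, j ∉ I → a k j = 0) (hsum : ∀ k, ∑ j, a k j • D.X j = D.X k) {z : D.CDelta}
    {ζ : ι → ℂ} (h : IsNormalizer F I z ζ) (hz : ∀ j, j ∉ F → (z : ι → ℂ) j ≠ 0) :
    D.fillMap hF I (baseCoord F I a ζ z hz, (D.cone F).toQuot (D.coneCoord hF a ζ z)) =
      D.toQuot z := by
  rw [fillMap_mk]
  refine (D.toQuot_eq_of_cexp_mul (memLieNC_complete hsum ζ) fun j => ?_).symm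
  exact congrFun (fill_eq_of_isNormalizer ha h) j

/-- Logarithms that depend continuously on `z` near `z₀`. -/
def localLog (F I : Finset ι) (z₀ ζ₀ z : ι → ℂ) : ι → ℂ := fun j =>
  if j ∈ F ∨ j ∈ I then 0 else ζ₀ j - Complex.log (z j / z₀ j) / (2 * Real.pi * Complex.I)

/-- No closeness of `z` to `z₀` is needed, because the exponential undoes any branch of the
logarithm; only continuity is local. -/
theorem isNormalizer_localLog {F I : Finset ι} {z₀ ζ₀ z : ι → ℂ} (h₀ : IsNormalizer F I z₀ ζ₀)
    (hz₀ : ∀ j, j ∉ F → z₀ j ≠ 0) (hz : ∀ j, j ∉ F → z j ≠ 0) :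
    IsNormalizer F I z (localLog F I z₀ ζ₀ z) := by
  intro j hjF hjI
  have h1 := hz₀ j hjF
  have h2 := hz j hjF
  have h3 := h₀ j hjF hjI
  rw [localLog, if_neg (by tauto), cexp_sub, eq_div_of_mul_eq h1 h3]
  have : cexp (Complex.log (z j / z₀ j) / (2 * Real.pi * Complex.I)) = z j / z₀ j := by
    rw [cexp, mul_div_cancel₀ _ Complex.two_pi_I_ne_zero, Complex.exp_log (div_ne_zero h2 h1)]
  rw [this]
  field_simp

theorem continuousAt_localLog {F I : Finset ι} {z₀ : ι → ℂ} (ζ₀ : ι → ℂ)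
    (hz₀ : ∀ j, j ∉ F → z₀ j ≠ 0) : ContinuousAt (localLog F I z₀ ζ₀) z₀ := by
  refine continuousAt_pi.2 fun j => ?_
  unfold localLog
  split_ifs with h
  · exact continuousAt_const
  · push Not at h
    refine continuousAt_const.sub (ContinuousAt.div_const ?_ _)
    refine ContinuousAt.clog ?_ ?_
    · exact (continuous_apply j).continuousAt.div_const _
    · rw [div_self (hz₀ j h.1)]
      exact Complex.one_mem_slitPlane

theorem exists_isNormalizer {F I : Finset ι} {z : ι → ℂ} (hz : ∀ j, j ∉ F → z j ≠ 0) :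
    ∃ ζ, IsNormalizer F I z ζ := by
  have h : ∀ j, ∃ ξ, j ∉ F → cexp ξ = (z j)⁻¹ := fun j => by
    by_cases hj : j ∈ F
    · exact ⟨0, fun h => absurd hj h⟩
    · obtain ⟨ξ, hξ⟩ := exists_cexp_eq (inv_ne_zero (hz j hj))
      exact ⟨ξ, fun _ => hξ⟩
  choose ζ hζ using h
  exact ⟨ζ, fun j hj _ => by rw [hζ j hj, inv_mul_cancel₀ (hz j hj)]⟩

theorem continuous_cexp : Continuous cexp := by
  unfold cexp
  fun_prop

theorem continuous_complete (a : ι → ι → ℝ) : Continuous (complete a) := by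
  unfold complete
  fun_prop

/-- The map from the twisted product to the neighbourhood of the stratum. -/
def trivMap {F : Finset ι} (hF : D.IsFace F) (I : Finset ι) (x : D.TwistedProduct F I) : D.nbhd F :=
  ⟨Quotient.lift (D.fillMap hF I) (by
      intro p q h
      obtain ⟨g, hg⟩ := MulAction.orbitRel_apply.1 h
      rw [← hg]
      exact D.fillMap_smul hF I g q) x, by
    obtain ⟨⟨w, y⟩, rfl⟩ := Quotient.exists_rep x
    obtain ⟨v, rfl⟩ := (D.cone F).exists_toQuot_eq y
    exact (toQuot_mem_nbhd_iff hF _).2 (D.hull_subset_of_fill hF w v)⟩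

theorem continuous_trivMap {F : Finset ι} (hF : D.IsFace F) (I : Finset ι) :
    Continuous (D.trivMap hF I) :=
  Continuous.subtype_mk ((D.continuous_fillMap hF I).quotient_lift _) _

theorem trivMap_bijective {F I : Finset ι} (hF : D.IsFace F) (hI : D.IsBasisIndex I)
    (hIF : D.spanX (I ∩ F) = D.spanX F) : Function.Bijective (D.trivMap hF I) := by
  constructor
  · intro x y h
    obtain ⟨p, rfl⟩ := Quotient.exists_rep x
    obtain ⟨q, rfl⟩ := Quotient.exists_rep y
    exact (D.fillMap_eq_iff hF hI hIF).1 (congrArg Subtype.val h)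
  · rintro ⟨x, hx⟩
    obtain ⟨z, rfl⟩ := D.exists_toQuot_eq x
    rw [toQuot_mem_nbhd_iff hF] at hx
    have hz : ∀ j, j ∉ F → (z : ι → ℂ) j ≠ 0 := fun j hj =>
      D.ne_zero_of_notMem_hull fun h => hj (hx h)
    obtain ⟨a, ha, hsum⟩ := hI.exists_coeff
    obtain ⟨ζ, hζ⟩ := exists_isNormalizer (I := I) hz
    refine ⟨D.twistedMk F I (baseCoord F I a ζ z hz, (D.cone F).toQuot (D.coneCoord hF a ζ z)),
      Subtype.ext ?_⟩
    exact D.fillMap_coord hF ha hsum hζ hz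

theorem continuous_twistedMk (F I : Finset ι) : Continuous (D.twistedMk F I) :=
  continuous_quotient_mk'

/-- Over an open set the projection from `CDelta` restricts to a quotient map, so continuity can be
tested upstairs. There, for each `z₀`, the normalisation with `localLog` based at `z₀` is a formula
for the inverse that is continuous at `z₀`. -/
theorem continuous_trivMap_symm {F I : Finset ι} (hF : D.IsFace F) (hI : D.IsBasisIndex I)
    (hIF : D.spanX (I ∩ F) = D.spanX F) :
    Continuous (Equiv.ofBijective _ (D.trivMap_bijective hF hI hIF)).symm := by
  set e := Equiv.ofBijective _ (D.trivMap_bijective hF hI hIF)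
  have hq := D.isQuotientMap_toQuot.restrictPreimage_isOpen (isOpen_nbhd hF)
  rw [hq.continuous_iff, continuous_iff_continuousAt]
  intro z₀
  have hz : ∀ z : D.toQuot ⁻¹' D.nbhd F, ∀ j, j ∉ F → ((z : D.CDelta) : ι → ℂ) j ≠ 0 :=
    fun z j hj => D.ne_zero_of_notMem_hull fun h => hj ((toQuot_mem_nbhd_iff hF z.1).1 z.2 h)
  obtain ⟨a, ha, hsum⟩ := hI.exists_coeff
  obtain ⟨ζ₀, hζ₀⟩ := exists_isNormalizer (I := I) (hz z₀)
  let ζ : D.toQuot ⁻¹' D.nbhd F → ι → ℂ := fun z => localLog F I z₀.1 ζ₀ z.1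
  have heq : e.symm ∘ (D.nbhd F).restrictPreimage D.toQuot = fun z => D.twistedMk F I
      (baseCoord F I a (ζ z) z.1 (hz z), (D.cone F).toQuot (D.coneCoord hF a (ζ z) z.1)) := by
    funext z
    rw [Function.comp_apply, Equiv.symm_apply_eq]
    exact Subtype.ext (D.fillMap_coord hF ha hsum
      (isNormalizer_localLog hζ₀ (hz z₀) (hz z)) (hz z)).symm
  rw [heq]
  have hval : Continuous fun z : D.toQuot ⁻¹' D.nbhd F => ((z : D.CDelta) : ι → ℂ) :=
    continuous_subtype_val.comp continuous_subtype_val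
  have hζ : ContinuousAt ζ z₀ :=
    (continuousAt_localLog (I := I) ζ₀ (hz z₀)).comp (f := fun z : D.toQuot ⁻¹' D.nbhd F =>
      ((z : D.CDelta) : ι → ℂ)) hval.continuousAt
  have hcoord : ∀ j, ContinuousAt (fun z : D.toQuot ⁻¹' D.nbhd F =>
      cexp (complete a (ζ z) j) * ((z : D.CDelta) : ι → ℂ) j) z₀ := by
    intro j
    refine ContinuousAt.mul ?_ ((continuous_apply j).comp hval).continuousAt
    refine continuous_cexp.continuousAt.comp ?_
    exact ((continuous_apply j).comp (continuous_complete a)).continuousAt.comp hζ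
  refine (D.continuous_twistedMk F I).continuousAt.comp (ContinuousAt.prodMk ?_ ?_)
  · refine Topology.IsInducing.subtypeVal.continuousAt_iff.2 ?_
    exact continuousAt_pi.2 fun j => hcoord j
  · refine (D.cone F).continuous_toQuot.continuousAt.comp ?_
    refine Topology.IsInducing.subtypeVal.continuousAt_iff.2 ?_
    exact continuousAt_pi.2 fun j => hcoord j

/-- The local trivialization. -/
def triv {F I : Finset ι} (hF : D.IsFace F) (hI : D.IsBasisIndex I)
    (hIF : D.spanX (I ∩ F) = D.spanX F) : D.TwistedProduct F I ≃ₜ D.nbhd F where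
  toEquiv := Equiv.ofBijective _ (D.trivMap_bijective hF hI hIF)
  continuous_toFun := D.continuous_trivMap hF I
  continuous_invFun := D.continuous_trivMap_symm hF hI hIF

/-- The origin of the cone. -/
def coneOrigin {F : Finset ι} (hF : D.IsFace F) : (D.cone F).CDelta :=
  ⟨0, Finset.univ, cone_isFace_univ hF, fun j hj => absurd (Finset.mem_univ j) hj⟩

/-- With the hull equal to everything, no coordinate is left to distinguish points: the apex stratum
of the cone is a single point. -/
theorem cone_toQuot_eq_origin {F : Finset ι} (hF : D.IsFace F) {v : (D.cone F).CDelta}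
    (h : (D.cone F).hull v = Finset.univ) :
    (D.cone F).toQuot v = (D.cone F).toQuot (D.coneOrigin hF) := by
  refine (D.cone F).toQuot_eq_iff.2 ⟨?_, 0, (D.cone F).memLieNC_zero, fun j hj => ?_⟩
  · rw [h]
    exact (hull_eq_of_zeros (cone_isFace_univ hF) fun j => by simp [coneOrigin]).symm
  · rw [h] at hj
    exact absurd (Finset.mem_univ j) hj

theorem smul_coneOrigin {F I : Finset ι} (hF : D.IsFace F) (g : D.GammaCheck F I) :
    g • (D.cone F).toQuot (D.coneOrigin hF) = (D.cone F).toQuot (D.coneOrigin hF) := by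
  obtain ⟨γ, rfl⟩ := QuotientGroup.mk_surjective g
  rw [coneAction_mk, smul_toQuot]
  refine congrArg _ (Subtype.ext (funext fun j => ?_))
  simp [torusMul, coneOrigin]

theorem fill_zero_eq_slicePoint {F I : Finset ι} (w : (I \ F : Finset ι) → ℂ) :
    fill F I w 0 = slicePoint (I \ F) F w := by
  funext j
  unfold fill slicePoint
  by_cases hjF : j ∈ F
  · simp [hjF]
  · simp [hjF]

/-- The zero section of the twisted product. -/
def zeroSection {F : Finset ι} (hF : D.IsFace F) (I : Finset ι)
    (x : MulAction.orbitRel.Quotient (D.GammaCheck F I) (PTorus (I \ F))) : D.TwistedProduct F I :=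
  Quotient.map' (fun w => (w, (D.cone F).toQuot (D.coneOrigin hF))) (by
    rintro w w' ⟨g, hg⟩
    refine ⟨g, ?_⟩
    exact Prod.ext hg (D.smul_coneOrigin hF g)) x

/-- The projection of the twisted product to its base. -/
def baseProj (F I : Finset ι) (x : D.TwistedProduct F I) :
    MulAction.orbitRel.Quotient (D.GammaCheck F I) (PTorus (I \ F)) :=
  Quotient.map' Prod.fst (by
    rintro p p' ⟨g, hg⟩
    exact ⟨g, congrArg Prod.fst hg⟩) x

theorem baseProj_zeroSection {F : Finset ι} (hF : D.IsFace F) (I : Finset ι)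
    (x : MulAction.orbitRel.Quotient (D.GammaCheck F I) (PTorus (I \ F))) :
    D.baseProj F I (D.zeroSection hF I x) = x := by
  obtain ⟨w, rfl⟩ := Quotient.exists_rep x
  rfl

theorem continuous_zeroSection {F : Finset ι} (hF : D.IsFace F) (I : Finset ι) :
    Continuous (D.zeroSection hF I) :=
  Continuous.quotient_map' (by fun_prop) _

theorem continuous_baseProj (F I : Finset ι) : Continuous (D.baseProj F I) :=
  Continuous.quotient_map' continuous_fst _

theorem triv_mem_stratum_iff {F I : Finset ι} (hF : D.IsFace F) (hI : D.IsBasisIndex I)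
    (hIF : D.spanX (I ∩ F) = D.spanX F) (x : D.TwistedProduct F I) :
    (D.triv hF hI hIF x : D.XDelta) ∈ D.stratum F ↔
      D.zeroSection hF I (D.baseProj F I x) = x := by
  obtain ⟨⟨w, y⟩, rfl⟩ := Quotient.exists_rep x
  obtain ⟨v, rfl⟩ := (D.cone F).exists_toQuot_eq y
  have h1 : D.zeroSection hF I (D.baseProj F I ⟦(w, (D.cone F).toQuot v)⟧) =
    D.twistedMk F I (w, (D.cone F).toQuot (D.coneOrigin hF)) := rfl
  have h2 : (D.triv hF hI hIF ⟦(w, (D.cone F).toQuot v)⟧ : D.XDelta) =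
    D.toQuot ⟨fill F I w.1 v, fill_mem_CDelta hF w.2 v.2⟩ := rfl
  rw [h1, h2, toQuot_mem_stratum_iff hF]
  change D.hull (fill F I w.1 v) = F ↔ _
  rw [hull_fill hF w.2]
  constructor
  · intro h
    rw [← D.cone_toQuot_eq_origin hF (Finset.map_injective _ (h.trans (lift_univ F).symm))]
    rfl
  · intro h
    have h3 := D.hull_eq_of_toQuot_eq ((D.fillMap_eq_iff hF hI hIF).2 h)
    change D.hull (fill F I w.1 (D.coneOrigin hF)) = D.hull (fill F I w.1 v) at h3
    rw [hull_fill hF w.2, hull_fill hF w.2] at h3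
    rw [← h3]
    have : (D.cone F).hull (D.coneOrigin hF) = Finset.univ :=
      hull_eq_of_zeros (cone_isFace_univ hF) fun j => by simp [coneOrigin]
    rw [this, lift_univ]

/-- The stratum of `F` as a quotient of a torus. -/
def stratumHomeomorph {F I : Finset ι} (hF : D.IsFace F) (hI : D.IsBasisIndex I)
    (hIF : D.spanX (I ∩ F) = D.spanX F) :
    MulAction.orbitRel.Quotient (D.GammaCheck F I) (PTorus (I \ F)) ≃ₜ D.stratum F where
  toFun x := ⟨D.triv hF hI hIF (D.zeroSection hF I x),
    (D.triv_mem_stratum_iff hF hI hIF _).2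
      (congrArg (D.zeroSection hF I) (D.baseProj_zeroSection hF I x))⟩
  invFun x := D.baseProj F I ((D.triv hF hI hIF).symm
    ⟨x, stratum_subset_nbhd hF hF subset_rfl x.2⟩)
  left_inv x := by simp [baseProj_zeroSection]
  right_inv := by
    rintro ⟨x, hx⟩
    refine Subtype.ext ?_
    have h := (D.triv_mem_stratum_iff hF hI hIF ((D.triv hF hI hIF).symm
      ⟨x, stratum_subset_nbhd hF hF subset_rfl hx⟩)).1 (by simpa using hx)
    simp [h]
  continuous_toFun := Continuous.subtype_mk (continuous_subtype_val.comp
    ((D.triv hF hI hIF).continuous.comp (D.continuous_zeroSection hF I))) _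
  continuous_invFun := (D.continuous_baseProj F I).comp ((D.triv hF hI hIF).symm.continuous.comp
    (Continuous.subtype_mk continuous_subtype_val _))

theorem stratumHomeomorph_mk {F I : Finset ι} (hF : D.IsFace F) (hI : D.IsBasisIndex I)
    (hIF : D.spanX (I ∩ F) = D.spanX F) (w : PTorus (I \ F)) :
    (D.stratumHomeomorph hF hI hIF (Quotient.mk _ w) : D.XDelta) =
      (D.stratumChart F hF I).proj w := by
  change D.toQuot ⟨fill F I w.1 0, _⟩ = D.toQuot ⟨slicePoint (I \ F) F w.1, _⟩
  exact congrArg D.toQuot (Subtype.ext (fill_zero_eq_slicePoint w.1))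

end Trivialization

/-! ### Logarithmic coordinates. -/

section ExponentialCharts

/-- The chart `ξ ↦ z exp (2πi ξ)` near `z ≠ 0`. -/
def expChart (z : ℂ) (hz : z ≠ 0) : OpenPartialHomeomorph ℂ ℂ :=
  (Homeomorph.mulLeft₀ (2 * Real.pi * Complex.I : ℂ)
    Complex.two_pi_I_ne_zero).toOpenPartialHomeomorph.trans
    (Complex.expOpenPartialHomeomorph.trans (Homeomorph.mulLeft₀ z hz).toOpenPartialHomeomorph)

theorem expChart_apply (z : ℂ) (hz : z ≠ 0) (ξ : ℂ) : expChart z hz ξ = z * cexp ξ := rfl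

theorem zero_mem_expChart_source (z : ℂ) (hz : z ≠ 0) : (0 : ℂ) ∈ (expChart z hz).source := by
  simp [expChart, Complex.expOpenPartialHomeomorph, Real.pi_pos]

theorem differentiable_cexp : Differentiable ℂ cexp := by
  unfold cexp
  fun_prop

theorem differentiableOn_expChart_symm (z : ℂ) (hz : z ≠ 0) :
    DifferentiableOn ℂ (expChart z hz).symm (expChart z hz).target := by
  have h1 : ∀ u ∈ (expChart z hz).target, z⁻¹ * u ∈ Complex.slitPlane := by
    intro u hu
    simpa [expChart, Complex.expOpenPartialHomeomorph] using hu
  have h2 : ∀ u, (expChart z hz).symm u =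
      (2 * Real.pi * Complex.I : ℂ)⁻¹ * Complex.log (z⁻¹ * u) := fun u => rfl
  intro u hu
  refine DifferentiableAt.differentiableWithinAt ?_
  rw [show ((expChart z hz).symm : ℂ → ℂ) = fun u =>
    (2 * Real.pi * Complex.I : ℂ)⁻¹ * Complex.log (z⁻¹ * u) from funext h2]
  refine DifferentiableAt.const_mul (DifferentiableAt.clog ?_ (h1 u hu)) _
  fun_prop

/-- The identity for `z = 0`, and otherwise the chart `ξ ↦ z exp (2πi ξ)`. -/
def coordChart (z : ℂ) : OpenPartialHomeomorph ℂ ℂ :=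
  if hz : z = 0 then OpenPartialHomeomorph.refl ℂ else expChart z hz

theorem coordChart_apply (z ξ : ℂ) : coordChart z ξ = if z = 0 then ξ else z * cexp ξ := by
  unfold coordChart
  split_ifs
  · rfl
  · rw [expChart_apply]

theorem zero_mem_coordChart_source (z : ℂ) : (0 : ℂ) ∈ (coordChart z).source := by
  unfold coordChart
  split_ifs
  · trivial
  · exact zero_mem_expChart_source _ _

theorem differentiable_coordChart (z : ℂ) : Differentiable ℂ (coordChart z) := by
  have : (coordChart z : ℂ → ℂ) = fun ξ => if z = 0 then ξ else z * cexp ξ :=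
    funext (coordChart_apply z)
  rw [this]
  split_ifs
  · fun_prop
  · exact differentiable_cexp.const_mul z

theorem differentiableOn_coordChart_symm (z : ℂ) :
    DifferentiableOn ℂ (coordChart z).symm (coordChart z).target := by
  unfold coordChart
  split_ifs
  · exact differentiableOn_id
  · exact differentiableOn_expChart_symm _ _

/-- Logarithmic coordinates, for the nonzero coordinates, near `z`. -/
def logChart {S : Type*} [Fintype S] (z : S → ℂ) : OpenPartialHomeomorph (S → ℂ) (S → ℂ) :=
  OpenPartialHomeomorph.pi fun s => coordChart (z s)

variable {S : Type*} [Fintype S]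

theorem logChart_apply (z m : S → ℂ) (s : S) :
    logChart z m s = if z s = 0 then m s else z s * cexp (m s) := coordChart_apply _ _

theorem zero_mem_logChart_source (z : S → ℂ) : 0 ∈ (logChart z).source :=
  fun _ _ => zero_mem_coordChart_source _

theorem logChart_zero (z : S → ℂ) : logChart z 0 = z := by
  funext s
  rw [logChart_apply]
  split_ifs with h
  · exact h.symm
  · simp [cexp_zero]

theorem differentiable_logChart (z : S → ℂ) : Differentiable ℂ (logChart z) :=
  differentiable_pi.2 fun s => (differentiable_coordChart (z s)).comp (differentiable_apply s)

theorem differentiableOn_logChart_symm (z : S → ℂ) :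
    DifferentiableOn ℂ (logChart z).symm (logChart z).target :=
  differentiableOn_pi.2 fun s => (differentiableOn_coordChart_symm (z s)).comp
    (differentiable_apply s).differentiableOn fun _ hu => hu s trivial

end ExponentialCharts

/-! ### Transition maps in logarithmic coordinates. -/

section ChangeOfBasis

variable {W ι : Type*} [AddCommGroup W] [Module ℝ W] [Fintype ι] [DecidableEq ι] (x : ι → W)

/-- The complex coefficients `m` and `n` represent the same element of the complexification. -/
def SameVector {S T : Finset ι} (m : S → ℂ) (n : T → ℂ) : Prop :=
  ∀ f : ℂ →ₗ[ℝ] ℝ, ∑ t, f (n t) • x t = ∑ s, f (m s) • x s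

variable {x}

theorem SameVector.symm {S T : Finset ι} {m : S → ℂ} {n : T → ℂ} (h : SameVector x m n) :
    SameVector x n m := fun f => (h f).symm

theorem SameVector.unique {S T : Finset ι} (hT : LinearIndependent ℝ fun t : T => x t) {m : S → ℂ}
    {n n' : T → ℂ} (h : SameVector x m n) (h' : SameVector x m n') : n = n' := by
  have key : ∀ f : ℂ →ₗ[ℝ] ℝ, ∀ t, f (n t) = f (n' t) := by
    intro f t
    have h0 : ∑ t, (f (n t) - f (n' t)) • x t = 0 := by
      simp only [sub_smul, Finset.sum_sub_distrib, h f, h' f, sub_self]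
    exact sub_eq_zero.1 (Fintype.linearIndependent_iff.1 hT _ h0 t)
  funext t
  exact Complex.ext (key Complex.reLm t) (key Complex.imLm t)

/-- The change of the coefficients for two bases. -/
def changeBasis {S T : Finset ι} (b : Basis T ℝ W) : (S → ℂ) →ₗ[ℂ] (T → ℂ) :=
  Matrix.toLin' (Matrix.of fun (t : T) (s : S) => (b.repr (x s) t : ℂ))

theorem sameVector_changeBasis {S T : Finset ι} (b : Basis T ℝ W) (hb : ∀ t, b t = x t)
    (m : S → ℂ) : SameVector x m (changeBasis (x := x) b m) := by
  intro f
  have h : ∀ t, f (changeBasis (x := x) b m t) = ∑ s, f (m s) * b.repr (x s) t := by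
    intro t
    simp only [changeBasis, Matrix.toLin'_apply, Matrix.mulVec, dotProduct, Matrix.of_apply, map_sum]
    refine Finset.sum_congr rfl fun s _ => ?_
    rw [← Complex.real_smul, map_smul, smul_eq_mul, mul_comm]
  simp only [h, Finset.sum_smul]
  rw [Finset.sum_comm]
  refine Finset.sum_congr rfl fun s _ => ?_
  simp only [mul_smul, ← Finset.smul_sum]
  congr 1
  conv_rhs => rw [← b.sum_repr (x s)]
  simp only [hb]

/-- The coefficients outside of `P`. -/
def offPart {S : Finset ι} (P : Finset ι) (m : S → ℂ) : S → ℂ := fun s =>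
  if (s : ι) ∈ P then 0 else m s

/-- The transition map between logarithmic coordinates with respect to two bases, for
points whose coordinates vanish exactly on `P`. -/
def skewMap {S T P : Finset ι} (hPS : P ⊆ S) (L : (S → ℂ) →ₗ[ℂ] (T → ℂ)) (c : ι → ℂ) (m : S → ℂ) :
    T → ℂ := fun t =>
  if h : (t : ι) ∈ P then m ⟨t, hPS h⟩ * cexp (c t + L (offPart P m) t) else L (offPart P m) t

theorem sameVector_restrict {S T P : Finset ι} (hPT : P ⊆ T) {q : S → ℂ} {q' : T → ℂ}
    (hq : ∀ s : S, (s : ι) ∉ P → q s = 0) (hq' : ∀ t : T, (t : ι) ∉ P → q' t = 0)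
    (h : ∀ j (hS : j ∈ S) (hT : j ∈ T), j ∈ P → q ⟨j, hS⟩ = q' ⟨j, hT⟩) (hPS : P ⊆ S) :
    SameVector x q q' := by
  intro f
  have key : ∀ (R : Finset ι) (r : R → ℂ), P ⊆ R → (∀ s : R, (s : ι) ∉ P → r s = 0) →
      ∑ s, f (r s) • x s = ∑ j ∈ P, (if h : j ∈ R then f (r ⟨j, h⟩) else 0) • x j := by
    intro R r hPR hr
    rw [Finset.sum_subset hPR,
      ← Finset.sum_coe_sort R fun j => (if h : j ∈ R then f (r ⟨j, h⟩) else 0) • x j]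
    · exact Finset.sum_congr rfl fun s _ => by rw [dif_pos s.2]
    · intro j hj hjP
      rw [dif_pos hj, hr ⟨j, hj⟩ hjP, map_zero, zero_smul]
  rw [key T q' hPT hq', key S q hPS hq]
  refine Finset.sum_congr rfl fun j hj => ?_
  rw [dif_pos (hPT hj), dif_pos (hPS hj), h j (hPS hj) (hPT hj) hj]

/-- The off-`P` part of the image represents the original vector minus its components `n` along `P`.
Expanding it back in `S` gives `m` off `P` and `-n` on `P`, so the exponential factors on the
`P`-coordinates cancel once `c` is negated. -/
theorem skewMap_skewMap {S T P : Finset ι} (hPS : P ⊆ S) (hPT : P ⊆ T) (bS : Basis S ℝ W)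
    (bT : Basis T ℝ W) (hS : ∀ s, bS s = x s) (hT : ∀ t, bT t = x t) (c : ι → ℂ) (m : S → ℂ) :
    skewMap hPT (changeBasis (x := x) bS) (-c) (skewMap hPS (changeBasis (x := x) bT) c m) = m := by
  have hliS : LinearIndependent ℝ fun s : S => x s := by
    rw [← show ⇑bS = fun s : S => x s from funext hS]
    exact bS.linearIndependent
  set n := changeBasis (x := x) bT (offPart P m) with hn
  set y := skewMap hPS (changeBasis (x := x) bT) c m with hy
  have hback : changeBasis (x := x) bS (offPart P y) = fun s : S =>
      if h : (s : ι) ∈ P then - n ⟨s, hPT h⟩ else m s := by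
    refine SameVector.unique hliS (sameVector_changeBasis bS hS _) fun f => ?_
    have h1 := sameVector_changeBasis bT hT (offPart P m) f
    rw [← hn] at h1
    have h2 := sameVector_restrict (x := x) hPT
      (q := fun s : S => if h : (s : ι) ∈ P then n ⟨s, hPT h⟩ else 0)
      (q' := fun t : T => if (t : ι) ∈ P then n t else 0) (P := P)
      (fun s hs => dif_neg hs) (fun t ht => if_neg ht)
      (fun j _ _ hj => by simp [hj]) hPS f
    have h3 : ∀ s : S, f (if h : (s : ι) ∈ P then - n ⟨s, hPT h⟩ else m s) =
        f (offPart P m s) - f (if h : (s : ι) ∈ P then n ⟨s, hPT h⟩ else 0) := by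
      intro s
      unfold offPart
      split_ifs <;> simp
    have h4 : ∀ t : T, f (offPart P y t) = f (n t) - f (if (t : ι) ∈ P then n t else 0) := by
      intro t
      unfold offPart
      split_ifs with h
      · simp
      · simp [hy, skewMap, h, hn]
    simp only [h3, h4, sub_smul, Finset.sum_sub_distrib, h1, h2]
  funext s
  by_cases h : (s : ι) ∈ P
  · simp only [skewMap, dif_pos h, hback]
    rw [hy]
    simp only [skewMap, dif_pos h]
    rw [← hn, mul_assoc, ← cexp_add, Pi.neg_apply]
    rw [show c s + n ⟨s, hPT h⟩ + (-c s + -n ⟨s, hPT h⟩) = 0 by ring, cexp_zero, mul_one]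
  · simp only [skewMap, dif_neg h, hback]

theorem differentiable_offPart {S P : Finset ι} :
    Differentiable ℂ (offPart P : (S → ℂ) → S → ℂ) := by
  refine differentiable_pi.2 fun s => ?_
  unfold offPart
  split_ifs <;> fun_prop

theorem differentiable_skewMap {S T P : Finset ι} (hPS : P ⊆ S) (L : (S → ℂ) →ₗ[ℂ] (T → ℂ))
    (c : ι → ℂ) : Differentiable ℂ (skewMap hPS L c) := by
  have hL : Differentiable ℂ fun m : S → ℂ => L (offPart P m) :=
    L.toContinuousLinearMap.differentiable.comp differentiable_offPart
  refine differentiable_pi.2 fun t => ?_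
  have hLt : Differentiable ℂ fun m : S → ℂ => L (offPart P m) t := differentiable_pi.1 hL t
  unfold skewMap
  split_ifs with h
  · exact (differentiable_apply _).mul (differentiable_cexp.comp (hLt.const_add (c t)))
  · exact hLt

/-- Given two bases and points `z`, `z'` of the coordinate spaces with the same zero set `P`, the
change of basis in logarithmic coordinates is a biholomorphic map near `z` which maps `z` to `z'`. -/
theorem exists_local_biholomorphism {S T P : Finset ι} (hPS : P ⊆ S) (hPT : P ⊆ T)
    (bS : Basis S ℝ W) (bT : Basis T ℝ W) (hS : ∀ s, bS s = x s) (hT : ∀ t, bT t = x t)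
    {z : S → ℂ} {z' : T → ℂ} (hz : ∀ s, z s = 0 ↔ (s : ι) ∈ P) (hz' : ∀ t, z' t = 0 ↔ (t : ι) ∈ P)
    (c : ι → ℂ) :
    ∃ e : OpenPartialHomeomorph (S → ℂ) (T → ℂ), z ∈ e.source ∧ e z = z' ∧
      DifferentiableOn ℂ e e.source ∧ DifferentiableOn ℂ e.symm e.target ∧
      ∀ u ∈ e.source, ∃ (η : S → ℂ) (θ : T → ℂ), (∀ s : S, (s : ι) ∈ P → η s = 0) ∧
        SameVector x η θ ∧ (∀ s : S, (s : ι) ∉ P → u s = z s * cexp (η s)) ∧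
        (∀ t : T, (t : ι) ∉ P → e u t = z' t * cexp (θ t)) ∧
        ∀ j (hjS : j ∈ S) (hjT : j ∈ T), j ∈ P →
          e u ⟨j, hjT⟩ = u ⟨j, hjS⟩ * cexp (c j + θ ⟨j, hjT⟩) := by
  let Φ : (S → ℂ) ≃ₜ (T → ℂ) :=
    { toFun := skewMap hPS (changeBasis (x := x) bT) c
      invFun := skewMap hPT (changeBasis (x := x) bS) (-c)
      left_inv := skewMap_skewMap hPS hPT bS bT hS hT c
      right_inv := fun m => by
        have := skewMap_skewMap hPT hPS bT bS hT hS (-c) m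
        rwa [neg_neg] at this
      continuous_toFun := (differentiable_skewMap _ _ _).continuous
      continuous_invFun := (differentiable_skewMap _ _ _).continuous }
  have hΦ : ∀ m, Φ m = skewMap hPS (changeBasis (x := x) bT) c m := fun _ => rfl
  have hΦ0 : Φ 0 = 0 := by
    have h0 : offPart P (0 : S → ℂ) = 0 := by
      funext s
      simp [offPart]
    funext t
    simp [hΦ, skewMap, h0]
  have hz0 : (logChart z).symm z = 0 := by
    have := (logChart z).left_inv (zero_mem_logChart_source z)
    rwa [logChart_zero] at this
  have hzt : z ∈ (logChart z).target := by
    have := (logChart z).map_source (zero_mem_logChart_source z)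
    rwa [logChart_zero] at this
  let e := (logChart z).symm.trans (Φ.toOpenPartialHomeomorph.trans (logChart z'))
  have he : ∀ u, e u = logChart z' (Φ ((logChart z).symm u)) := fun _ => rfl
  have hsrc : ∀ u, u ∈ e.source ↔ u ∈ (logChart z).target ∧
      Φ ((logChart z).symm u) ∈ (logChart z').source := fun u => by simp [e]
  have htgt : ∀ u, u ∈ e.target → u ∈ (logChart z').target := fun u hu => by
    simp only [e, OpenPartialHomeomorph.trans_target, Set.mem_inter_iff] at hu
    exact hu.1.1
  refine ⟨e, ?_, ?_, ?_, ?_, fun u hu => ?_⟩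
  · rw [hsrc, hz0, hΦ0]
    exact ⟨hzt, zero_mem_logChart_source z'⟩
  · rw [he, hz0, hΦ0, logChart_zero]
  · exact (differentiable_logChart z').comp_differentiableOn
      ((differentiable_skewMap hPS _ c).comp_differentiableOn
        ((differentiableOn_logChart_symm z).mono fun u hu => ((hsrc u).1 hu).1))
  · exact (differentiable_logChart z).comp_differentiableOn
      ((differentiable_skewMap hPT _ (-c)).comp_differentiableOn
        ((differentiableOn_logChart_symm z').mono htgt))
  · set m := (logChart z).symm u
    have hum : logChart z m = u := (logChart z).right_inv ((hsrc u).1 hu).1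
    refine ⟨offPart P m, changeBasis (x := x) bT (offPart P m), fun s hs => if_pos hs,
      sameVector_changeBasis bT hT _, fun s hs => ?_, fun t ht => ?_, fun j hjS hjT hj => ?_⟩
    · rw [← hum, logChart_apply, if_neg fun h => hs ((hz s).1 h), offPart, if_neg hs]
    · rw [he, logChart_apply, if_neg fun h => ht ((hz' t).1 h), hΦ, skewMap, dif_neg ht]
    · have huj : u ⟨j, hjS⟩ = m ⟨j, hjS⟩ := by
        rw [← congrFun hum, logChart_apply, if_pos ((hz _).2 hj)]
      rw [he, logChart_apply, if_pos ((hz' _).2 hj), hΦ, skewMap, dif_pos hj, huj]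

end ChangeOfBasis

/-! ### Compatibility of the charts within one piece. -/

section Compatibility

variable {V ι : Type*} [AddCommGroup V] [Module ℝ V] [Fintype ι] [DecidableEq ι]
variable (D : PolyhedralData V ι)

/-- Extension of coefficients by zero. -/
def extendZero {S : Finset ι} (m : S → ℂ) : ι → ℂ := fun j =>
  if h : j ∈ S then m ⟨j, h⟩ else 0

theorem extendZero_coe {S : Finset ι} (m : S → ℂ) (s : S) : extendZero m s = m s := dif_pos s.2

theorem extendZero_of_notMem {S : Finset ι} (m : S → ℂ) {j : ι} (hj : j ∉ S) :
    extendZero m j = 0 := dif_neg hj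

theorem sum_extendZero {W : Type*} [AddCommGroup W] [Module ℝ W] (x : ι → W) {S : Finset ι}
    (m : S → ℂ) (f : ℂ →ₗ[ℝ] ℝ) : ∑ j, f (extendZero m j) • x j = ∑ s, f (m s) • x s := by
  rw [← Finset.sum_subset (Finset.subset_univ S) fun j _ hj => by
    rw [extendZero_of_notMem m hj, map_zero, zero_smul],
    ← Finset.sum_coe_sort S fun j => f (extendZero m j) • x j]
  exact Finset.sum_congr rfl fun s _ => by rw [extendZero_coe]

theorem sum_sub_extendZero {W : Type*} [AddCommGroup W] [Module ℝ W] {x : ι → W} {S T : Finset ι}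
    {m : S → ℂ} {n : T → ℂ} (h : SameVector x m n) (f : ℂ →ₗ[ℝ] ℝ) :
    ∑ j, f (extendZero n j - extendZero m j) • x j = 0 := by
  simp only [map_sub, sub_smul, Finset.sum_sub_distrib, sum_extendZero, h f, sub_self]

theorem slicePoint_coe {S J : Finset ι} (w : S → ℂ) (s : S) : slicePoint S J w s = w s :=
  dif_pos s.2

theorem slicePoint_of_notMem {S J : Finset ι} (w : S → ℂ) {j : ι} (hj : j ∉ S) :
    slicePoint S J w j = if j ∈ J then 0 else 1 := dif_neg hj

theorem slicePoint_eq_mul {S J P : Finset ι} {u z η : S → ℂ}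
    (h : ∀ s : S, (s : ι) ∉ P → u s = z s * cexp (η s)) {j : ι} (hj : j ∉ P) :
    slicePoint S J u j = slicePoint S J z j * cexp (extendZero η j) := by
  by_cases hjS : j ∈ S
  · rw [slicePoint_coe u ⟨j, hjS⟩, slicePoint_coe z ⟨j, hjS⟩, extendZero_coe η ⟨j, hjS⟩, h _ hj]
  · rw [slicePoint_of_notMem u hjS, slicePoint_of_notMem z hjS, extendZero_of_notMem η hjS,
      cexp_zero, mul_one]

theorem slicePoint_sdiff_eq_zero_iff {B J : Finset ι} {w : (B \ J : Finset ι) → ℂ}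
    (hw : ∀ j, w j ≠ 0) (j : ι) : slicePoint (B \ J) J w j = 0 ↔ j ∈ J := by
  by_cases hj : j ∈ B \ J
  · rw [slicePoint_coe w ⟨j, hj⟩]
    exact iff_of_false (hw _) (Finset.mem_sdiff.1 hj).2
  · rw [slicePoint_of_notMem w hj]
    simp

variable {D} in
theorem hull_slicePoint {J : Finset ι} (hJ : D.IsFace J) {B : Finset ι}
    {w : (B \ J : Finset ι) → ℂ} (hw : ∀ j, w j ≠ 0) :
    D.hull (slicePoint (B \ J) J w) = J :=
  hull_eq_of_zeros hJ (slicePoint_sdiff_eq_zero_iff hw)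

theorem memLieNC_of_sums {ξ : ι → ℂ} (h : ∀ f : ℂ →ₗ[ℝ] ℝ, ∑ j, f (ξ j) • D.X j = 0) :
    D.MemLieNC ξ := by
  refine ⟨?_, h Complex.imLm⟩
  rw [show ∑ j, (ξ j).re • D.X j = 0 from h Complex.reLm]
  exact D.Q.zero_mem

variable {D} in
-- Charts of a stratum ignore the coordinates in `J`, so their transitions are changes of basis in
-- the quotient by the span of `J`.
theorem IsBasisIndex.exists_quotient_basis {B J : Finset ι} (hB : D.IsBasisIndex B)
    (h : D.spanX (B ∩ J) = D.spanX J) :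
    ∃ b : Basis ↥(B \ J) ℝ (V ⧸ D.spanX J), ∀ s, b s = (D.spanX J).mkQ (D.X s) := by
  have hli : LinearIndependent ℝ fun s : ↥(B \ J) => (D.spanX J).mkQ (D.X s) := by
    rw [Fintype.linearIndependent_iff]
    intro g hg s
    let y : ι → ℝ := fun j => if h : j ∈ B \ J then g ⟨j, h⟩ else 0
    have hy : ∑ j, y j • D.X j = ∑ s, g s • D.X s := by
      rw [← Finset.sum_subset (Finset.subset_univ (B \ J)) fun j _ hj => by
        rw [show y j = 0 from dif_neg hj, zero_smul],
        ← Finset.sum_coe_sort (B \ J) fun j => y j • D.X j]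
      exact Finset.sum_congr rfl fun s _ => by rw [show y s = g s from dif_pos s.2]
    have hmem : ∑ j, y j • D.X j ∈ D.spanX J := by
      rw [hy, ← Submodule.Quotient.mk_eq_zero, ← Submodule.mkQ_apply, map_sum]
      simpa only [map_smul] using hg
    obtain ⟨a, ha, hsum⟩ := exists_sum_eq_of_mem_span D.X J hmem
    have hsJ := (Finset.mem_sdiff.1 s.2).2
    have := hB.eq_zero_of_relation h (y := fun j => y j - a j) (fun j hjJ hjB => by
      rw [ha j hjJ, sub_zero]
      exact dif_neg fun h' => hjB (Finset.mem_sdiff.1 h').1)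
      (by simp only [sub_smul, Finset.sum_sub_distrib, hsum, sub_self]) hsJ
    rw [ha _ hsJ, sub_zero] at this
    rwa [show y s = g s from dif_pos s.2] at this
  refine ⟨Basis.mk hli ?_, fun s => Basis.mk_apply _ _ s⟩
  have htop : (D.spanX B).map (D.spanX J).mkQ = ⊤ := by
    rw [hB.spanX_eq_top, Submodule.map_top, Submodule.range_mkQ]
  rw [← htop, spanX, Submodule.map_span, Submodule.span_le]
  rintro _ ⟨_, ⟨j, hj, rfl⟩, rfl⟩
  by_cases hjJ : j ∈ J
  · rw [Submodule.mkQ_apply, (Submodule.Quotient.mk_eq_zero _).2 (X_mem_spanX hjJ)]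
    exact Submodule.zero_mem _
  · exact Submodule.subset_span ⟨⟨j, Finset.mem_sdiff.2 ⟨hj, hjJ⟩⟩, rfl⟩

variable {D} in
-- The difference of the two expansions lies in the span of `J` and is cancelled by exponents on
-- `J`, which do not matter for points with hull `J`.
theorem exists_memLieNC_of_sameVector {S T J : Finset ι} {m : S → ℂ} {n : T → ℂ}
    (h : SameVector (fun j => (D.spanX J).mkQ (D.X j)) m n) :
    ∃ ξ, D.MemLieNC ξ ∧ ∀ j, j ∉ J → ξ j = extendZero n j - extendZero m j := by
  have key : ∀ f : ℂ →ₗ[ℝ] ℝ, ∃ a : ι → ℝ, (∀ j, j ∉ J → a j = 0) ∧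
      ∑ j, a j • D.X j = ∑ j, f (extendZero n j - extendZero m j) • D.X j := by
    intro f
    refine exists_sum_eq_of_mem_span D.X J ?_
    rw [← Submodule.Quotient.mk_eq_zero, ← Submodule.mkQ_apply, map_sum]
    simpa only [map_smul] using sum_sub_extendZero h f
  obtain ⟨a, ha, hasum⟩ := key Complex.reLm
  obtain ⟨b, hb, hbsum⟩ := key Complex.imLm
  refine ⟨fun j => extendZero n j - extendZero m j - ⟨a j, b j⟩, ⟨?_, ?_⟩, fun j hj => ?_⟩
  · have : ∑ j, (extendZero n j - extendZero m j - ⟨a j, b j⟩ : ℂ).re • D.X j = 0 := by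
      have h1 : ∀ j, (extendZero n j - extendZero m j - ⟨a j, b j⟩ : ℂ).re • D.X j =
          Complex.reLm (extendZero n j - extendZero m j) • D.X j - a j • D.X j :=
        fun j => sub_smul _ _ _
      rw [Finset.sum_congr rfl fun j _ => h1 j, Finset.sum_sub_distrib, hasum, sub_self]
    rw [this]
    exact D.Q.zero_mem
  · have h1 : ∀ j, (extendZero n j - extendZero m j - ⟨a j, b j⟩ : ℂ).im • D.X j =
        Complex.imLm (extendZero n j - extendZero m j) • D.X j - b j • D.X j :=
      fun j => sub_smul _ _ _
    rw [Finset.sum_congr rfl fun j _ => h1 j, Finset.sum_sub_distrib, hbsum, sub_self]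
  · beta_reduce
    rw [ha j hj, hb j hj]
    exact sub_zero _

variable {D} in
/-- Any two charts of a stratum are compatible. -/
theorem stratumChart_lifts {J : Finset ι} (hJ : D.IsFace J) {B B' : Finset ι}
    (hB : D.IsBasisIndex B) (hB' : D.IsBasisIndex B') (h : D.spanX (B ∩ J) = D.spanX J)
    (h' : D.spanX (B' ∩ J) = D.spanX J) :
    LiftsBiholomorphically id (D.stratumChart J hJ B) (D.stratumChart J hJ B') := by
  rintro ⟨(z : ↥(B \ J) → ℂ), (hz : ∀ j, z j ≠ 0)⟩
    ⟨(z' : ↥(B' \ J) → ℂ), (hz' : ∀ j, z' j ≠ 0)⟩ heq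
  obtain ⟨-, ξ₀, hξ₀, hz0⟩ := D.toQuot_eq_iff.1 heq
  simp only [hull_slicePoint hJ hz] at hz0
  obtain ⟨b, hb⟩ := hB.exists_quotient_basis h
  obtain ⟨b', hb'⟩ := hB'.exists_quotient_basis h'
  obtain ⟨e, hze, hez, hd, hd', he⟩ := exists_local_biholomorphism
    (x := fun j => (D.spanX J).mkQ (D.X j)) (P := ∅) (Finset.empty_subset _) (Finset.empty_subset _)
    b b' hb hb' (z := z) (z' := z') (fun s => iff_of_false (hz s) (Finset.notMem_empty _))
    (fun s => iff_of_false (hz' s) (Finset.notMem_empty _)) 0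
  refine ⟨e, hze, hez, fun u hu s => ?_, fun u hu t => ?_, hd, hd', ?_⟩
  · obtain ⟨η, -, -, -, h1, -⟩ := he u hu
    rw [h1 s (Finset.notMem_empty _)]
    exact mul_ne_zero (hz s) (cexp_ne_zero _)
  · obtain ⟨-, θ, -, -, -, h1, -⟩ := he (e.symm u) (e.map_target hu)
    rw [← e.right_inv hu, h1 t (Finset.notMem_empty _)]
    exact mul_ne_zero (hz' t) (cexp_ne_zero _)
  · rintro ⟨(u : ↥(B \ J) → ℂ), hu⟩ ⟨(y : ↥(B' \ J) → ℂ), hy⟩ hue hey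
    obtain ⟨η, θ, -, hsame, h1, h2, -⟩ := he u hue
    obtain ⟨κ, hκ, hκ'⟩ := exists_memLieNC_of_sameVector hsame
    -- Off `J`, `u = z exp η`, `z' = exp ξ₀ z` and `y = z' exp θ`, so `y` and `u` differ by `ξ₀ + θ
    -- - η`.
    refine D.toQuot_eq_iff.2 ⟨?_, ξ₀ + κ, hξ₀.add hκ, fun j hj => ?_⟩
    · rw [hull_slicePoint hJ hu, hull_slicePoint hJ hy]
    · simp only [hull_slicePoint hJ hu] at hj ⊢
      change e u = y at hey
      rw [hey] at h2
      have h3 := slicePoint_eq_mul (J := J) h1 (Finset.notMem_empty j)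
      have h4 := slicePoint_eq_mul (J := J) h2 (Finset.notMem_empty j)
      have h5 := hz0 j hj
      rw [h3, h4, h5, Pi.add_apply, hκ' j hj, cexp_add, cexp_sub]
      have := cexp_ne_zero (extendZero η j)
      field_simp

variable {D} in
theorem IsBasisIndex.exists_basis {B : Finset ι} (hB : D.IsBasisIndex B) :
    ∃ b : Basis B ℝ V, ∀ s, b s = D.X s := by
  refine ⟨Basis.mk hB.1 ?_, fun s => Basis.mk_apply _ _ s⟩
  rw [← hB.spanX_eq_top, spanX, Set.image_eq_range]
  rfl

theorem slicePoint_empty_ne_zero {B : Finset ι} (w : B → ℂ) {j : ι} (hj : j ∉ B) :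
    slicePoint B ∅ w j ≠ 0 := by
  rw [slicePoint_of_notMem w hj]
  simp

variable {D} in
-- It suffices that the zeros lie inside a regular index set, since subsets of such a set are again
-- regular; so points near one with zero set `J` stay in the domain.
theorem mem_regularChart_dom [FiniteDimensional ℝ V] {B J : Finset ι} (hJ : D.IsRegularFace J)
    {w : B → ℂ} (hw : ∀ s : B, (s : ι) ∉ J → w s ≠ 0) : w ∈ (D.regularChart B).dom := by
  classical
  refine ⟨J.filter fun j => slicePoint B ∅ w j = 0, hJ.subset (Finset.filter_subset _ _),
    fun j => ?_⟩
  rw [Finset.mem_filter]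
  refine ⟨fun h => ⟨?_, h⟩, fun h => h.2⟩
  by_contra hj
  by_cases hjB : j ∈ B
  · rw [slicePoint_coe w ⟨j, hjB⟩] at h
    exact hw _ hj h
  · exact slicePoint_empty_ne_zero w hjB h

variable {D} in
/-- Any two charts of the regular piece are compatible. -/
theorem regularChart_lifts [FiniteDimensional ℝ V] {B B' : Finset ι}
    (hB : D.IsBasisIndex B) (hB' : D.IsBasisIndex B') :
    LiftsBiholomorphically id (D.regularChart B) (D.regularChart B') := by
  rintro ⟨(z : B → ℂ), J, hJ, hz⟩ ⟨(z' : B' → ℂ), J', hJ', hz'⟩ heq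
  obtain ⟨hh, ξ₀, hξ₀, hz0⟩ := D.toQuot_eq_iff.1 heq
  simp only [hull_eq_of_zeros hJ.1 hz] at hz0 hh
  rw [hull_eq_of_zeros hJ'.1 hz'] at hh
  subst hh
  have hJB : J ⊆ B := fun j hj => by
    by_contra hjB
    exact slicePoint_empty_ne_zero z hjB ((hz j).2 hj)
  have hJB' : J ⊆ B' := fun j hj => by
    by_contra hjB
    exact slicePoint_empty_ne_zero z' hjB ((hz' j).2 hj)
  obtain ⟨b, hb⟩ := hB.exists_basis
  obtain ⟨b', hb'⟩ := hB'.exists_basis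
  have hzs : ∀ s, z s = 0 ↔ (s : ι) ∈ J := fun s => by rw [← hz, slicePoint_coe]
  have hzt : ∀ s, z' s = 0 ↔ (s : ι) ∈ J := fun s => by rw [← hz', slicePoint_coe]
  -- On the coordinates in `J` both base points vanish and cannot absorb the element `ξ₀` relating
  -- them, so its exponents are passed explicitly as the factors there.
  obtain ⟨e, hze, hez, hd, hd', he⟩ := exists_local_biholomorphism (x := D.X) hJB hJB'
    b b' hb hb' hzs hzt ξ₀
  refine ⟨e, hze, hez, fun u hu => ?_, fun u hu => ?_, hd, hd', ?_⟩
  · obtain ⟨η, -, -, -, h1, -⟩ := he u hu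
    refine mem_regularChart_dom hJ fun s hs => ?_
    rw [h1 s hs]
    exact mul_ne_zero (fun h => hs ((hzs s).1 h)) (cexp_ne_zero _)
  · obtain ⟨-, θ, -, -, -, h1, -⟩ := he (e.symm u) (e.map_target hu)
    refine mem_regularChart_dom hJ fun t ht => ?_
    rw [← e.right_inv hu, h1 t ht]
    exact mul_ne_zero (fun h => ht ((hzt t).1 h)) (cexp_ne_zero _)
  · rintro ⟨(u : B → ℂ), hu⟩ ⟨(y : B' → ℂ), hy⟩ hue hey
    obtain ⟨η, θ, hη, hsame, h1, h2, h3⟩ := he u hue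
    change e u = y at hey
    rw [hey] at h2 h3
    refine D.toQuot_eq_of_cexp_mul (ξ := ξ₀ + (extendZero θ - extendZero η))
      (hξ₀.add (D.memLieNC_of_sums (sum_sub_extendZero hsame))) fun j => ?_
    simp only [Pi.add_apply, Pi.sub_apply, cexp_add, cexp_sub]
    by_cases hj : j ∈ J
    · rw [slicePoint_coe y ⟨j, hJB' hj⟩, slicePoint_coe u ⟨j, hJB hj⟩, h3 j (hJB hj) (hJB' hj) hj,
        extendZero_coe θ ⟨j, hJB' hj⟩, extendZero_coe η ⟨j, hJB hj⟩, hη _ hj, cexp_zero, cexp_add]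
      ring
    · rw [slicePoint_eq_mul (J := ∅) h1 hj, slicePoint_eq_mul (J := ∅) h2 hj, hz0 j hj]
      have := cexp_ne_zero (extendZero η j)
      field_simp

end Compatibility

/-! ### Covering of the pieces by charts when all facets share a vertex, as in a cone. -/

section Cover

variable {V ι : Type*} [AddCommGroup V] [Module ℝ V] [Fintype ι] [DecidableEq ι]
variable (D : PolyhedralData V ι)

variable {D} in
theorem spanX_univ_of_faceDim_eq_zero [FiniteDimensional ℝ V] (h : D.IsFace Finset.univ)
    (h0 : D.faceDim Finset.univ = 0) : D.spanX Finset.univ = ⊤ := by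
  have := h.faceDim_add_finrank
  rw [h0, zero_add] at this
  exact Submodule.eq_top_of_finrank_eq this

variable {D} in
/-- If all facets meet in a vertex, the charts of a stratum cover it. -/
theorem stratumAtlas_cover [FiniteDimensional ℝ V] (h : D.IsFace Finset.univ)
    (h0 : D.faceDim Finset.univ = 0) {J : Finset ι} (hJ : D.IsFace J) :
    ⋃ c ∈ D.stratumAtlas J hJ, Set.range c.proj = D.stratum J := by
  apply Set.Subset.antisymm
  · refine Set.iUnion₂_subset ?_
    rintro _ ⟨B, -, -, rfl⟩ _ ⟨w, rfl⟩
    exact (toQuot_mem_stratum_iff hJ _).2 (hull_slicePoint hJ w.2)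
  · intro x hx
    obtain ⟨z, rfl⟩ := D.exists_toQuot_eq x
    rw [toQuot_mem_stratum_iff hJ] at hx
    -- Any basis is admissible, because the common vertex has the full index set; one adapted to `J`
    -- gives a chart of the stratum, and the normalisation of `z` lies in it.
    obtain ⟨B, -, hli, hspan, hBJ⟩ := D.exists_adapted_basis (Finset.subset_univ J)
    have hB : D.IsBasisIndex B := ⟨hli, hspan.trans (spanX_univ_of_faceDim_eq_zero h h0)⟩
    have hz : ∀ j, j ∉ J → (z : ι → ℂ) j ≠ 0 := fun j hj =>
      D.ne_zero_of_notMem_hull (hx ▸ hj)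
    obtain ⟨a, ha, hsum⟩ := hB.exists_coeff
    obtain ⟨ζ, hζ⟩ := exists_isNormalizer (I := B) hz
    refine Set.mem_biUnion (x := D.stratumChart J hJ B)
      ⟨B, hB.isBasisSet h h0 (Finset.subset_univ _), (hB.spanX_inter_eq_iff hJ).1 hBJ, rfl⟩
      ⟨baseCoord J B a ζ z hz, ?_⟩
    refine (D.toQuot_eq_iff.2 ⟨?_, complete a ζ, memLieNC_complete hsum ζ, fun j hj => ?_⟩).symm
    · rw [hx]
      exact (hull_slicePoint hJ (baseCoord J B a ζ z hz).2).symm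
    · rw [hx] at hj
      by_cases hjB : j ∈ B
      · exact slicePoint_coe _ ⟨j, Finset.mem_sdiff.2 ⟨hjB, hj⟩⟩
      · rw [complete_apply_of_notMem ha ζ hjB, hζ j hj hjB]
        refine (slicePoint_of_notMem _ fun h' => hjB (Finset.mem_sdiff.1 h').1).trans ?_
        rw [if_neg hj]

variable {D} in
/-- If all facets meet in a vertex, the charts of the regular piece cover it. -/
theorem regularAtlas_cover [FiniteDimensional ℝ V] (h : D.IsFace Finset.univ)
    (h0 : D.faceDim Finset.univ = 0) :
    ⋃ c ∈ D.regularAtlas, Set.range c.proj = D.regularPiece := by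
  apply Set.Subset.antisymm
  · refine Set.iUnion₂_subset ?_
    rintro _ ⟨B, -, rfl⟩ _ ⟨⟨w, J, hJ, hw⟩, rfl⟩
    refine (D.toQuot_mem_regularPiece_iff _).2 ?_
    simp only [hull_eq_of_zeros hJ.1 hw]
    exact hJ
  · intro x hx
    obtain ⟨z, rfl⟩ := D.exists_toQuot_eq x
    rw [toQuot_mem_regularPiece_iff] at hx
    obtain ⟨B, hJB, -, hli, hspan⟩ := D.exists_extension (Finset.subset_univ (D.hull z))
      ((D.isRegularFace_iff _).1 hx).2
    have hB : D.IsBasisIndex B := ⟨hli, hspan.trans (spanX_univ_of_faceDim_eq_zero h h0)⟩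
    obtain ⟨a, ha, hsum⟩ := hB.exists_coeff
    obtain ⟨ζ, hζ⟩ := exists_isNormalizer (F := D.hull z) (I := B) (z := z)
      fun j hj => D.ne_zero_of_notMem_hull hj
    have hslice : ∀ j, slicePoint B ∅ (fun s : B => cexp (complete a ζ s) * (z : ι → ℂ) s) j =
        cexp (complete a ζ j) * (z : ι → ℂ) j := by
      intro j
      by_cases hjB : j ∈ B
      · exact slicePoint_coe _ ⟨j, hjB⟩
      · rw [slicePoint_of_notMem _ hjB, complete_apply_of_notMem ha ζ hjB,
          hζ j (fun h' => hjB (hJB h')) hjB]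
        simp
    refine Set.mem_biUnion (x := D.regularChart B)
      ⟨B, hB.isBasisSet h h0 (Finset.subset_univ _), rfl⟩
      ⟨⟨fun s : B => cexp (complete a ζ s) * (z : ι → ℂ) s, D.hull z, hx, fun j => ?_⟩, ?_⟩
    · rw [hslice, mul_eq_zero, or_iff_right (cexp_ne_zero _), eq_zero_iff_mem_hull hx]
    · exact (D.toQuot_eq_of_cexp_mul (memLieNC_complete hsum ζ) hslice).symm

end Cover

end PolyhedralData

-- Reducing biholomorphy to compatibility of charts in the target.

universe u v w

/-- The chart `c` is, through `f` and a linear change of coordinates, a restriction of the chart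
`c'` to an open subset. -/
def QuasifoldChart.IsRestrictionOf {X : Type v} {Y : Type w} (f : X → Y)
    (c : QuasifoldChart.{u} X) (c' : QuasifoldChart.{u} Y) : Prop :=
  ∃ (R : c.E ≃L[ℂ] c'.E) (O : Set c.E), IsOpen O ∧ c.dom ⊆ O ∧
    (∀ a ∈ O, R a ∈ c'.dom → a ∈ c.dom) ∧
    ∃ hR : ∀ a ∈ c.dom, R a ∈ c'.dom, ∀ a : c.dom, f (c.proj a) = c'.proj ⟨R a, hR a a.2⟩

/-- The lift is the transition map from `c₁` to `c'`, precomposed with the linear isomorphism and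
cut down to the open set. -/
theorem LiftsBiholomorphically.of_isRestrictionOf {X : Type v} {Y : Type w} {f : X → Y}
    {c : QuasifoldChart.{u} X} {c₁ c' : QuasifoldChart.{u} Y} (h : c.IsRestrictionOf f c₁)
    (h' : LiftsBiholomorphically id c₁ c') : LiftsBiholomorphically f c c' := by
  obtain ⟨R, O, hO, hdom, hOdom, hR, hproj⟩ := h
  intro a b hab
  rw [hproj] at hab
  obtain ⟨e, hae, heb, hs, ht, hd, hd', he⟩ := h' _ b hab
  let e' := (R.toHomeomorph.transOpenPartialHomeomorph e).restrOpen O hO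
  have hsrc : ∀ x, x ∈ e'.source ↔ R x ∈ e.source ∧ x ∈ O := fun x => Iff.rfl
  have htgt : e'.target ⊆ e.target := fun y hy => by
    have h1 := e'.map_target hy
    have h2 := e.map_source ((hsrc _).1 h1).1
    have h3 : e (R (e'.symm y)) = y := e'.right_inv hy
    rwa [h3] at h2
  refine ⟨e', (hsrc _).2 ⟨hae, hdom a.2⟩, heb, fun x hx => ?_, htgt.trans ht, ?_, ?_, ?_⟩
  · obtain ⟨h1, h2⟩ := (hsrc x).1 hx
    exact hOdom x h2 (hs h1)
  · exact hd.comp R.differentiable.differentiableOn fun x hx => ((hsrc x).1 hx).1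
  · exact R.symm.differentiable.comp_differentiableOn (hd'.mono htgt)
  · intro x y hx hxy
    rw [hproj]
    exact he ⟨R x, hR x x.2⟩ y ((hsrc _).1 hx).1 hxy

theorem isBiholomorphicOn_of_isRestrictionOf {X : Type v} {Y : Type w} {f : X → Y} {P : Set X}
    {𝒜 : Set (QuasifoldChart.{u} X)} {P' : Set Y} {ℬ : Set (QuasifoldChart.{u} Y)}
    (hbij : Set.BijOn f P P') (hcover : ⋃ c ∈ 𝒜, Set.range c.proj = P)
    (hrestr : ∀ c ∈ 𝒜, ∃ c' ∈ ℬ, c.IsRestrictionOf f c')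
    (hcompat : ∀ c ∈ ℬ, ∀ c' ∈ ℬ, LiftsBiholomorphically id c c') :
    IsBiholomorphicOn f P 𝒜 P' ℬ where
  bijOn := hbij
  cover := hcover
  cover' := by
    intro y hy
    obtain ⟨x, hx, rfl⟩ := hbij.surjOn hy
    rw [← hcover] at hx
    simp only [Set.mem_iUnion] at hx
    obtain ⟨c, hc, a, rfl⟩ := hx
    obtain ⟨c', hc', R, O, -, -, -, hR, hproj⟩ := hrestr c hc
    exact Set.mem_biUnion hc' ⟨_, (hproj a).symm⟩
  lifts := by
    intro c hc c' hc'
    obtain ⟨c₁, hc₁, h⟩ := hrestr c hc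
    exact .of_isRestrictionOf h (hcompat c₁ hc₁ c' hc')

namespace PolyhedralData

/-! ### Joining torus and cone coordinates. -/

section Join

variable {ι : Type*} [Fintype ι] [DecidableEq ι]

/-- Coordinates in `I \ F` and in a subset `T` of `F` give coordinates in the union `S`. -/
def joinEquiv {F I S : Finset ι} {T : Finset F} (hS : ∀ j, j ∈ S ↔ j ∈ I \ F ∨ j ∈ lift F T) :
    (((I \ F : Finset ι) → ℂ) × (T → ℂ)) ≃ₗ[ℂ] (S → ℂ) where
  toFun p s := if h : (s : ι) ∈ F then
      p.2 ⟨⟨s, h⟩, coe_mem_lift.1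
        (((hS s).1 s.2).resolve_left fun h' => (Finset.mem_sdiff.1 h').2 h)⟩
    else p.1 ⟨s, ((hS s).1 s.2).resolve_right fun h' => h (lift_subset h')⟩
  map_add' p q := by
    funext s
    by_cases h : (s : ι) ∈ F <;> simp [h]
  map_smul' a p := by
    funext s
    by_cases h : (s : ι) ∈ F <;> simp [h]
  invFun u := (fun j => u ⟨j, (hS j).2 (Or.inl j.2)⟩,
    fun t => u ⟨(t : F), (hS _).2 (Or.inr (coe_mem_lift.2 t.2))⟩)
  left_inv p := by
    refine Prod.ext (funext fun j => ?_) (funext fun t => ?_)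
    · exact dif_neg (Finset.mem_sdiff.1 j.2).2
    · exact dif_pos (t : F).2
  right_inv u := by
    funext s
    by_cases h : (s : ι) ∈ F <;> simp [h]

variable {F I S : Finset ι} {T : Finset F} (hS : ∀ j, j ∈ S ↔ j ∈ I \ F ∨ j ∈ lift F T)

theorem joinEquiv_of_mem (p : ((I \ F : Finset ι) → ℂ) × (T → ℂ)) {s : S} (h : (s : ι) ∈ F)
    (hT : (⟨s, h⟩ : F) ∈ T) : joinEquiv hS p s = p.2 ⟨⟨s, h⟩, hT⟩ := dif_pos h

theorem joinEquiv_of_notMem (p : ((I \ F : Finset ι) → ℂ) × (T → ℂ)) {s : S} (h : (s : ι) ∉ F)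
    (hI : (s : ι) ∈ I \ F) : joinEquiv hS p s = p.1 ⟨s, hI⟩ := dif_neg h

theorem joinEquiv_ne_zero_iff (p : ((I \ F : Finset ι) → ℂ) × (T → ℂ)) :
    (∀ s, joinEquiv hS p s ≠ 0) ↔ (∀ j, p.1 j ≠ 0) ∧ ∀ t, p.2 t ≠ 0 := by
  constructor
  · intro h
    refine ⟨fun j => ?_, fun t => ?_⟩
    · have := h ⟨j, (hS j).2 (Or.inl j.2)⟩
      rwa [joinEquiv_of_notMem hS p (Finset.mem_sdiff.1 j.2).2 j.2] at this
    · have := h ⟨(t : F), (hS _).2 (Or.inr (coe_mem_lift.2 t.2))⟩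
      rwa [joinEquiv_of_mem hS p (t : F).2 t.2] at this
  · rintro ⟨h1, h2⟩ s
    rcases (hS s).1 s.2 with h | h
    · rw [joinEquiv_of_notMem hS p (Finset.mem_sdiff.1 h).2 h]
      exact h1 _
    · obtain ⟨hF, hT⟩ := mem_lift.1 h
      rw [joinEquiv_of_mem hS p hF hT]
      exact h2 _

/-- The identity holds for points of `ℂ^d`, before passing to the quotient; hence the trivialization
is linear in the charts. -/
theorem fill_slicePoint (K : Finset F) (p : ((I \ F : Finset ι) → ℂ) × (T → ℂ)) :
    fill F I p.1 (slicePoint T K p.2) = slicePoint S (lift F K) (joinEquiv hS p) := by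
  funext j
  by_cases hjS : j ∈ S
  · rw [slicePoint_coe (joinEquiv hS p) ⟨j, hjS⟩]
    rcases (hS j).1 hjS with h | h
    · rw [joinEquiv_of_notMem hS p (Finset.mem_sdiff.1 h).2 h, fill_of_mem_sdiff h]
    · obtain ⟨hF, hT⟩ := mem_lift.1 h
      rw [joinEquiv_of_mem hS p hF hT, fill_of_mem hF]
      exact slicePoint_coe p.2 ⟨⟨j, hF⟩, hT⟩
  · rw [slicePoint_of_notMem _ hjS]
    have h := fun h => hjS ((hS j).2 h)
    by_cases hjF : j ∈ F
    · rw [fill_of_mem hjF, slicePoint_of_notMem _ fun h' => h (Or.inr (mem_lift.2 ⟨hjF, h'⟩))]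
      simp [hjF]
    · rw [fill_of_notMem hjF fun hI => h (Or.inl (Finset.mem_sdiff.2 ⟨hI, hjF⟩)),
        if_neg fun h' => hjF (lift_subset h')]

end Join

/-! ### The trivialization on pieces and in charts. -/

section Pieces

variable {V ι : Type*} [AddCommGroup V] [Module ℝ V] [Fintype ι] [DecidableEq ι]
variable (D : PolyhedralData V ι)

theorem twistedChart_cover {F I : Finset ι} {P : Set (D.cone F).XDelta}
    {𝒜 : Set (QuasifoldChart (D.cone F).XDelta)} (h : ⋃ c ∈ 𝒜, Set.range c.proj = P) :
    ⋃ c ∈ D.twistedChart F I '' 𝒜, Set.range c.proj = D.twistedPiece F I P := by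
  subst h
  ext x
  simp only [Set.mem_iUnion, twistedPiece]
  constructor
  · rintro ⟨_, ⟨c, hc, rfl⟩, a, rfl⟩
    exact ⟨(⟨a.1.1, a.2.1⟩, c.proj ⟨a.1.2, a.2.2⟩), ⟨c, hc, _, rfl⟩, rfl⟩
  · rintro ⟨⟨w, _⟩, ⟨c, hc, a, rfl⟩, rfl⟩
    exact ⟨_, ⟨c, hc, rfl⟩, ⟨(w.1, a.1), w.2, a.2⟩, rfl⟩

variable {F I : Finset ι} (hF : D.IsFace F) (hI : D.IsBasisIndex I)
  (hIF : D.spanX (I ∩ F) = D.spanX F)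

theorem bijOn_triv {P : Set (D.cone F).XDelta} {P' : Set D.XDelta} (hP' : P' ⊆ D.nbhd F)
    (h : ∀ (w : PTorus (I \ F)) (v : (D.cone F).CDelta), (D.cone F).toQuot v ∈ P ↔
      D.toQuot ⟨fill F I w.1 v, fill_mem_CDelta hF w.2 v.2⟩ ∈ P') :
    Set.BijOn (fun x => (D.triv hF hI hIF x : D.XDelta)) (D.twistedPiece F I P) P' := by
  refine ⟨?_, (Subtype.val_injective.comp (D.triv hF hI hIF).injective).injOn, ?_⟩
  · rintro _ ⟨⟨w, y⟩, hy, rfl⟩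
    obtain ⟨v, rfl⟩ := (D.cone F).exists_toQuot_eq y
    exact (h w v).1 hy
  · intro x hx
    obtain ⟨y, hy⟩ := (D.triv hF hI hIF).surjective ⟨x, hP' hx⟩
    obtain ⟨⟨w, y⟩, rfl⟩ := Quotient.exists_rep y
    obtain ⟨v, rfl⟩ := (D.cone F).exists_toQuot_eq y
    have hx' : D.toQuot ⟨fill F I w.1 v, fill_mem_CDelta hF w.2 v.2⟩ = x := congrArg Subtype.val hy
    exact ⟨_, ⟨(w, (D.cone F).toQuot v), (h w v).2 (hx' ▸ hx), rfl⟩, hx'⟩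

theorem toQuot_mem_cone_stratum_iff {K : Finset F} (hK : (D.cone F).IsFace K) (w : PTorus (I \ F))
    (v : (D.cone F).CDelta) : (D.cone F).toQuot v ∈ (D.cone F).stratum K ↔
      D.toQuot ⟨fill F I w.1 v, fill_mem_CDelta hF w.2 v.2⟩ ∈ D.stratum (lift F K) := by
  rw [toQuot_mem_stratum_iff hK, toQuot_mem_stratum_iff ((cone_isFace_iff hF K).1 hK)]
  simp only [hull_fill hF w.2]
  exact (Finset.map_injective _).eq_iff.symm

theorem toQuot_mem_cone_regularPiece_iff [FiniteDimensional ℝ V] (w : PTorus (I \ F))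
    (v : (D.cone F).CDelta) : (D.cone F).toQuot v ∈ (D.cone F).regularPiece ↔
      D.toQuot ⟨fill F I w.1 v, fill_mem_CDelta hF w.2 v.2⟩ ∈ D.regularPiece ∩ D.nbhd F := by
  have : D.toQuot ⟨fill F I w.1 v, fill_mem_CDelta hF w.2 v.2⟩ ∈ D.nbhd F :=
    (toQuot_mem_nbhd_iff hF _).2 (D.hull_subset_of_fill hF w v)
  rw [Set.mem_inter_iff, and_iff_left this, toQuot_mem_regularPiece_iff, toQuot_mem_regularPiece_iff,
    cone_isRegularFace_iff hF]
  simp only [hull_fill hF w.2]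

theorem mem_glue_sdiff_iff {B K : Finset F} (j : ι) :
    j ∈ glue F I B \ lift F K ↔ j ∈ I \ F ∨ j ∈ lift F (B \ K) := by
  simp only [Finset.mem_sdiff, Finset.mem_union, mem_lift]
  constructor
  · rintro ⟨h | ⟨hF, hB⟩, hK⟩
    · exact Or.inl h
    · exact Or.inr ⟨hF, hB, fun h => hK ⟨hF, h⟩⟩
  · rintro (h | ⟨hF, hB, hK⟩)
    · exact ⟨Or.inl h, fun ⟨hF, _⟩ => h.2 hF⟩
    · exact ⟨Or.inr ⟨hF, hB⟩, fun ⟨_, h⟩ => hK h⟩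

theorem twistedChart_stratumChart_isRestrictionOf {K : Finset F} (hK : (D.cone F).IsFace K)
    (hG : D.IsFace (lift F K)) (B : Finset F) :
    (D.twistedChart F I ((D.cone F).stratumChart K hK B)).IsRestrictionOf
      (fun x => (D.triv hF hI hIF x : D.XDelta))
      (D.stratumChart (lift F K) hG (glue F I B)) := by
  let R := (joinEquiv (S := glue F I B \ lift F K) (I := I) (F := F) (T := B \ K)
    mem_glue_sdiff_iff).toContinuousLinearEquiv
  have hdom : ∀ a, a ∈ (D.twistedChart F I ((D.cone F).stratumChart K hK B)).dom ↔
      R a ∈ (D.stratumChart (lift F K) hG (glue F I B)).dom :=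
    fun a => (joinEquiv_ne_zero_iff mem_glue_sdiff_iff a).symm
  refine ⟨R, Set.univ, isOpen_univ, Set.subset_univ _, fun a _ ha => (hdom a).2 ha,
    fun a ha => (hdom a).1 ha, fun a => ?_⟩
  exact congrArg D.toQuot (Subtype.ext (fill_slicePoint mem_glue_sdiff_iff K a.1))

theorem twistedChart_regularChart_isRestrictionOf [FiniteDimensional ℝ V] (B : Finset F) :
    (D.twistedChart F I ((D.cone F).regularChart B)).IsRestrictionOf
      (fun x => (D.triv hF hI hIF x : D.XDelta)) (D.regularChart (glue F I B)) := by
  have hS : ∀ j, j ∈ glue F I B ↔ j ∈ I \ F ∨ j ∈ lift F B := fun j => Finset.mem_union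
  have hfill : ∀ p : ((I \ F : Finset ι) → ℂ) × (B → ℂ),
      fill F I p.1 (slicePoint B ∅ p.2) = slicePoint (glue F I B) ∅ (joinEquiv hS p) :=
    fun p => fill_slicePoint hS ∅ p
  -- The regular chart of the glued basis may contain points with zeros in `I \ F`, which the torus
  -- factor excludes; so the restriction to an open set is needed here, unlike for singular strata.
  refine ⟨(joinEquiv hS).toContinuousLinearEquiv,
    {a : ((I \ F : Finset ι) → ℂ) × (B → ℂ) | ∀ j, a.1 j ≠ 0}, ?_, fun a ha => ha.1, ?_, ?_, ?_⟩
  · have h : IsOpen {a : ((I \ F : Finset ι) → ℂ) × (B → ℂ) | ∀ j, a.1 j ≠ 0} := by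
      simp only [Set.ofPred_forall]
      exact isOpen_iInter_of_finite fun j => isOpen_ne_fun
        ((continuous_apply j).comp continuous_fst) continuous_const
    exact h
  · rintro ⟨a, v⟩ ha ⟨J, hJ, h⟩
    have h' : ∀ j, fill F I a (slicePoint B ∅ v) j = 0 ↔ j ∈ J := fun j => by
      rw [hfill (a, v)]
      exact h j
    obtain ⟨K, rfl⟩ := exists_lift_eq (F := F) (J := J) fun j hj => by
      by_contra hjF
      exact fill_ne_zero_of_notMem ha hjF ((h' j).2 hj)
    refine ⟨ha, K, (cone_isRegularFace_iff hF K).2 hJ, fun j => ?_⟩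
    rw [← coe_mem_lift, ← h', fill_of_mem j.2]
  · rintro ⟨a, v⟩ ⟨ha, K, hK, h⟩
    refine ⟨lift F K, (cone_isRegularFace_iff hF K).1 hK, fun j => ?_⟩
    change slicePoint (glue F I B) ∅ (joinEquiv hS (a, v)) j = 0 ↔ _
    rw [← hfill]
    by_cases hjF : j ∈ F
    · rw [fill_of_mem hjF, h, ← coe_mem_lift]
    · exact iff_of_false (fill_ne_zero_of_notMem ha hjF) fun h' => hjF (lift_subset h')
  · intro a
    exact congrArg D.toQuot (Subtype.ext (hfill a.1))

end Pieces

/-! ### Biholomorphy of the trivialization on each piece. -/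

section Biholomorphic

variable {V ι : Type*} [AddCommGroup V] [Module ℝ V] [FiniteDimensional ℝ V]
  [Fintype ι] [DecidableEq ι] (D : PolyhedralData V ι)

/-- The vertex that contains `I` also contains `F`, as `I` is adapted to `F`, and hence contains the
glued index set. -/
theorem glue_isBasisSet {F I : Finset ι} (hF : D.IsFace F) (hI : D.IsBasisSet I)
    (hIF : D.spanX (I ∩ F) = D.spanX F) {B : Finset F} (hB : (D.cone F).IsBasisIndex B) :
    D.IsBasisSet (glue F I B) := by
  obtain ⟨M, hM, hM0, hIM⟩ := hI.2.2
  refine (hI.isBasisIndex.glue hIF hB).isBasisSet hM hM0 (Finset.union_subset ?_ ?_)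
  · exact Finset.sdiff_subset.trans hIM
  · exact lift_subset.trans (subset_of_spanX_inter_eq hF hM hIM hIF)

theorem isBiholomorphicOn_stratum {F I : Finset ι} (hF : D.IsFace F) (hI : D.IsBasisSet I)
    (hIF : D.spanX (I ∩ F) = D.spanX F) {K : Finset F} (hK : (D.cone F).IsFace K)
    (hG : D.IsFace (lift F K)) :
    IsBiholomorphicOn (fun x => (D.triv hF hI.isBasisIndex hIF x : D.XDelta))
      (D.twistedPiece F I ((D.cone F).stratum K))
      (D.twistedChart F I '' (D.cone F).stratumAtlas K hK)
      (D.stratum (lift F K)) (D.stratumAtlas (lift F K) hG) := by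
  refine isBiholomorphicOn_of_isRestrictionOf
    (D.bijOn_triv hF _ hIF (stratum_subset_nbhd hG hF lift_subset)
      (D.toQuot_mem_cone_stratum_iff hF hK))
    (D.twistedChart_cover (stratumAtlas_cover (cone_isFace_univ hF) (cone_faceDim_univ hF) hK))
    ?_ ?_
  · rintro _ ⟨_, ⟨B, hB, hBK, rfl⟩, rfl⟩
    have hB' := D.glue_isBasisSet hF hI hIF hB.isBasisIndex
    refine ⟨_, ⟨_, hB', ?_, rfl⟩,
      D.twistedChart_stratumChart_isRestrictionOf hF hI.isBasisIndex hIF hK hG B⟩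
    rw [← hB'.isBasisIndex.spanX_inter_eq_iff hG, glue_inter, ← map_cone_spanX, ← map_cone_spanX,
      (hB.isBasisIndex.spanX_inter_eq_iff hK).2 hBK]
  · rintro _ ⟨B, hB, hBG, rfl⟩ _ ⟨B', hB', hBG', rfl⟩
    exact stratumChart_lifts hG hB.isBasisIndex hB'.isBasisIndex
      ((hB.isBasisIndex.spanX_inter_eq_iff hG).2 hBG)
      ((hB'.isBasisIndex.spanX_inter_eq_iff hG).2 hBG')

theorem isBiholomorphicOn_regularPiece {F I : Finset ι} (hF : D.IsFace F) (hI : D.IsBasisSet I)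
    (hIF : D.spanX (I ∩ F) = D.spanX F) :
    IsBiholomorphicOn (fun x => (D.triv hF hI.isBasisIndex hIF x : D.XDelta))
      (D.twistedPiece F I (D.cone F).regularPiece)
      (D.twistedChart F I '' (D.cone F).regularAtlas)
      (D.regularPiece ∩ D.nbhd F) D.regularAtlas := by
  refine isBiholomorphicOn_of_isRestrictionOf
    (D.bijOn_triv hF _ hIF Set.inter_subset_right (D.toQuot_mem_cone_regularPiece_iff hF))
    (D.twistedChart_cover (regularAtlas_cover (cone_isFace_univ hF) (cone_faceDim_univ hF))) ?_ ?_
  · rintro _ ⟨_, ⟨B, hB, rfl⟩, rfl⟩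
    exact ⟨_, ⟨_, D.glue_isBasisSet hF hI hIF hB.isBasisIndex, rfl⟩,
      D.twistedChart_regularChart_isRestrictionOf hF hI.isBasisIndex hIF B⟩
  · rintro _ ⟨B, hB, rfl⟩ _ ⟨B', hB', rfl⟩
    exact regularChart_lifts hB.isBasisIndex hB'.isBasisIndex

end Biholomorphic

end PolyhedralData

end

theorem mainTheorem9 {V ι : Type*} [AddCommGroup V] [Module ℝ V] [FiniteDimensional ℝ V]
    [Fintype ι] [DecidableEq ι] (D : PolyhedralData V ι) (hQ : IsQuasilattice D.Q)
    (hD : D.IsConvexPolytope) (F : Finset ι) (hF : D.IsSingularFace F)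
    (I : Finset ι) (hI : D.IsBasisSet I)
    (hIF : (I ∩ F).card + D.faceDim F = Module.finrank ℝ V) :
    -- the set `((ℂ^*)^{F^c} × ℂ^F) // N_ℂ` is an open neighbourhood of the stratum
    IsOpen (D.nbhd F) ∧ D.stratum F ⊆ D.nbhd F ∧
    -- the stratum is `(ℂ^*)^{I ∖ (I ∩ I_F)} / Γ̌_I`
    (∃ φ : MulAction.orbitRel.Quotient (D.GammaCheck F I)
          (PolyhedralData.PTorus (I \ F)) ≃ₜ D.stratum F,
      ∀ w : PolyhedralData.PTorus (I \ F),
        (φ (Quotient.mk _ w) : D.XDelta) = (D.stratumChart F hF.1 I).proj w) ∧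
    -- the singular faces of the cone correspond to the singular faces of the polytope that
    -- contain `F`, and these give the singular pieces that meet the neighbourhood
    (∀ K : Finset F, (D.cone F).IsSingularFace K ↔
      D.IsSingularFace (K.map (Function.Embedding.subtype _))) ∧
    (∀ G, D.IsSingularFace G → ((D.stratum G ∩ D.nbhd F).Nonempty ↔ G ⊆ F)) ∧
    -- the local trivialization
    ∃ h : D.TwistedProduct F I ≃ₜ D.nbhd F,
      (∀ (K : Finset F) (hK : (D.cone F).IsSingularFace K)
          (hG : D.IsSingularFace (K.map (Function.Embedding.subtype _))),
        IsBiholomorphicOn (fun x => (h x : D.XDelta))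
          (D.twistedPiece F I ((D.cone F).stratum K))
          (D.twistedChart F I '' (D.cone F).stratumAtlas K hK.1)
          (D.stratum (K.map (Function.Embedding.subtype _)))
          (D.stratumAtlas (K.map (Function.Embedding.subtype _)) hG.1)) ∧
      IsBiholomorphicOn (fun x => (h x : D.XDelta))
        (D.twistedPiece F I (D.cone F).regularPiece)
        (D.twistedChart F I '' (D.cone F).regularAtlas)
        (D.regularPiece ∩ D.nbhd F)
        D.regularAtlas := by
  have hI' := hI.isBasisIndex
  -- The cardinality condition is used only in this form: `I ∩ F` spans the same subspace as `F`.
  have hIF' := (hI'.spanX_inter_eq_iff hF.1).2 hIF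
  refine ⟨PolyhedralData.isOpen_nbhd hF.1,
    PolyhedralData.stratum_subset_nbhd hF.1 hF.1 subset_rfl,
    ⟨D.stratumHomeomorph hF.1 hI' hIF', D.stratumHomeomorph_mk hF.1 hI' hIF'⟩,
    PolyhedralData.cone_isSingularFace_iff hF.1,
    fun G hG => PolyhedralData.stratum_inter_nbhd_nonempty_iff hG.1 hF.1,
    D.triv hF.1 hI' hIF', fun K hK hG => ?_, ?_⟩
  · exact D.isBiholomorphicOn_stratum hF.1 hI hIF' hK.1 hG.1
  · exact D.isBiholomorphicOn_regularPiece hF.1 hI hIF'
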